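/- Let $d\ge 2$, let $\mathbf A\in C^1(\mathbb S^{d-1};\mathbb R^d)$ satisfy $\mathbf A(\theta)\cdot\theta=0$ for all $\theta$, and let $a\in L^\infty(\mathbb S^{d-1};\mathbb R)$. For $b\in\{0,a\}$ let $L_{\mathbf A,b}=(-i\nabla_{\mathbb S^{d-1}}+\mathbf A)^2+b$ on $L^2(\mathbb S^{d-1})$ (the operator of the closure of its quadratic form on $C^\infty(\mathbb S^{d-1})$), and let $\mathcal L_{\mathbf A,b}=\big(-i\nabla+\tfrac{\mathbf A(x/|x|)}{|x|}\big)^2+\tfrac{b(x/|x|)}{|x|^2}$ on $L^2(\mathbb R^d)$ be the Friedrichs extension of its quadratic form on $C_c^\infty(\mathbb R^d\setminus\{0\})$. For $j\in\mathbb N=\{0,1,\dots\}$ put $\eta_j=\sqrt{j(j+d-2)}$ and let $m_j$ be the multiplicity of the eigenvalue $\eta_j^2$ of $-\Delta_{\mathbb S^{d-1}}$, i.e. $m_j=\binom{d+j-1}{j}-\binom{d+j-3}{j-2}$ (the second binomial coefficient being $0$ for $j<2$). Assume that there are $\ell,\ell_0\in\mathbb N$ and $C\in(0,\tfrac12)$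 such that, with the index set $\mathcal I=\{1,\dots,\ell_0\}\cup\{(j,k): j\ge\ell,\ 1\le k\le m_j\}$, there are orthonormal bases $(e_\alpha)_{\alpha\in\mathcal I}$ and $(\phi_\alpha)_{\alpha\in\mathcal I}$ of $L^2(\mathbb S^{d-1})$ with $$L_{\mathbf A,0}\,e_\alpha=\mu_\alpha^2 e_\alpha,\qquad L_{\mathbf A,a}\,\phi_\alpha=\nu_\alpha^2\phi_\alpha ,$$ where, for $j\ge \ell$, the numbers $\mu_{jk},\nu_{jk}$ are real, with $$\eta_j+C-\tfrac12<\mu_{j1}\le\dots\le\mu_{jm_j}\le\eta_j+C+\tfrac12,\qquad \eta_j+C-\tfrac12<\nu_{j1}\le\dots\le\nu_{jm_j}\le\eta_j+C+\tfrac12,$$ and where, for $i=1,\dots,\ell_0$, the symbols $\mu_i^2,\nu_i^2$ denote (possibly negative) real numbers with $\mu_i^2,\nu_i^2\ge-\big(\tfrac{d-2}{2}\big)^2$. Put $\tilde\mu_\alpha=\sqrt{\mu_\alpha^2+(\frac{d-2}2)^2}$ and $\tilde\nu_\alpha=\sqrt{\nu_\alpha^2+(\frac{d-2}2)^2}$.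 For $\nu\ge0$ let $\mathcal H_\nu$ be the Hankel transform $$\mathcal H_\nu g(\lambda)=\int_0^\infty (r\lambda)^{-\frac{d-2}2}J_\nu(r\lambda)\,g(r)\,r^{d-1}\,dr$$ on $L^2((0,\infty),r^{d-1}dr)$, the integral being the $L^2$-limit of the integrals over $(0,R)$ as $R\to\infty$. For $f\in L^2(\mathbb R^d)$ put $f_\alpha(r)=\int_{\mathbb S^{d-1}}f(r\theta)\overline{e_\alpha(\theta)}\,d\theta$ and $\tilde f_\alpha(r)=\int_{\mathbb S^{d-1}}f(r\theta)\overline{\phi_\alpha(\theta)}\,d\theta$. **Lemma (Intertwining property).** The formula $$Wf(r\theta)=\sum_{\alpha\in\mathcal I}\big(\mathcal H_{\tilde\nu_\alpha}\mathcal H_{\tilde\mu_\alpha}f_\alpha\big)(r)\,\phi_\alpha(\theta)$$ (convergent in $L^2(\mathbb R^d)$) defines a bounded operator $W$ on $L^2(\mathbb R^d)$, whose adjoint is $$W^*f(r\theta)=\sum_{\alpha\in\mathcal I}\big(\mathcal H_{\tilde\mu_\alpha}\mathcal H_{\tilde\nu_\alpha}\tilde f_\alpha\big)(r)\,e_\alpha(\theta).$$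 $W$ is unitary, $WW^*=W^*W=I$, and for every bounded Borel function $F:\mathbb R\to\mathbb C$ $$F(\mathcal L_{\mathbf A,a})=W\,F(\mathcal L_{\mathbf A,0})\,W^*,$$ where $F(\mathcal L)=\int F\,dE$ with $E$ the spectral measure of $\mathcal L$, which exists for both operators. -/

import Mathlib

open MeasureTheory Filter Topology Set
open scoped ENNReal ContDiff ComplexConjugate

noncomputable section

namespace Intertwining

/-! ## Spaces -/

/-- Euclidean space `ℝ^d`. -/
abbrev Space (d : ℕ) := EuclideanSpace ℝ (Fin d)

/-- The unit sphere `S^{d-1}` of `ℝ^d`. -/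
abbrev Sph (d : ℕ) := Metric.sphere (0 : Space d) 1

/-- The surface measure on `S^{d-1}`. -/
abbrev surfaceMeasure (d : ℕ) : Measure (Sph d) := (volume : Measure (Space d)).toSphere

/-- The measure `r^{d-1} dr` on `(0, ∞)`. -/
abbrev radialMeasure (d : ℕ) : Measure (Ioi (0 : ℝ)) := Measure.volumeIoiPow (d - 1)

/-- `L²(ℝ^d; ℂ)`. -/
abbrev L2Space (d : ℕ) := Lp ℂ 2 (volume : Measure (Space d))

/-- `L²(S^{d-1}; ℂ)`. -/
abbrev L2Sphere (d : ℕ) := Lp ℂ 2 (surfaceMeasure d)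

/-- `L²((0, ∞), r^{d-1} dr; ℂ)`. -/
abbrev L2Radial (d : ℕ) := Lp ℂ 2 (radialMeasure d)

/-- Polar coordinates `x ↦ (x / |x|, |x|)` on `ℝ^d ∖ {0}`. -/
abbrev polar (d : ℕ) : ({0}ᶜ : Set (Space d)) ≃ₜ Sph d × Ioi (0 : ℝ) :=
  homeomorphUnitSphereProd (Space d)

open Classical in
/-- The function `x ↦ G (x / |x|, |x|)` on `ℝ^d ∖ {0}`, with value `0` at the origin. -/
def ofPolar {d : ℕ} {β : Type*} [Zero β] (G : Sph d × Ioi (0 : ℝ) → β) (x : Space d) : β :=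
  if h : x ∈ ({0}ᶜ : Set (Space d)) then G (polar d ⟨x, h⟩) else 0

/-- The extension of a function on the sphere to `ℝ^d ∖ {0}` which is homogeneous of degree
zero: `x ↦ f (x / |x|)`. -/
def homExt {d : ℕ} {β : Type*} [Zero β] (f : Sph d → β) : Space d → β :=
  ofPolar fun p => f p.1

theorem homExt_coe {d : ℕ} {β : Type*} [Zero β] (f : Sph d → β) (θ : Sph d) :
    homExt f (θ : Space d) = f θ := by
  have hθ : (θ : Space d) ∈ ({0}ᶜ : Set (Space d)) := by
    simp only [mem_compl_iff, mem_singleton_iff]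
    intro h
    have := norm_eq_of_mem_sphere θ
    rw [h] at this
    simp at this
  rw [homExt, ofPolar, dif_pos hθ]
  congr 1
  ext1
  simp

theorem homExt_add {d : ℕ} (f g : Sph d → ℂ) : homExt (f + g) = homExt f + homExt g := by
  funext x
  by_cases h : x ∈ ({0}ᶜ : Set (Space d)) <;> simp [homExt, ofPolar, h]

theorem homExt_smul {d : ℕ} (c : ℂ) (f : Sph d → ℂ) : homExt (c • f) = c • homExt f := by
  funext x
  by_cases h : x ∈ ({0}ᶜ : Set (Space d)) <;> simp [homExt, ofPolar, h]

/-! ## Separation of variables -/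

theorem measurePreserving_polar (d : ℕ) :
    MeasurePreserving (polar d) ((volume : Measure (Space d)).comap (↑))
      ((surfaceMeasure d).prod (radialMeasure d)) := by
  have := (volume : Measure (Space d)).measurePreserving_homeomorphUnitSphereProd
  rwa [finrank_euclideanSpace_fin] at this

theorem memLp_ofPolar {d : ℕ} (g : L2Radial d) (ψ : L2Sphere d) :
    MemLp (ofPolar fun p => g p.2 * ψ p.1) 2 (volume : Measure (Space d)) := by
  have h1 : MemLp (fun p : Sph d × Ioi (0 : ℝ) => g p.2 * ψ p.1) 2
      ((surfaceMeasure d).prod (radialMeasure d)) := by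
    have hm : AEStronglyMeasurable (fun p : Sph d × Ioi (0 : ℝ) => g p.2 * ψ p.1)
        ((surfaceMeasure d).prod (radialMeasure d)) :=
      (Lp.aestronglyMeasurable g).comp_snd.mul (Lp.aestronglyMeasurable ψ).comp_fst
    rw [memLp_two_iff_integrable_sq_norm hm]
    have h := ((memLp_two_iff_integrable_sq_norm (Lp.aestronglyMeasurable ψ)).1
      (Lp.memLp ψ)).mul_prod ((memLp_two_iff_integrable_sq_norm (Lp.aestronglyMeasurable g)).1
      (Lp.memLp g))
    refine h.congr (Eventually.of_forall fun p => ?_)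
    simp only [norm_mul, mul_pow]
    ring
  have h2 := h1.comp_measurePreserving (measurePreserving_polar d)
  have hs : MeasurableSet ({0}ᶜ : Set (Space d)) := (measurableSet_singleton _).compl
  have h3 : MemLp (ofPolar (d := d) fun p => g p.2 * ψ p.1) 2
      ((volume : Measure (Space d)).restrict {0}ᶜ) := by
    rw [← map_comap_subtype_coe hs, (MeasurableEmbedding.subtype_coe hs).memLp_map_measure_iff]
    refine h2.congr_norm ?_ (Eventually.of_forall fun x => ?_)
    · refine h2.aestronglyMeasurable.congr (Eventually.of_forall fun x => ?_)
      simp [ofPolar]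
    · simp [ofPolar]
  rw [← memLp_indicator_iff_restrict hs] at h3
  refine h3.ae_eq (Eventually.of_forall fun x => ?_)
  by_cases hx : x ∈ ({0}ᶜ : Set (Space d))
  · simp [hx]
  · simp only [indicator_of_notMem hx, ofPolar, hx, dite_false]

/-- The function `x ↦ g(|x|) ψ(x / |x|)` as an element of `L²(ℝ^d)`. -/
def separated {d : ℕ} (g : L2Radial d) (ψ : L2Sphere d) : L2Space d :=
  (memLp_ofPolar g ψ).toLp _

theorem memLp_coeff {d : ℕ} (ψ : L2Sphere d) (f : L2Space d) :
    MemLp (fun r : Ioi (0 : ℝ) =>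
      ∫ θ : Sph d, f ((r : ℝ) • (θ : Space d)) * conj (ψ θ) ∂(surfaceMeasure d))
      2 (radialMeasure d) := by
  set σ := surfaceMeasure d
  set ρ := radialMeasure d
  have hs : MeasurableSet ({0}ᶜ : Set (Space d)) := (measurableSet_singleton _).compl
  -- `f` in polar coordinates
  have h1 : MemLp (fun p : Sph d × Ioi (0 : ℝ) => f ((p.2 : ℝ) • (p.1 : Space d))) 2
      (σ.prod ρ) := by
    have h2 : MemLp (fun x : ({0}ᶜ : Set (Space d)) => f x) 2
        ((volume : Measure (Space d)).comap (↑)) := by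
      have h3 := (Lp.memLp f).restrict ({0}ᶜ : Set (Space d))
      rwa [← map_comap_subtype_coe hs,
        (MeasurableEmbedding.subtype_coe hs).memLp_map_measure_iff] at h3
    have h4 := h2.comp_measurePreserving
      ((measurePreserving_polar d).symm (polar d).toMeasurableEquiv)
    refine h4.ae_eq (Eventually.of_forall fun p => ?_)
    change f (((polar d).symm p : ({0}ᶜ : Set (Space d))) : Space d) = _
    simp
  have hm : AEStronglyMeasurable (fun p : Sph d × Ioi (0 : ℝ) =>
      f ((p.2 : ℝ) • (p.1 : Space d)) * conj (ψ p.1)) (σ.prod ρ) :=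
    h1.aestronglyMeasurable.mul
      (Complex.continuous_conj.comp_aestronglyMeasurable
        (Lp.aestronglyMeasurable ψ)).comp_fst
  have hsec : ∀ᵐ r : Ioi (0 : ℝ) ∂ρ, AEStronglyMeasurable
      (fun θ : Sph d => f ((r : ℝ) • (θ : Space d))) σ :=
    h1.aestronglyMeasurable.prod_swap.prodMk_left
  have hfin : ∫⁻ r : Ioi (0 : ℝ), ∫⁻ θ : Sph d, ‖f ((r : ℝ) • (θ : Space d))‖ₑ ^ (2 : ℝ) ∂σ ∂ρ < ⊤ := by
    have h5 := lintegral_rpow_enorm_lt_top_of_eLpNorm_lt_top (by simp) (by simp) h1.eLpNorm_lt_top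
    rw [lintegral_prod_symm _ (h1.aestronglyMeasurable.enorm.pow_const _)] at h5
    simpa using h5
  have hψ : ∫⁻ θ, ‖ψ θ‖ₑ ^ (2 : ℝ) ∂σ < ⊤ := by
    simpa using lintegral_rpow_enorm_lt_top_of_eLpNorm_lt_top (by simp) (by simp)
      (Lp.memLp ψ).eLpNorm_lt_top
  refine ⟨hm.prod_swap.integral_prod_right', ?_⟩
  rw [eLpNorm_lt_top_iff_lintegral_rpow_enorm_lt_top (by simp) (by simp)]
  refine lt_of_le_of_lt (lintegral_mono_ae (g := fun r : Ioi (0 : ℝ) =>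
    (∫⁻ θ, ‖f ((r : ℝ) • (θ : Space d))‖ₑ ^ (2 : ℝ) ∂σ) * ∫⁻ θ, ‖ψ θ‖ₑ ^ (2 : ℝ) ∂σ) ?_) ?_
  · filter_upwards [hsec] with r hr
    have h6 : ‖∫ θ : Sph d, f ((r : ℝ) • (θ : Space d)) * conj (ψ θ) ∂σ‖ₑ ≤
        (∫⁻ θ, ‖f ((r : ℝ) • (θ : Space d))‖ₑ ^ (2 : ℝ) ∂σ) ^ (1 / (2 : ℝ)) *
          (∫⁻ θ, ‖ψ θ‖ₑ ^ (2 : ℝ) ∂σ) ^ (1 / (2 : ℝ)) := by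
      refine (enorm_integral_le_lintegral_enorm _).trans ?_
      refine le_trans (le_of_eq ?_) (ENNReal.lintegral_mul_le_Lp_mul_Lq σ
        (Real.holderConjugate_iff.2 ⟨by norm_num, by norm_num⟩) hr.enorm
        (Lp.aestronglyMeasurable ψ).enorm)
      refine lintegral_congr fun θ => ?_
      simp [enorm_mul]
    calc _ ≤ _ := ENNReal.rpow_le_rpow h6 (by simp)
      _ = _ := by
        rw [ENNReal.mul_rpow_of_nonneg _ _ (by simp), ← ENNReal.rpow_mul, ← ENNReal.rpow_mul]
        simp
  · rw [lintegral_mul_const' _ _ hψ.ne]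
    exact ENNReal.mul_lt_top hfin hψ

/-- The radial coefficient `f_ψ(r) = ∫_{S^{d-1}} f(rθ) conj(ψ(θ)) dθ` of `f ∈ L²(ℝ^d)`. -/
def coeff {d : ℕ} (ψ : L2Sphere d) (f : L2Space d) : L2Radial d :=
  (memLp_coeff ψ f).toLp _

/-! ## Bessel functions and the Hankel transform -/

/-- The Bessel function of the first kind `J_ν(x)`, for `x > 0`. -/
def besselJ (ν x : ℝ) : ℝ :=
  ∑' k : ℕ, (-1) ^ k / (k.factorial * Real.Gamma (k + ν + 1)) * (x / 2) ^ (2 * (k : ℝ) + ν)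

/-- The truncated Hankel integral
`∫_0^R (rξ)^{-(d-2)/2} J_ν(rξ) f(r) r^{d-1} dr`. -/
def truncatedHankel {d : ℕ} (ν R : ℝ) (f : L2Radial d) (ξ : Ioi (0 : ℝ)) : ℂ :=
  ∫ r in {r : Ioi (0 : ℝ) | (r : ℝ) ≤ R},
    (((r * ξ : ℝ) ^ (-(((d : ℝ) - 2) / 2)) * besselJ ν (r * ξ) : ℝ) : ℂ) * f r ∂(radialMeasure d)

/-- `g` is the Hankel transform of order `ν` of `f`: the truncated integrals converge to `g` in
`L²((0, ∞), ξ^{d-1} dξ)`. -/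
def IsHankel {d : ℕ} (ν : ℝ) (f g : L2Radial d) : Prop :=
  Tendsto (fun R : ℝ => eLpNorm (fun ξ => truncatedHankel ν R f ξ - g ξ) 2 (radialMeasure d))
    atTop (𝓝 0)

open Classical in
/-- The Hankel transform of order `ν` on `L²((0, ∞), r^{d-1} dr)` (for `ν ≥ 0` the limit exists
for every `f`, and it is unique). -/
def hankel {d : ℕ} (ν : ℝ) (f : L2Radial d) : L2Radial d :=
  if h : ∃ g, IsHankel ν f g then h.choose else 0

/-! ## The operator of a quadratic form -/

/-- The graph of the operator associated with the closure of a hermitian form `q` on a space of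
test functions `V`, embedded by `j` into the Hilbert space `H`: `(u, f)` belongs to it if there is
a sequence of test functions which converges to `u` in `H`, is Cauchy for `q`, and satisfies
`q(ψ, w n) → ⟨ψ, f⟩` for all test functions `ψ`. (Forms and inner products are conjugate-linear in
the first variable.) -/
def formGraph {V H : Type*} [AddCommGroup V] [NormedAddCommGroup H] [InnerProductSpace ℂ H]
    (j : V → H) (q : V → V → ℂ) : Set (H × H) :=
  {p | ∃ w : ℕ → V,
    Tendsto (fun n => j (w n)) atTop (𝓝 p.1) ∧
    Tendsto (fun nm : ℕ × ℕ => q (w nm.1 - w nm.2) (w nm.1 - w nm.2)) atTop (𝓝 0) ∧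
    ∀ ψ : V, Tendsto (fun n => q ψ (w n)) atTop (𝓝 (inner ℂ (j ψ) p.2))}

/-- The Friedrichs operator of a form. For a densely defined closable form which is bounded below,
`formGraph j q` is already the graph of a linear operator, so that the span changes nothing. -/
def friedrichs {V H : Type*} [AddCommGroup V] [NormedAddCommGroup H] [InnerProductSpace ℂ H]
    (j : V → H) (q : V → V → ℂ) : H →ₗ.[ℂ] H :=
  (Submodule.span ℂ (formGraph j q)).toLinearPMap

/-! ## The electromagnetic Hamiltonian on `ℝ^d` -/

/-- `ℝ^d ∖ {0}` as an open set. -/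
def punctured (d : ℕ) : TopologicalSpace.Opens (Space d) := ⟨{0}ᶜ, isOpen_compl_singleton⟩

/-- `C_c^∞(ℝ^d ∖ {0}; ℂ)`. -/
abbrev TestSpace (d : ℕ) := TestFunction (punctured d) ℂ ⊤

/-- A test function as an element of `L²(ℝ^d)`. -/
def testToL2 {d : ℕ} (u : TestSpace d) : L2Space d :=
  (u.contDiff.continuous.memLp_of_hasCompactSupport u.hasCompactSupport).toLp u

/-- The `i`-th component of `∇u + i (A(x/|x|) / |x|) u`. -/
def magneticGrad {d : ℕ} (A : Sph d → Space d) (u : Space d → ℂ) (x : Space d) (i : Fin d) : ℂ :=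
  fderiv ℝ u x (EuclideanSpace.single i 1) +
    Complex.I * ((homExt A x i / ‖x‖ : ℝ) : ℂ) * u x

/-- The form `∫ conj(∇_A u) · ∇_A v + (a(x/|x|) / |x|²) conj(u) v dx`, where
`∇_A = ∇ + i A(x/|x|) / |x|`. -/
def hamiltonianForm {d : ℕ} (A : Sph d → Space d) (a : Sph d → ℝ) (u v : TestSpace d) : ℂ :=
  ∫ x : Space d, (∑ i, conj (magneticGrad A u x i) * magneticGrad A v x i) +
    ((homExt a x / ‖x‖ ^ 2 : ℝ) : ℂ) * (conj (u x) * v x)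

/-- The Hamiltonian `(-i∇ + A(x/|x|) / |x|)² + a(x/|x|) / |x|²`, as the Friedrichs extension from
`C_c^∞(ℝ^d ∖ {0})`. -/
def hamiltonian {d : ℕ} (A : Sph d → Space d) (a : Sph d → ℝ) : L2Space d →ₗ.[ℂ] L2Space d :=
  friedrichs testToL2 (hamiltonianForm A a)

/-! ## The spherical operator -/

/-- `C^∞(S^{d-1}; ℂ)`: the functions whose homogeneous extension of degree zero is smooth away
from the origin. -/
def SmoothSphere (d : ℕ) : Submodule ℂ (Sph d → ℂ) where
  carrier := {ψ | ContDiffOn ℝ ∞ (homExt ψ) {0}ᶜ}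
  add_mem' hf hg := by
    simp only [mem_ofPred_eq, homExt_add] at *
    exact hf.add hg
  zero_mem' := by
    have : homExt (0 : Sph d → ℂ) = fun _ => 0 := by
      funext x
      by_cases h : x ∈ ({0}ᶜ : Set (Space d)) <;> simp [homExt, ofPolar, h]
    simp only [mem_ofPred_eq, this]
    exact contDiffOn_const
  smul_mem' c f hf := by
    simp only [mem_ofPred_eq, homExt_smul] at *
    exact hf.const_smul c

theorem SmoothSphere.continuous {d : ℕ} (ψ : SmoothSphere d) : Continuous (ψ : Sph d → ℂ) := by
  have h : ContDiffOn ℝ ∞ (homExt (ψ : Sph d → ℂ)) {0}ᶜ := ψ.2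
  have h2 := h.continuousOn.comp_continuous (f := fun θ : Sph d => (θ : Space d))
    continuous_subtype_val (fun θ => by
      simp only [mem_compl_iff, mem_singleton_iff]
      intro h
      have := norm_eq_of_mem_sphere θ
      rw [h] at this
      simp at this)
  exact h2.congr fun θ => homExt_coe _ θ

/-- A smooth function on the sphere as an element of `L²(S^{d-1})`. -/
def sphereToL2 {d : ℕ} (ψ : SmoothSphere d) : L2Sphere d :=
  (SmoothSphere.continuous ψ).memLp_of_hasCompactSupport (p := 2) (μ := surfaceMeasure d)
    (HasCompactSupport.of_compactSpace _) |>.toLp _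

/-- The `i`-th component of `∇_{S^{d-1}} ψ + i A ψ`; the spherical gradient of `ψ` at `θ` is the
Euclidean gradient at `θ` of the homogeneous extension of degree zero. -/
def sphericalMagneticGrad {d : ℕ} (A : Sph d → Space d) (ψ : Sph d → ℂ) (θ : Sph d)
    (i : Fin d) : ℂ :=
  fderiv ℝ (homExt ψ) (θ : Space d) (EuclideanSpace.single i 1) +
    Complex.I * ((A θ i : ℝ) : ℂ) * ψ θ

/-- The form of the spherical operator `(-i∇_{S^{d-1}} + A)² + a`. -/
def sphericalForm {d : ℕ} (A : Sph d → Space d) (a : Sph d → ℝ) (φ ψ : SmoothSphere d) : ℂ :=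
  ∫ θ : Sph d, (∑ i, conj (sphericalMagneticGrad A φ.1 θ i) * sphericalMagneticGrad A ψ.1 θ i) +
    ((a θ : ℝ) : ℂ) * (conj (φ.1 θ) * ψ.1 θ) ∂(surfaceMeasure d)

/-- `e` lies in the domain of the spherical operator `(-i∇_{S^{d-1}} + A)² + a` on `L²(S^{d-1})`,
and this operator maps it to `lam • e`. -/
def IsSphericalEigenfunction {d : ℕ} (A : Sph d → Space d) (a : Sph d → ℝ) (lam : ℝ)
    (e : L2Sphere d) : Prop :=
  (e, (lam : ℂ) • e) ∈ formGraph sphereToL2 (sphericalForm A a)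

/-! ## The spectral assumption -/

/-- The square root `√(j(j+d-2))` of the `j`-th eigenvalue of `-Δ` on `S^{d-1}`. -/
def freeRoot (d j : ℕ) : ℝ := Real.sqrt (j * (j + d - 2))

/-- The multiplicity of the `j`-th eigenvalue of `-Δ` on `S^{d-1}` (`d ≥ 2`): the dimension of the
space of spherical harmonics of degree `j`, that is, homogeneous polynomials of degree `j` modulo
`|x|²` times those of degree `j - 2`. -/
def sphereMultiplicity (d j : ℕ) : ℕ :=
  if j < 2 then (d + j - 1).choose j
  else (d + j - 1).choose j - (d + (j - 2) - 1).choose (j - 2)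

/-- The index set: `ℓ₀` low indices, and the pairs `(j, k)` with `j ≥ ℓ` and `k` below the
multiplicity of the `j`-th free eigenvalue. -/
abbrev Index (d ℓ ℓ₀ : ℕ) := Fin ℓ₀ ⊕ (Σ j : {j : ℕ // ℓ ≤ j}, Fin (sphereMultiplicity d j))

/-- The eigenvalue with a given index: `low i` for the low indices, `(μ j k)²` in the clusters. -/
def eigenvalue {d ℓ ℓ₀ : ℕ} (low : Fin ℓ₀ → ℝ) (μ : (j : ℕ) → Fin (sphereMultiplicity d j) → ℝ) :
    Index d ℓ ℓ₀ → ℝ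
  | Sum.inl i => low i
  | Sum.inr ⟨j, k⟩ => μ j k ^ 2

/-- The orthonormal basis `e` of `L²(S^{d-1})` consists of eigenfunctions of
`(-i∇_{S^{d-1}} + A)² + a`, with eigenvalues `(μ j k)²` localized in clusters for `j ≥ ℓ`, and with
`ℓ₀` further eigenvalues `low i ≥ -((d-2)/2)²`. -/
structure IsClusteredEigenbasis {d ℓ ℓ₀ : ℕ} (A : Sph d → Space d) (a : Sph d → ℝ) (C : ℝ)
    (low : Fin ℓ₀ → ℝ) (μ : (j : ℕ) → Fin (sphereMultiplicity d j) → ℝ)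
    (e : HilbertBasis (Index d ℓ ℓ₀) ℂ (L2Sphere d)) : Prop where
  mono : ∀ j, ℓ ≤ j → Monotone (μ j)
  lower : ∀ j, ℓ ≤ j → ∀ k, freeRoot d j + C - 1 / 2 < μ j k
  upper : ∀ j, ℓ ≤ j → ∀ k, μ j k ≤ freeRoot d j + C + 1 / 2
  low_ge : ∀ i, -(((d : ℝ) - 2) / 2) ^ 2 ≤ low i
  eigen : ∀ α, IsSphericalEigenfunction A a (eigenvalue low μ α) (e α)

/-- The Bessel order `√(lam + ((d-2)/2)²)` belonging to the angular eigenvalue `lam`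
(`lam ≥ -((d-2)/2)²`). -/
def besselOrder (d : ℕ) (lam : ℝ) : ℝ := Real.sqrt (lam + (((d : ℝ) - 2) / 2) ^ 2)

/-- The summand `(𝓗_{ν'} 𝓗_ν f_α)(r) φ_α(θ)`, where `f_α` is the coefficient of `f` along `e_α`,
and `ν`, `ν'` are the Bessel orders of the angular eigenvalues `lam` and `lam'`. -/
def intertwiningTerm {d : ℕ} (lam lam' : ℝ) (e φ : L2Sphere d) (f : L2Space d) : L2Space d :=
  separated (hankel (besselOrder d lam') (hankel (besselOrder d lam) (coeff e f))) φ

/-! ## Borel functional calculus of an unbounded self-adjoint operator -/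

section FunctionalCalculus

variable {H : Type*} [NormedAddCommGroup H] [InnerProductSpace ℂ H] [CompleteSpace H]

/-- A projection-valued Borel measure on `ℝ`. -/
structure ProjectionValuedMeasure (H : Type*) [NormedAddCommGroup H] [InnerProductSpace ℂ H]
    [CompleteSpace H] where
  proj : Set ℝ → H →L[ℂ] H
  isStarProjection : ∀ B, MeasurableSet B → IsStarProjection (proj B)
  univ : proj Set.univ = 1
  inter : ∀ B B', MeasurableSet B → MeasurableSet B' → proj (B ∩ B') = proj B * proj B'
  hasSum : ∀ B : ℕ → Set ℝ, (∀ n, MeasurableSet (B n)) → Pairwise (Function.onFun Disjoint B) →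
    ∀ u, HasSum (fun n => proj (B n) u) (proj (⋃ n, B n) u)

theorem ProjectionValuedMeasure.inner_eq (E : ProjectionValuedMeasure H) {B : Set ℝ}
    (hB : MeasurableSet B) (u : H) : (inner ℂ u (E.proj B u)).re = ‖E.proj B u‖ ^ 2 := by
  have h := E.isStarProjection B hB
  have h1 : E.proj B (E.proj B u) = E.proj B u := by
    rw [← mul_apply_eq_comp, h.isIdempotentElem.eq]
  have h2 : inner ℂ (E.proj B u) (E.proj B u) = inner ℂ u (E.proj B u) := by
    have := ContinuousLinearMap.adjoint_inner_right (E.proj B) u (E.proj B u)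
    rw [← ContinuousLinearMap.star_eq_adjoint, h.isSelfAdjoint.star_eq, h1] at this
    exact this.symm
  rw [← h2, inner_self_eq_norm_sq_to_K]
  norm_cast

theorem ProjectionValuedMeasure.empty (E : ProjectionValuedMeasure H) : E.proj ∅ = 0 := by
  ext u
  have h := (E.hasSum (fun _ => ∅) (fun _ => MeasurableSet.empty)
    (fun _ _ _ => disjoint_bot_left) u).summable
  simpa using (summable_const_iff _).1 h

/-- The scalar measure `B ↦ ⟨u, E(B) u⟩`. -/
def ProjectionValuedMeasure.measure (E : ProjectionValuedMeasure H) (u : H) : Measure ℝ :=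
  Measure.ofMeasurable (fun B _ => ENNReal.ofReal (inner ℂ u (E.proj B u)).re)
    (by simp [E.empty])
    (by
      intro B hB hd
      have h := (E.hasSum B hB hd u).mapL (innerSL ℂ u)
      have h' := Complex.hasSum_re h
      simp only [innerSL_apply_apply] at h'
      rw [← h'.tsum_eq, ENNReal.ofReal_tsum_of_nonneg _ h'.summable]
      intro n
      rw [E.inner_eq (hB n)]
      positivity)

/-- `E` is the spectral measure of `T`, i.e. `T = ∫ x dE(x)`: the domain of `T` is
`{u | ∫ x² d⟨u, E u⟩ < ∞}`, and `⟨u, T u⟩ = ∫ x d⟨u, E u⟩` on it. -/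
def IsSpectralMeasure (T : H →ₗ.[ℂ] H) (E : ProjectionValuedMeasure H) : Prop :=
  (∀ u, u ∈ T.domain ↔ ∫⁻ x, ENNReal.ofReal (x ^ 2) ∂(E.measure u) < ⊤) ∧
  ∀ u : T.domain, inner ℂ (u : H) (T u) = ∫ x, (x : ℂ) ∂(E.measure (u : H))

/-- `B = F(T) = ∫ F dE`, where `E` is the spectral measure of `T`. -/
def IsFunctionOf (T : H →ₗ.[ℂ] H) (F : ℝ → ℂ) (B : H →L[ℂ] H) : Prop :=
  ∃ E : ProjectionValuedMeasure H, IsSpectralMeasure T E ∧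
    ∀ u, inner ℂ u (B u) = ∫ x, F x ∂(E.measure u)

open Classical in
/-- The operator `F(T)` (for a self-adjoint `T` and a bounded Borel function `F` it exists and is
unique). -/
def borelFC (T : H →ₗ.[ℂ] H) (F : ℝ → ℂ) : H →L[ℂ] H :=
  if h : ∃ B, IsFunctionOf T F B then h.choose else 0

end FunctionalCalculus

end Intertwining

end

/-! In polar coordinates the form of the Hamiltonian is `∫ |∂_r u|²` plus `r⁻²` times the spherical
form of the slices of `u`. On the component along a spherical eigenfunction with eigenvalue `ν² -
((d-2)/2)²` the operator is therefore a Bessel operator, which the Hankel transform of order `ν`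
turns into multiplication by `r²`. Let `Ψ_e`, `Ψ_φ` be the unitary involutions that apply the
appropriate Hankel transform to each component along the bases `e`, `φ` (`hankelTransport`). Then
`F(𝓛_{A,0}) = Ψ_e F(|x|²) Ψ_e` and `F(𝓛_{A,a}) = Ψ_φ F(|x|²) Ψ_φ`. The operator `W` is `Ψ_φ V Ψ_e`,
where `V` replaces `e_α` by `φ_α` and keeps the radial coefficients. Since `V` is unitary and
touches only the angular variable, it commutes with `F(|x|²)`, and the intertwining relation is the
cancellation `Ψ_φ V Ψ_e Ψ_e F Ψ_e Ψ_e V* Ψ_φ = Ψ_φ F Ψ_φ` (`conj_mul_conj_eq`, `waveOperator_conj`).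

The Hankel transform is built without Bessel asymptotics. The Gaussians `g_s = r^{ν-(d-2)/2} exp(-s
r²/2)` are total, because the Laplace transform is injective, and their Gram matrix is a constant
times `(s+t)^{-ν-1}`. Hence `g_s ↦ s^{-ν-1} g_{1/s}` preserves inner products and extends to a
unitary involution (`exists_hankelOp`). Integrating the Bessel series term by term shows that the
integral kernel has the same effect on Gaussians (`integral_hankelKernel_gauss`). Fubini and Laplace
injectivity then carry this over to the truncated integrals of arbitrary functions
(`truncatedHankel_ae`, `hankel_eq`).

For the diagonalization (`IsAdmissible.isDiagonalizedBy_hamiltonian`), a positive form is described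
by the resolvent `R = J J*`, where `J` maps the energy space into `H`: a pair `(u, f)` lies in the
graph exactly when `R (u + f) = u` (`energy_mem_formGraph`). It is thus enough to know `R` on a
total family, namely on `(1 + L) g_s` times an eigenfunction, where `L` is the Bessel operator. That
requires `g_s φ_α` to lie in the operator domain. It does, as a weak limit of smooth truncations
with bounded energy (`IsPosForm.mem_formGraph_of_bounded`, `exists_energy_bound`). The energy of the
truncations near the origin stays bounded but need not tend to zero when `ν = 0`, so strong energy
convergence is not available in general.

Positivity of the form combines the lower bound `-((d-2)/2)²` of the spherical form, which is read
off from the eigenbasis (`form_lower_bound`), with Hardy's inequality on each ray (`hardy_ray`).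

Finally, `borelFC` is a choice among the operators `∫ F dE`. It is determined because the spectral
measure is unique: the operator fixes `∫ (x+i)⁻¹ dE`, and the algebra of functions on which two
spectral measures agree then separates points (`IsSpectralMeasure.measure_unique`). -/

noncomputable section

namespace Intertwining

/-! ## Friedrichs resolvents of positive forms -/

section Forms

universe u v

variable {V : Type u} {H : Type v} [AddCommGroup V] [Module ℂ V]

/-- A positive semidefinite hermitian form, conjugate-linear in the first variable. -/
structure IsPosForm (q : V → V → ℂ) : Prop where
  add_left : ∀ u v w, q (u + v) w = q u w + q v w
  smul_left : ∀ (c : ℂ) u v, q (c • u) v = conj c * q u v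
  symm : ∀ u v, conj (q v u) = q u v
  nonneg : ∀ u, 0 ≤ (q u u).re

/-- The pre-inner product of a positive form. -/
@[reducible]
def IsPosForm.core {q : V → V → ℂ} (hq : IsPosForm q) : PreInnerProductSpace.Core ℂ V where
  inner := q
  conj_inner_symm := hq.symm
  re_inner_nonneg := hq.nonneg
  add_left := hq.add_left
  smul_left u v c := hq.smul_left c u v

/-- The Hausdorff completion for the seminorm of `q` identifies null vectors, so the form need not
be definite. -/
theorem IsPosForm.exists_completion {q : V → V → ℂ} (hq : IsPosForm q) :
    ∃ (K : Type u) (_ : NormedAddCommGroup K) (_ : InnerProductSpace ℂ K) (_ : CompleteSpace K)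
      (ι : V →ₗ[ℂ] K), DenseRange ι ∧ ∀ u v, inner ℂ (ι u) (ι v) = q u v := by
  let : PreInnerProductSpace.Core ℂ V := hq.core
  let : SeminormedAddCommGroup V := InnerProductSpace.Core.toSeminormedAddCommGroup (𝕜 := ℂ)
  let : InnerProductSpace ℂ V := .ofCore _
  refine ⟨UniformSpace.Completion V, inferInstance, inferInstance, inferInstance,
    (UniformSpace.Completion.toComplL (𝕜 := ℂ) (E := V)).toLinearMap, ?_, ?_⟩
  · exact UniformSpace.Completion.denseRange_coe
  · intro u v
    exact UniformSpace.Completion.inner_coe u v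

variable [NormedAddCommGroup H] [InnerProductSpace ℂ H]

theorem IsPosForm.add_inner {q : V → V → ℂ} (hq : IsPosForm q) (j : V →ₗ[ℂ] H) :
    IsPosForm fun u v => q u v + inner ℂ (j u) (j v) where
  add_left u v w := by rw [hq.add_left, map_add, inner_add_left]; ring
  smul_left c u v := by rw [hq.smul_left, map_smul, inner_smul_left]; ring
  symm u v := by rw [map_add, hq.symm, inner_conj_symm]
  nonneg u := by
    rw [Complex.add_re]
    exact add_nonneg (hq.nonneg u) (inner_self_nonneg (𝕜 := ℂ))

/-- Convergence in `H` and the Cauchy condition for `q` add up to the Cauchy condition for the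
energy norm `q + ‖j ·‖²`. -/
theorem energy_cauchySeq {K : Type*} [NormedAddCommGroup K] [InnerProductSpace ℂ K]
    {q : V → V → ℂ} {j : V →ₗ[ℂ] H} {ι : V →ₗ[ℂ] K}
    (hι : ∀ u v, inner ℂ (ι u) (ι v) = q u v + inner ℂ (j u) (j v)) {w : ℕ → V} {u : H}
    (h1 : Tendsto (fun n => j (w n)) atTop (𝓝 u))
    (h2 : Tendsto (fun nm : ℕ × ℕ => q (w nm.1 - w nm.2) (w nm.1 - w nm.2)) atTop (𝓝 0)) :
    CauchySeq fun n => ι (w n) := by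
  rw [cauchySeq_iff_tendsto_dist_atTop_0]
  have h3 := cauchySeq_iff_tendsto_dist_atTop_0.1 h1.cauchySeq
  have h4 : Tendsto (fun nm : ℕ × ℕ => (q (w nm.1 - w nm.2) (w nm.1 - w nm.2)).re +
      dist (j (w nm.1)) (j (w nm.2)) ^ 2) atTop (𝓝 0) := by
    have := ((Complex.continuous_re.tendsto 0).comp h2).add (h3.pow 2)
    simpa [Function.comp_def] using this
  have h5 : ∀ nm : ℕ × ℕ, dist (ι (w nm.1)) (ι (w nm.2)) =
      √((q (w nm.1 - w nm.2) (w nm.1 - w nm.2)).re +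
      dist (j (w nm.1)) (j (w nm.2)) ^ 2) := by
    intro nm
    rw [dist_eq_norm, dist_eq_norm, ← map_sub, ← map_sub, eq_comm,
      Real.sqrt_eq_iff_eq_sq _ (norm_nonneg _), ← inner_self_eq_norm_sq (𝕜 := ℂ) (ι _), hι,
      ← inner_self_eq_norm_sq (𝕜 := ℂ) (j _)]
    · simp
    · rw [← inner_self_eq_norm_sq (𝕜 := ℂ) (j _)]
      have := inner_self_nonneg (𝕜 := ℂ) (x := ι (w nm.1 - w nm.2))
      rw [hι] at this
      simpa using this
  simp_rw [h5]
  simpa using h4.sqrt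

variable [CompleteSpace H]

/-- The energy space of a positive form `q`, together with its map `J` into `H`. -/
theorem IsPosForm.exists_energy {q : V → V → ℂ} (hq : IsPosForm q) (j : V →ₗ[ℂ] H) :
    ∃ (K : Type u) (_ : NormedAddCommGroup K) (_ : InnerProductSpace ℂ K) (_ : CompleteSpace K)
      (ι : V →ₗ[ℂ] K) (J : K →L[ℂ] H), DenseRange ι ∧ (∀ u, J (ι u) = j u) ∧
      ∀ u v, inner ℂ (ι u) (ι v) = q u v + inner ℂ (j u) (j v) := by
  obtain ⟨K, i1, i2, i3, ι, hd, hι⟩ := (hq.add_inner j).exists_completion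
  -- Positivity of `q` makes `j` a contraction for the energy norm, so it extends to the completion.
  have hb : ∃ C : ℝ, ∀ u, ‖j u‖ ≤ C * ‖ι u‖ := by
    refine ⟨1, fun u => ?_⟩
    rw [one_mul, ← sq_le_sq₀ (norm_nonneg _) (norm_nonneg _)]
    have h1 := inner_self_eq_norm_sq (𝕜 := ℂ) (ι u)
    have h2 := inner_self_eq_norm_sq (𝕜 := ℂ) (j u)
    rw [hι] at h1
    simp only [map_add, RCLike.re_to_complex] at h1 h2
    linarith [hq.nonneg u]
  exact ⟨K, i1, i2, i3, ι, j.extendOfNorm ι, hd, fun u => LinearMap.extendOfNorm_eq hd hb u, hι⟩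

/-- If `ι (w n) → x`, the weak equation in `formGraph` reads `⟨ι ψ, x⟩ = ⟨j ψ, u + f⟩`, that is, `x
= J*(u + f)`, while `J x = u`. Conversely, any approximation of `J*(u + f)` from the dense range of
`ι` is a suitable sequence. Injectivity of `J`, which is closability of the form, plays no role. -/
theorem energy_mem_formGraph {K : Type*} [NormedAddCommGroup K] [InnerProductSpace ℂ K]
    [CompleteSpace K] {q : V → V → ℂ} {j : V →ₗ[ℂ] H} {ι : V →ₗ[ℂ] K} {J : K →L[ℂ] H}
    (hd : DenseRange ι) (hJ : ∀ u, J (ι u) = j u)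
    (hι : ∀ u v, inner ℂ (ι u) (ι v) = q u v + inner ℂ (j u) (j v)) (u f : H) :
    (u, f) ∈ formGraph j q ↔ J (ContinuousLinearMap.adjoint J (u + f)) = u := by
  have hq : ∀ u v, q u v = inner ℂ (ι u) (ι v) - inner ℂ (j u) (j v) := fun u v => by
    rw [hι]; ring
  constructor
  · rintro ⟨w, h1, h2, h3⟩
    obtain ⟨x, hx⟩ := cauchySeq_tendsto_of_complete (energy_cauchySeq hι h1 h2)
    have hJx : J x = u := by
      refine tendsto_nhds_unique ((J.continuous.tendsto x).comp hx) ?_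
      simpa [Function.comp_def, hJ] using h1
    have hx' : x = ContinuousLinearMap.adjoint J (u + f) := by
      refine hd.eq_of_inner_right (𝕜 := ℂ) fun ψ => ?_
      have h5 : Tendsto (fun n => inner ℂ (ι ψ) (ι (w n))) atTop (𝓝 (inner ℂ (ι ψ) x)) :=
        tendsto_const_nhds.inner hx
      have h6 : Tendsto (fun n => inner ℂ (ι ψ) (ι (w n))) atTop
          (𝓝 (inner ℂ (j ψ) f + inner ℂ (j ψ) u)) := by
        simp_rw [hι]
        exact (h3 ψ).add (tendsto_const_nhds.inner h1)
      have h7 := tendsto_nhds_unique h5 h6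
      rw [ContinuousLinearMap.adjoint_inner_right, hJ, inner_add_right, h7, add_comm]
    rw [← hx', hJx]
  · intro h
    set x := ContinuousLinearMap.adjoint J (u + f) with hx
    obtain ⟨y, hy, hyx⟩ := mem_closure_iff_seq_limit.1 (hd x)
    choose w hw using hy
    have hwx : Tendsto (fun n => ι (w n)) atTop (𝓝 x) := by simpa [hw] using hyx
    have hju : Tendsto (fun n => j (w n)) atTop (𝓝 u) := by
      have := (J.continuous.tendsto x).comp hwx
      simpa [Function.comp_def, hJ, h] using this
    refine ⟨w, hju, ?_, fun ψ => ?_⟩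
    · have a1 : Tendsto (fun nm : ℕ × ℕ => ι (w nm.1) - ι (w nm.2)) atTop (𝓝 (x - x)) := by
        rw [← prod_atTop_atTop_eq]
        exact (hwx.comp tendsto_fst).sub (hwx.comp tendsto_snd)
      have a2 : Tendsto (fun nm : ℕ × ℕ => j (w nm.1) - j (w nm.2)) atTop (𝓝 (u - u)) := by
        rw [← prod_atTop_atTop_eq]
        exact (hju.comp tendsto_fst).sub (hju.comp tendsto_snd)
      simp_rw [hq, map_sub]
      simpa using (a1.inner (𝕜 := ℂ) a1).sub (a2.inner (𝕜 := ℂ) a2)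
    · simp_rw [hq]
      have := ((tendsto_const_nhds (x := ι ψ)).inner (𝕜 := ℂ) hwx).sub
        ((tendsto_const_nhds (x := j ψ)).inner (𝕜 := ℂ) hju)
      convert this using 2
      rw [hx, ContinuousLinearMap.adjoint_inner_right, hJ, inner_add_right]
      ring

/-- The resolvent is `R = J J*`. Since `‖J‖² = ‖R‖`, an upper bound for `R` is a lower bound for the
form; this is the last clause, used in `form_lower_bound`. -/
theorem IsPosForm.exists_resolvent {q : V → V → ℂ} (hq : IsPosForm q) (j : V →ₗ[ℂ] H) :
    ∃ R : H →L[ℂ] H, ContinuousLinearMap.adjoint R = R ∧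
      (∀ u f : H, (u, f) ∈ formGraph j q ↔ R (u + f) = u) ∧
      (∀ M : ℝ, ‖R‖ ≤ M → ∀ ψ, ‖j ψ‖ ^ 2 ≤ M * ((q ψ ψ).re + ‖j ψ‖ ^ 2)) := by
  obtain ⟨K, i1, i2, i3, ι, J, hd, hJ, hι⟩ := hq.exists_energy j
  refine ⟨J ∘L ContinuousLinearMap.adjoint J, ?_, fun u f => energy_mem_formGraph hd hJ hι u f,
    fun M hM ψ => ?_⟩
  · rw [ContinuousLinearMap.adjoint_comp, ContinuousLinearMap.adjoint_adjoint]
  · have h1 : ‖J‖ * ‖J‖ ≤ M := by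
      have := ContinuousLinearMap.norm_adjoint_comp_self (ContinuousLinearMap.adjoint J)
      rw [ContinuousLinearMap.adjoint_adjoint, LinearIsometryEquiv.norm_map] at this
      rw [← this]; exact hM
    have h2 : ‖ι ψ‖ ^ 2 = (q ψ ψ).re + ‖j ψ‖ ^ 2 := by
      rw [← inner_self_eq_norm_sq (𝕜 := ℂ), hι, ← inner_self_eq_norm_sq (𝕜 := ℂ)]
      simp
    have h3 := J.le_opNorm (ι ψ)
    rw [hJ] at h3
    rw [← h2]
    calc ‖j ψ‖ ^ 2 ≤ (‖J‖ * ‖ι ψ‖) ^ 2 := by gcongr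
      _ = ‖J‖ * ‖J‖ * ‖ι ψ‖ ^ 2 := by ring
      _ ≤ _ := by gcongr

/-- The form is uniformly bounded along a sequence which converges in the energy norm. -/
theorem IsPosForm.bounded_of_cauchy {q : V → V → ℂ} (hq : IsPosForm q) (j : V →ₗ[ℂ] H)
    {w : ℕ → V} {u : H} (h1 : Tendsto (fun n => j (w n)) atTop (𝓝 u))
    (h2 : Tendsto (fun nm : ℕ × ℕ => q (w nm.1 - w nm.2) (w nm.1 - w nm.2)) atTop (𝓝 0)) :
    ∃ C, 0 ≤ C ∧ ∀ ψ n, ‖q ψ (w n)‖ ≤ C * √((q ψ ψ).re + ‖j ψ‖ ^ 2) := by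
  obtain ⟨K, i1, i2, i3, ι, J, hd, hJ, hι⟩ := hq.exists_energy j
  obtain ⟨x, hx⟩ := cauchySeq_tendsto_of_complete (energy_cauchySeq hι h1 h2)
  obtain ⟨B, hB⟩ := hx.norm.bddAbove_range
  have hB' : ∀ n, ‖ι (w n)‖ ≤ B := fun n => hB ⟨n, rfl⟩
  have hB0 : 0 ≤ B := (norm_nonneg _).trans (hB' 0)
  refine ⟨B + ‖J‖ * (‖J‖ * B), by positivity, fun ψ n => ?_⟩
  have h3 : √((q ψ ψ).re + ‖j ψ‖ ^ 2) = ‖ι ψ‖ := by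
    rw [Real.sqrt_eq_iff_eq_sq _ (norm_nonneg _), ← inner_self_eq_norm_sq (𝕜 := ℂ) (ι ψ), hι,
      ← inner_self_eq_norm_sq (𝕜 := ℂ)]
    · simp
    · exact add_nonneg (hq.nonneg ψ) (by positivity)
  have h4 : q ψ (w n) = inner ℂ (ι ψ) (ι (w n)) - inner ℂ (J (ι ψ)) (J (ι (w n))) := by
    rw [hι, hJ, hJ]; ring
  rw [h3, h4]
  calc _ ≤ ‖ι ψ‖ * ‖ι (w n)‖ + ‖J (ι ψ)‖ * ‖J (ι (w n))‖ :=
        (norm_sub_le _ _).trans (add_le_add (norm_inner_le_norm _ _) (norm_inner_le_norm _ _))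
    _ ≤ ‖ι ψ‖ * B + (‖J‖ * ‖ι ψ‖) * (‖J‖ * B) := by
        have := hB' n
        gcongr
        · exact J.le_opNorm _
        · exact (J.le_opNorm _).trans (by gcongr)
    _ = _ := by ring

end Forms

/-! ## Integration against a projection-valued measure -/

section PVM

variable {H : Type*} [NormedAddCommGroup H] [InnerProductSpace ℂ H]

theorem inner_self_ofReal (u : H) : inner ℂ u u = ((‖u‖ ^ 2 : ℝ) : ℂ) := by
  rw [inner_self_eq_norm_sq_to_K]
  norm_cast

/-- Polarization over `ℂ`. -/
theorem clm_ext_inner {S T : H →L[ℂ] H} (h : ∀ u, inner ℂ u (S u) = inner ℂ u (T u)) : S = T := by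
  have : (S : H →ₗ[ℂ] H) = T := (ext_inner_map _ _).1 fun u => by
    have := congrArg conj (h u)
    rwa [inner_conj_symm, inner_conj_symm] at this
  ext u
  exact congrArg (fun L : H →ₗ[ℂ] H => L u) this

variable [CompleteSpace H]

namespace ProjectionValuedMeasure

variable (E : ProjectionValuedMeasure H)

theorem measure_apply (u : H) {B : Set ℝ} (hB : MeasurableSet B) :
    E.measure u B = ENNReal.ofReal (‖E.proj B u‖ ^ 2) := by
  rw [measure, Measure.ofMeasurable_apply _ hB, E.inner_eq hB]

theorem measure_univ (u : H) : E.measure u Set.univ = ENNReal.ofReal (‖u‖ ^ 2) := by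
  rw [E.measure_apply u MeasurableSet.univ, E.univ]
  simp

instance (u : H) : IsFiniteMeasure (E.measure u) := ⟨by simp [E.measure_univ]⟩

theorem inner_proj (u : H) {B : Set ℝ} (hB : MeasurableSet B) :
    inner ℂ u (E.proj B u) = ((E.measure u).real B : ℂ) := by
  have h := E.isStarProjection B hB
  have h2 : inner ℂ (E.proj B u) (E.proj B u) = inner ℂ u (E.proj B u) := by
    have := ContinuousLinearMap.adjoint_inner_right (E.proj B) u (E.proj B u)
    rw [← ContinuousLinearMap.star_eq_adjoint, h.isSelfAdjoint.star_eq, ← mul_apply_eq_comp,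
      h.isIdempotentElem.eq] at this
    exact this.symm
  rw [measureReal_def, E.measure_apply u hB, ENNReal.toReal_ofReal (by positivity), ← h2,
    inner_self_eq_norm_sq_to_K]
  norm_cast

theorem adjoint_proj {B : Set ℝ} (hB : MeasurableSet B) :
    ContinuousLinearMap.adjoint (E.proj B) = E.proj B := by
  rw [← ContinuousLinearMap.star_eq_adjoint, (E.isStarProjection B hB).isSelfAdjoint.star_eq]

/-- Finite additivity is inherited from the scalar measures by polarization. -/
theorem proj_union {s t : Set ℝ} (hs : MeasurableSet s) (ht : MeasurableSet t)
    (hst : Disjoint s t) : E.proj (s ∪ t) = E.proj s + E.proj t := by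
  refine clm_ext_inner fun u => ?_
  rw [add_apply, inner_add_right, E.inner_proj u (hs.union ht), E.inner_proj u hs,
    E.inner_proj u ht, measureReal_union hst ht]
  push_cast
  rfl

/-- The set function `B ↦ (c ↦ c E(B))`. -/
def smulProj (B : Set ℝ) : ℂ →L[ℝ] (H →L[ℂ] H) :=
  (ContinuousLinearMap.id ℝ ℂ).smulRight (E.proj B)

/-- The zero measure makes the finiteness conditions in `FinMeasAdditive` void, so every measurable
set is admitted. -/
theorem finMeasAdditive_smulProj : FinMeasAdditive (0 : Measure ℝ) E.smulProj := by
  intro s t hs ht _ _ hst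
  ext c u
  simp [smulProj, E.proj_union hs ht hst]

/-- The integral of a simple function. -/
def simpleInt (f : SimpleFunc ℝ ℂ) : H →L[ℂ] H := f.setToSimpleFunc E.smulProj

theorem simpleInt_add (f g : SimpleFunc ℝ ℂ) :
    E.simpleInt (f + g) = E.simpleInt f + E.simpleInt g :=
  SimpleFunc.setToSimpleFunc_add _ E.finMeasAdditive_smulProj (by simp) (by simp)

theorem simpleInt_sub (f g : SimpleFunc ℝ ℂ) :
    E.simpleInt (f - g) = E.simpleInt f - E.simpleInt g :=
  SimpleFunc.setToSimpleFunc_sub _ E.finMeasAdditive_smulProj (by simp) (by simp)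

theorem simpleInt_indicator (c : ℂ) {s : Set ℝ} (hs : MeasurableSet s) :
    E.simpleInt (SimpleFunc.piecewise s hs (SimpleFunc.const _ c) (SimpleFunc.const _ 0)) =
      c • E.proj s := by
  have h0 : E.smulProj ∅ = 0 := by ext; simp [smulProj, E.empty]
  rw [simpleInt, SimpleFunc.setToSimpleFunc_indicator _ h0 hs]
  simp [smulProj]

/-- By bilinearity the claim reduces to indicators, where it is the multiplicativity `E.inter`. -/
theorem simpleInt_mul (f g : SimpleFunc ℝ ℂ) :
    E.simpleInt (f * g) = E.simpleInt f * E.simpleInt g := by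
  induction f using SimpleFunc.induction with
  | add _ hf hf' => rw [add_mul, simpleInt_add, hf, hf', simpleInt_add, add_mul]
  | const c hs =>
    induction g using SimpleFunc.induction with
    | add _ hg hg' => rw [mul_add, simpleInt_add, hg, hg', simpleInt_add, mul_add]
    | const c' hs' =>
      rename_i s t
      rw [simpleInt_indicator, simpleInt_indicator]
      have : (SimpleFunc.piecewise s hs (SimpleFunc.const _ c) (SimpleFunc.const _ 0)) *
          (SimpleFunc.piecewise t hs' (SimpleFunc.const _ c') (SimpleFunc.const _ 0)) =
          SimpleFunc.piecewise (s ∩ t) (hs.inter hs') (SimpleFunc.const ℝ (c * c'))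
            (SimpleFunc.const _ 0) := by
        ext x
        by_cases h1 : x ∈ s <;> by_cases h2 : x ∈ t <;> simp [h1, h2]
      rw [this, simpleInt_indicator, E.inter _ _ hs hs', smul_mul_smul_comm]

/-- The complex conjugate of a simple function. -/
def conjSimple (f : SimpleFunc ℝ ℂ) : SimpleFunc ℝ ℂ := f.map conj

theorem adjoint_simpleInt (f : SimpleFunc ℝ ℂ) :
    ContinuousLinearMap.adjoint (E.simpleInt f) = E.simpleInt (conjSimple f) := by
  induction f using SimpleFunc.induction with
  | @add f f' _ hf hf' =>
    have : conjSimple (f + f') = conjSimple f + conjSimple f' := by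
      ext x; simp [conjSimple]
    rw [this, simpleInt_add, simpleInt_add, map_add, hf, hf']
  | const c hs =>
    rename_i s
    have : conjSimple (SimpleFunc.piecewise s hs (SimpleFunc.const _ c) (SimpleFunc.const _ 0)) =
        SimpleFunc.piecewise s hs (SimpleFunc.const _ (conj c)) (SimpleFunc.const _ 0) := by
      ext x
      by_cases h1 : x ∈ s <;> simp [conjSimple, h1]
    rw [this, simpleInt_indicator, simpleInt_indicator, map_smulₛₗ, E.adjoint_proj hs]

theorem integrable_simple (μ : Measure ℝ) [IsFiniteMeasure μ] (f : SimpleFunc ℝ ℂ) :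
    Integrable f μ := SimpleFunc.integrable_of_isFiniteMeasure f

theorem inner_simpleInt (f : SimpleFunc ℝ ℂ) (u : H) :
    inner ℂ u (E.simpleInt f u) = ∫ x, f x ∂(E.measure u) := by
  induction f using SimpleFunc.induction with
  | add _ hf hf' =>
    rw [simpleInt_add, add_apply, inner_add_right, hf, hf',
      ← integral_add (integrable_simple _ _) (integrable_simple _ _)]
    rfl
  | const c hs =>
    rename_i s
    rw [simpleInt_indicator, smul_apply, inner_smul_right, E.inner_proj u hs]
    have : (fun x => (SimpleFunc.piecewise s hs (SimpleFunc.const _ c)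
        (SimpleFunc.const _ (0 : ℂ))) x) = s.indicator fun _ : ℝ => c := by
      ext x; by_cases h1 : x ∈ s <;> simp [h1]
    rw [this, integral_indicator hs, setIntegral_const, Complex.real_smul, mul_comm]

/-- With multiplicativity and adjoints, `f ↦ (∫ f dE) u` is an isometry from the simple functions in
`L²(E.measure u)` to `H`. The convergence statements below rest on it. -/
theorem norm_sq_simpleInt (f : SimpleFunc ℝ ℂ) (u : H) :
    ‖E.simpleInt f u‖ ^ 2 = ∫ x, ‖f x‖ ^ 2 ∂(E.measure u) := by
  have h1 : inner ℂ (E.simpleInt f u) (E.simpleInt f u) =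
      ∫ x, (conjSimple f * f) x ∂(E.measure u) := by
    rw [← E.inner_simpleInt, simpleInt_mul, ← adjoint_simpleInt, mul_apply_eq_comp,
      ContinuousLinearMap.adjoint_inner_right]
  have h2 : ∀ x, (conjSimple f * f) x = ((‖f x‖ ^ 2 : ℝ) : ℂ) := by
    intro x
    simp [conjSimple, Complex.conj_mul']
  simp_rw [h2] at h1
  rw [integral_complex_ofReal, inner_self_ofReal] at h1
  exact Complex.ofReal_injective h1

/-- The operators of a bounded, pointwise convergent sequence of simple functions converge. -/
theorem exists_tendsto_simpleInt {s : ℕ → SimpleFunc ℝ ℂ} {F : ℝ → ℂ} {M : ℝ}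
    (hM : ∀ n x, ‖s n x‖ ≤ M) (hF : ∀ x, Tendsto (fun n => s n x) atTop (𝓝 (F x))) :
    ∃ D : H →L[ℂ] H, ∀ u, Tendsto (fun n => E.simpleInt (s n) u) atTop (𝓝 (D u)) := by
  have h1 : ∀ u, CauchySeq fun n => E.simpleInt (s n) u := by
    intro u
    rw [cauchySeq_iff_tendsto_dist_atTop_0]
    have h2 : ∀ nm : ℕ × ℕ, dist (E.simpleInt (s nm.1) u) (E.simpleInt (s nm.2) u) =
        √(∫ x, ‖s nm.1 x - s nm.2 x‖ ^ 2 ∂(E.measure u)) := by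
      intro nm
      rw [dist_eq_norm, ← sub_apply, ← simpleInt_sub]
      have := E.norm_sq_simpleInt (s nm.1 - s nm.2) u
      simp only [SimpleFunc.coe_sub, Pi.sub_apply] at this
      rw [← this, Real.sqrt_sq (norm_nonneg _)]
    simp_rw [h2]
    have h3 : Tendsto (fun nm : ℕ × ℕ => ∫ x, ‖s nm.1 x - s nm.2 x‖ ^ 2 ∂(E.measure u)) atTop
        (𝓝 (∫ x, (0 : ℝ) ∂(E.measure u))) := by
      refine tendsto_integral_filter_of_dominated_convergence (fun _ => (M + M) ^ 2) ?_ ?_ ?_ ?_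
      · refine Eventually.of_forall fun nm => ?_
        exact (((s nm.1).aestronglyMeasurable.sub (s nm.2).aestronglyMeasurable).norm).pow 2
      · refine Eventually.of_forall fun nm => Eventually.of_forall fun x => ?_
        rw [Real.norm_of_nonneg (by positivity)]
        have := (norm_sub_le (s nm.1 x) (s nm.2 x)).trans (add_le_add (hM _ x) (hM _ x))
        gcongr
      · exact integrable_const _
      · refine Eventually.of_forall fun x => ?_
        rw [← prod_atTop_atTop_eq]
        have := (((hF x).comp tendsto_fst).sub ((hF x).comp (tendsto_snd (f := atTop)))).norm.pow 2
        simpa [Function.comp_def] using this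
    simpa using h3.sqrt
  choose D hD using fun u => cauchySeq_tendsto_of_complete (h1 u)
  -- The pointwise limit of bounded operators is bounded, by Banach–Steinhaus.
  exact ⟨continuousLinearMapOfTendsto (fun n => E.simpleInt (s n)) (f := D)
    (tendsto_pi_nhds.2 hD), hD⟩

/-- `D = ∫ F dE`, as a strong limit of integrals of simple functions. -/
def Represents (F : ℝ → ℂ) (D : H →L[ℂ] H) : Prop :=
  ∃ (s : ℕ → SimpleFunc ℝ ℂ) (M : ℝ), (∀ n x, ‖s n x‖ ≤ M) ∧
    (∀ x, Tendsto (fun n => s n x) atTop (𝓝 (F x))) ∧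
    ∀ u, Tendsto (fun n => E.simpleInt (s n) u) atTop (𝓝 (D u))

variable {E}

theorem exists_represents (E : ProjectionValuedMeasure H) {F : ℝ → ℂ} (hF : Measurable F) {M : ℝ}
    (hM : ∀ x, ‖F x‖ ≤ M) : ∃ D, E.Represents F D := by
  set s : ℕ → SimpleFunc ℝ ℂ := SimpleFunc.approxOn F hF Set.univ 0 (mem_univ _)
  have h1 : ∀ n x, ‖s n x‖ ≤ M + M := fun n x =>
    (SimpleFunc.norm_approxOn_zero_le hF (mem_univ _) x n).trans (add_le_add (hM x) (hM x))
  have h2 : ∀ x, Tendsto (fun n => s n x) atTop (𝓝 (F x)) := fun x =>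
    SimpleFunc.tendsto_approxOn hF (mem_univ _) (by simp)
  obtain ⟨D, hD⟩ := E.exists_tendsto_simpleInt h1 h2
  exact ⟨D, s, _, h1, h2, hD⟩

theorem Represents.inner_eq {F : ℝ → ℂ} {D : H →L[ℂ] H} (h : E.Represents F D) (u : H) :
    inner ℂ u (D u) = ∫ x, F x ∂(E.measure u) := by
  obtain ⟨s, M, h1, h2, h3⟩ := h
  refine tendsto_nhds_unique (tendsto_const_nhds.inner (h3 u)) ?_
  simp_rw [inner_simpleInt]
  exact tendsto_integral_of_dominated_convergence (fun _ => M)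
    (fun n => (s n).aestronglyMeasurable) (integrable_const _)
    (fun n => Eventually.of_forall (h1 n)) (Eventually.of_forall h2)

theorem Represents.add {F G : ℝ → ℂ} {D D' : H →L[ℂ] H} (h : E.Represents F D)
    (h' : E.Represents G D') : E.Represents (F + G) (D + D') := by
  obtain ⟨s, M, h1, h2, h3⟩ := h
  obtain ⟨s', M', h1', h2', h3'⟩ := h'
  refine ⟨fun n => s n + s' n, M + M', fun n x => ?_, fun x => ?_, fun u => ?_⟩
  · exact (norm_add_le _ _).trans (add_le_add (h1 n x) (h1' n x))
  · exact (h2 x).add (h2' x)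
  · simp_rw [simpleInt_add]
    exact (h3 u).add (h3' u)

/-- Strong limits multiply when the left factors are uniformly bounded; the bound `M` comes from the
isometry. -/
theorem Represents.mul {F G : ℝ → ℂ} {D D' : H →L[ℂ] H} (h : E.Represents F D)
    (h' : E.Represents G D') : E.Represents (F * G) (D * D') := by
  obtain ⟨s, M, h1, h2, h3⟩ := h
  obtain ⟨s', M', h1', h2', h3'⟩ := h'
  have hM0 : 0 ≤ M := (norm_nonneg _).trans (h1 0 0)
  refine ⟨fun n => s n * s' n, M * M', fun n x => ?_, fun x => ?_, fun u => ?_⟩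
  · simp only [SimpleFunc.coe_mul, Pi.mul_apply, norm_mul]
    exact mul_le_mul (h1 n x) (h1' n x) (norm_nonneg _) hM0
  · exact (h2 x).mul (h2' x)
  · simp_rw [simpleInt_mul]
    have hb : ∀ n v, ‖E.simpleInt (s n) v‖ ≤ M * ‖v‖ := by
      intro n v
      rw [← sq_le_sq₀ (norm_nonneg _) (by positivity), norm_sq_simpleInt]
      have : ∫ x, ‖s n x‖ ^ 2 ∂(E.measure v) ≤ ∫ _, M ^ 2 ∂(E.measure v) := by
        refine integral_mono_of_nonneg (Eventually.of_forall fun x => by positivity)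
          (integrable_const _) (Eventually.of_forall fun x => ?_)
        have := h1 n x
        dsimp only
        gcongr
      refine this.trans (le_of_eq ?_)
      rw [integral_const, measureReal_def, E.measure_univ, ENNReal.toReal_ofReal (by positivity),
        smul_eq_mul]
      ring
    have h4 : Tendsto (fun n => E.simpleInt (s n) (E.simpleInt (s' n) u - D' u)) atTop (𝓝 0) := by
      refine squeeze_zero_norm (fun n => hb n _) ?_
      have := ((h3' u).sub_const (D' u)).norm.const_mul M
      simpa using this
    have := h4.add (h3 (D' u))
    simpa [mul_apply_eq_comp] using this

/-- Adjoints do not pass to strong limits directly. The conjugate approximants are therefore given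
their own strong limit `D'`, which is identified with the adjoint weakly. -/
theorem Represents.star {F : ℝ → ℂ} {D : H →L[ℂ] H} (h : E.Represents F D) :
    E.Represents (fun x => conj (F x)) (ContinuousLinearMap.adjoint D) := by
  obtain ⟨s, M, h1, h2, h3⟩ := h
  have h1' : ∀ n x, ‖conjSimple (s n) x‖ ≤ M := fun n x => by simpa [conjSimple] using h1 n x
  have h2' : ∀ x, Tendsto (fun n => conjSimple (s n) x) atTop (𝓝 (conj (F x))) := fun x => by
    simpa [conjSimple, Function.comp_def] using (Complex.continuous_conj.tendsto _).comp (h2 x)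
  obtain ⟨D', hD'⟩ := E.exists_tendsto_simpleInt h1' h2'
  have : ContinuousLinearMap.adjoint D = D' := by
    refine clm_ext_inner fun u => ?_
    rw [ContinuousLinearMap.adjoint_inner_right]
    refine tendsto_nhds_unique ((h3 u).inner tendsto_const_nhds)
      (Tendsto.congr (fun n => ?_) (tendsto_const_nhds.inner (hD' u)))
    rw [← adjoint_simpleInt, ContinuousLinearMap.adjoint_inner_right]
  rw [this]
  exact ⟨_, M, h1', h2', hD'⟩

theorem represents_const (c : ℂ) : E.Represents (fun _ => c) (c • 1) := by
  refine ⟨fun _ => SimpleFunc.const ℝ c, ‖c‖, fun n x => by simp, fun x => by simp, fun u => ?_⟩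
  have : E.simpleInt (SimpleFunc.const ℝ c) = c • 1 := by
    have h := E.simpleInt_indicator c MeasurableSet.univ
    rw [E.univ] at h
    rw [← h]
    congr 1
    ext x
    simp
  simp [this]

theorem Represents.norm_sq {F : ℝ → ℂ} {D : H →L[ℂ] H} (h : E.Represents F D) (u : H) :
    ‖D u‖ ^ 2 = ∫ x, ‖F x‖ ^ 2 ∂(E.measure u) := by
  have h1 := (h.star.mul h).inner_eq u
  rw [mul_apply_eq_comp, ContinuousLinearMap.adjoint_inner_right] at h1
  simp only [Pi.mul_apply, Complex.conj_mul'] at h1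
  have h2 : ∫ x, (‖F x‖ : ℂ) ^ 2 ∂(E.measure u) = ((∫ x, ‖F x‖ ^ 2 ∂(E.measure u) : ℝ) : ℂ) := by
    rw [← integral_complex_ofReal]
    simp
  rw [h2, inner_self_ofReal] at h1
  exact Complex.ofReal_injective h1

theorem represents_indicator {B : Set ℝ} (hB : MeasurableSet B) :
    E.Represents (B.indicator fun _ => 1) (E.proj B) := by
  refine ⟨fun _ => SimpleFunc.piecewise B hB (SimpleFunc.const _ 1) (SimpleFunc.const _ 0), 1,
    fun n x => ?_, fun x => ?_, fun u => ?_⟩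
  · by_cases h : x ∈ B <;> simp [h]
  · by_cases h : x ∈ B <;> simp [h]
  · simp only [E.simpleInt_indicator 1 hB, one_smul]
    exact tendsto_const_nhds

/-- `E(B) D` is the integral of `1_B F`, so its norm on `u` is an integral of `|F|²` over `B`. -/
theorem Represents.measure_eq {F : ℝ → ℂ} {D : H →L[ℂ] H} (hF : Measurable F)
    (h : E.Represents F D) (u : H) :
    E.measure (D u) = (E.measure u).withDensity fun x => ENNReal.ofReal (‖F x‖ ^ 2) := by
  ext B hB
  have h1 := ((represents_indicator hB).mul h).norm_sq u
  rw [E.measure_apply _ hB, withDensity_apply _ hB, ← mul_apply_eq_comp, h1]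
  have hi : Integrable (fun x => ‖F x‖ ^ 2) (E.measure u) := by
    obtain ⟨s, M, h1, h2, h3⟩ := h
    have : ∀ x, ‖F x‖ ≤ M := fun x =>
      le_of_tendsto (h2 x).norm (Eventually.of_forall fun n => h1 n x)
    refine Integrable.of_bound (C := M ^ 2) (hF.norm.pow_const 2).aestronglyMeasurable
      (Eventually.of_forall fun x => ?_)
    rw [Real.norm_of_nonneg (by positivity)]
    have := this x
    gcongr
  have h2 : (fun x => ‖((B.indicator fun _ => (1 : ℂ)) * F) x‖ ^ 2) =
      B.indicator fun x => ‖F x‖ ^ 2 := by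
    ext x
    by_cases hx : x ∈ B <;> simp [hx]
  rw [h2, integral_indicator hB, ofReal_integral_eq_lintegral_ofReal hi.integrableOn]
  exact Eventually.of_forall fun x => by positivity

end ProjectionValuedMeasure

end PVM

/-! ## Uniqueness of the spectral measure -/

section Uniqueness

variable {H : Type*} [NormedAddCommGroup H] [InnerProductSpace ℂ H] [CompleteSpace H]

/-- The function `x ↦ 1 / (x + i)`. -/
def resolventFun (x : ℝ) : ℂ := ((x : ℂ) + Complex.I)⁻¹

theorem add_I_ne_zero (x : ℝ) : (x : ℂ) + Complex.I ≠ 0 := fun h => by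
  have := congrArg Complex.im h
  simp at this

theorem continuous_resolventFun : Continuous resolventFun :=
  (Complex.continuous_ofReal.add continuous_const).inv₀ add_I_ne_zero

theorem norm_sq_resolventFun (x : ℝ) : ‖resolventFun x‖ ^ 2 = (x ^ 2 + 1)⁻¹ := by
  rw [resolventFun, norm_inv, inv_pow, Complex.sq_norm, Complex.normSq_apply]
  simp [pow_two]

theorem norm_resolventFun_le (x : ℝ) : ‖resolventFun x‖ ≤ 1 := by
  rw [← sq_le_one_iff₀ (norm_nonneg _), norm_sq_resolventFun]
  exact inv_le_one_of_one_le₀ (by nlinarith [sq_nonneg x])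

/-- `IsSpectralMeasure` knows `T` only through its quadratic form. This gives `⟨B v, (T + i) B v⟩ =
⟨B v, v⟩` first; polarization turns it into `B* ((T + i) B - 1) = 0`, and `B*` is injective because
`1/(x+i)` has no zeros. -/
theorem IsSpectralMeasure.resolvent {T : H →ₗ.[ℂ] H} {E : ProjectionValuedMeasure H}
    (hE : IsSpectralMeasure T E) {B : H →L[ℂ] H} (hB : E.Represents resolventFun B) (u : H) :
    ∃ h : B u ∈ T.domain, T ⟨B u, h⟩ + Complex.I • B u = u := by
  have hm : Measurable resolventFun := continuous_resolventFun.measurable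
  have hμ := fun v => hB.measure_eq hm v
  have hdm : Measurable fun x => ENNReal.ofReal (‖resolventFun x‖ ^ 2) :=
    (hm.norm.pow_const 2).ennreal_ofReal
  have hdom : ∀ v, B v ∈ T.domain := by
    intro v
    rw [hE.1, hμ, lintegral_withDensity_eq_lintegral_mul _ hdm
      (by fun_prop)]
    refine lt_of_le_of_lt (lintegral_mono (g := fun _ => 1) fun x => ?_) (by simp)
    rw [Pi.mul_apply, ← ENNReal.ofReal_mul (by positivity), ENNReal.ofReal_le_one,
      norm_sq_resolventFun, inv_mul_le_iff₀ (by positivity)]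
    linarith
  have hq : ∀ v, inner ℂ (B v) (T ⟨B v, hdom v⟩ + Complex.I • B v) = inner ℂ (B v) v := by
    intro v
    have hi : ∀ G : ℝ → ℂ, Measurable G → (∀ x, ‖G x‖ ≤ 1) → Integrable G (E.measure v) :=
      fun G hG hb => Integrable.of_bound hG.aestronglyMeasurable 1 (Eventually.of_forall hb)
    have e1 : inner ℂ (B v) (T ⟨B v, hdom v⟩) =
        ∫ x, ((‖resolventFun x‖ ^ 2 : ℝ) : ℂ) * x ∂(E.measure v) := by
      rw [hE.2 ⟨B v, hdom v⟩, hμ, integral_withDensity_eq_integral_toReal_smul hdm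
        (Eventually.of_forall fun x => ENNReal.ofReal_lt_top)]
      refine integral_congr_ae (Eventually.of_forall fun x => ?_)
      simp only [ENNReal.toReal_ofReal (sq_nonneg ‖resolventFun x‖), Complex.real_smul]
    have e2 : inner ℂ (B v) (B v) = ∫ x, ((‖resolventFun x‖ ^ 2 : ℝ) : ℂ) ∂(E.measure v) := by
      rw [inner_self_ofReal, hB.norm_sq, integral_complex_ofReal]
    have e3 : inner ℂ (B v) v = ∫ x, conj (resolventFun x) ∂(E.measure v) := by
      rw [← hB.star.inner_eq, ContinuousLinearMap.adjoint_inner_right]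
    rw [inner_add_right, inner_smul_right, e1, e2, e3, ← integral_const_mul, ← integral_add]
    · refine integral_congr_ae (Eventually.of_forall fun x => ?_)
      have h1 : conj (resolventFun x) * resolventFun x = ((‖resolventFun x‖ ^ 2 : ℝ) : ℂ) := by
        rw [Complex.conj_mul']; norm_cast
      have h2 : resolventFun x * ((x : ℂ) + Complex.I) = 1 := inv_mul_cancel₀ (add_I_ne_zero x)
      simp only [← h1]
      linear_combination conj (resolventFun x) * h2
    · refine hi _ (by fun_prop) fun x => ?_
      rw [norm_mul, Complex.norm_real, Complex.norm_real, Real.norm_of_nonneg (by positivity),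
        norm_sq_resolventFun, inv_mul_le_iff₀ (by positivity), Real.norm_eq_abs]
      nlinarith [sq_abs x, sq_nonneg (|x| - 1), abs_nonneg x]
    · refine (hi _ (by fun_prop) fun x => ?_).const_mul _
      rw [Complex.norm_real, Real.norm_of_nonneg (by positivity)]
      exact pow_le_one₀ (norm_nonneg _) (norm_resolventFun_le x)
  let B' : H →ₗ[ℂ] T.domain := (B : H →ₗ[ℂ] H).codRestrict T.domain hdom
  -- Boundedness of `(T + i) B - 1` is not known at this stage; polarization needs only a linear
  -- map.
  let C : H →ₗ[ℂ] H := T.toFun ∘ₗ B' + Complex.I • (B : H →ₗ[ℂ] H) - LinearMap.id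
  have hC : ∀ v, C v = T ⟨B v, hdom v⟩ + Complex.I • B v - v := fun v => rfl
  have hz : (ContinuousLinearMap.adjoint B : H →ₗ[ℂ] H) ∘ₗ C = 0 := by
    rw [← inner_map_self_eq_zero]
    intro v
    change inner ℂ (ContinuousLinearMap.adjoint B (C v)) v = 0
    rw [ContinuousLinearMap.adjoint_inner_left, hC, ← inner_conj_symm, inner_sub_right, hq v]
    simp only [sub_self, map_zero]
  have hker : ∀ w, ContinuousLinearMap.adjoint B w = 0 → w = 0 := by
    intro w hw
    have h1 := hB.star.norm_sq w
    simp only [hw, RCLike.norm_conj, norm_zero, norm_sq_resolventFun] at h1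
    have h2 : Integrable (fun x : ℝ => (x ^ 2 + 1)⁻¹) (E.measure w) := by
      refine Integrable.of_bound (C := 1) (by fun_prop) (Eventually.of_forall fun x => ?_)
      rw [Real.norm_of_nonneg (by positivity)]
      exact inv_le_one_of_one_le₀ (by nlinarith [sq_nonneg x])
    have h3 := (integral_eq_zero_iff_of_nonneg (fun x => by positivity) h2).1 (by rw [← h1]; simp)
    have h4 : E.measure w = 0 := by
      rw [← ae_eq_bot, ← Filter.eventually_false_iff_eq_bot]
      filter_upwards [h3] with x hx
      have : (0 : ℝ) < (x ^ 2 + 1)⁻¹ := by positivity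
      exact this.ne' hx
    have h5 := E.measure_univ w
    rw [h4] at h5
    simpa using h5.symm
  refine ⟨hdom u, ?_⟩
  have := hker (C u) (congrArg (fun L : H →ₗ[ℂ] H => L u) hz)
  rw [hC] at this
  exact sub_eq_zero.1 this

/-- The quadratic form of `T` is real, being an integral of `x`, so `T v + i v = 0` forces `‖v‖² =
0`. Hence `T + i` has at most one right inverse. -/
theorem IsSpectralMeasure.resolvent_unique {T : H →ₗ.[ℂ] H} {E E' : ProjectionValuedMeasure H}
    (hE : IsSpectralMeasure T E) (hE' : IsSpectralMeasure T E') {B B' : H →L[ℂ] H}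
    (hB : E.Represents resolventFun B) (hB' : E'.Represents resolventFun B') : B = B' := by
  ext u
  obtain ⟨h1, h2⟩ := hE.resolvent hB u
  obtain ⟨h3, h4⟩ := hE'.resolvent hB' u
  set v : T.domain := ⟨B u, h1⟩ - ⟨B' u, h3⟩ with hv
  have h5 : T v + Complex.I • (v : H) = 0 := by
    rw [hv, LinearPMap.map_sub, Submodule.coe_sub, smul_sub]
    refine Eq.trans ?_ (sub_eq_zero.2 (h2.trans h4.symm))
    abel
  have h6 : inner ℂ (v : H) (T v) + Complex.I * inner ℂ (v : H) (v : H) = 0 := by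
    rw [← inner_smul_right, ← inner_add_right, h5, inner_zero_right]
  rw [hE.2 v, integral_complex_ofReal, inner_self_ofReal] at h6
  have h7 := congrArg Complex.im h6
  rw [Complex.add_im, Complex.ofReal_im, Complex.mul_im, Complex.I_re, Complex.I_im,
    Complex.ofReal_im, Complex.ofReal_re] at h7
  have h8 : (v : H) = 0 := by simpa using h7
  exact sub_eq_zero.1 h8

-- The bounded continuous functions with the same integral operator for `E` and `E'` form a
-- star-subalgebra. It contains `1/(x+i)`, which separates points, and such an algebra determines a
-- finite measure on a Polish space.
open BoundedContinuousFunction in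
theorem IsSpectralMeasure.measure_unique {T : H →ₗ.[ℂ] H} {E E' : ProjectionValuedMeasure H}
    (hE : IsSpectralMeasure T E) (hE' : IsSpectralMeasure T E') (u : H) :
    E.measure u = E'.measure u := by
  let A : StarSubalgebra ℂ (ℝ →ᵇ ℂ) :=
    { carrier := {G | ∃ D : H →L[ℂ] H, E.Represents G D ∧ E'.Represents G D}
      mul_mem' := by
        rintro _ _ ⟨D, h1, h2⟩ ⟨D', h1', h2'⟩
        exact ⟨D * D', h1.mul h1', h2.mul h2'⟩
      add_mem' := by
        rintro _ _ ⟨D, h1, h2⟩ ⟨D', h1', h2'⟩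
        exact ⟨D + D', h1.add h1', h2.add h2'⟩
      algebraMap_mem' := fun c =>
        ⟨c • 1, ProjectionValuedMeasure.represents_const c,
          ProjectionValuedMeasure.represents_const c⟩
      star_mem' := by
        rintro _ ⟨D, h1, h2⟩
        exact ⟨_, h1.star, h2.star⟩ }
  have hm : Measurable resolventFun := continuous_resolventFun.measurable
  obtain ⟨B, hB⟩ := E.exists_represents hm norm_resolventFun_le
  obtain ⟨B', hB'⟩ := E'.exists_represents hm norm_resolventFun_le
  have hBB := hE.resolvent_unique hE' hB hB'
  subst hBB
  refine ext_of_forall_mem_subalgebra_integral_eq_of_polish (A := A) ?_ ?_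
  · intro x y hxy
    let g : ℝ →ᵇ ℂ := BoundedContinuousFunction.ofNormedAddCommGroup resolventFun
      continuous_resolventFun 1 norm_resolventFun_le
    have hg : g ∈ A := ⟨B, hB, hB'⟩
    refine ⟨g, ⟨g.toContinuousMapStarₐ ℂ, ⟨g, hg, rfl⟩, rfl⟩, fun h => hxy ?_⟩
    have h1 : resolventFun x = resolventFun y := h
    exact_mod_cast add_right_cancel (inv_injective h1)
  · rintro g ⟨D, h1, h2⟩
    exact (h1.inner_eq u).symm.trans (h2.inner_eq u)

theorem IsFunctionOf.unique {T : H →ₗ.[ℂ] H} {F : ℝ → ℂ} {B B' : H →L[ℂ] H}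
    (h : IsFunctionOf T F B) (h' : IsFunctionOf T F B') : B = B' := by
  obtain ⟨E, hE, h1⟩ := h
  obtain ⟨E', hE', h2⟩ := h'
  refine clm_ext_inner fun u => ?_
  rw [h1, h2, hE.measure_unique hE']

theorem IsFunctionOf.borelFC_eq {T : H →ₗ.[ℂ] H} {F : ℝ → ℂ} {B : H →L[ℂ] H}
    (h : IsFunctionOf T F B) : borelFC T F = B := by
  have hex : ∃ B, IsFunctionOf T F B := ⟨B, h⟩
  rw [borelFC, dif_pos hex]
  exact hex.choose_spec.unique h

end Uniqueness

/-! ## Multiplication operators -/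

section Multiplication

variable {Ω : Type*} [MeasurableSpace Ω] {μ : Measure Ω}

theorem ofReal_norm_sq_eq_lintegral (f : Lp ℂ 2 μ) :
    ENNReal.ofReal (‖f‖ ^ 2) = ∫⁻ x, ‖f x‖ₑ ^ 2 ∂μ := by
  rw [ENNReal.ofReal_pow (norm_nonneg _), Lp.norm_def, ENNReal.ofReal_toReal (Lp.eLpNorm_ne_top f)]
  have := eLpNorm_nnreal_pow_eq_lintegral (f := f) (μ := μ) (p := 2) (by norm_num)
  simpa using this

theorem memLp_two_iff_lintegral {f : Ω → ℂ} (hf : AEStronglyMeasurable f μ) :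
    MemLp f 2 μ ↔ ∫⁻ x, ‖f x‖ₑ ^ 2 ∂μ < ⊤ := by
  have h := eLpNorm_lt_top_iff_lintegral_rpow_enorm_lt_top (f := f) (μ := μ) (p := 2) (by norm_num)
    (by norm_num)
  simp only [ENNReal.toReal_ofNat, ENNReal.rpow_ofNat] at h
  exact ⟨fun hm => h.1 hm.2, fun hm => ⟨hf, h.2 hm⟩⟩

/-- A bounded measurable function. -/
structure IsBddMeas (F : Ω → ℂ) : Prop where
  measurable : Measurable F
  bounded : ∃ M : ℝ, ∀ x, ‖F x‖ ≤ M

theorem IsBddMeas.memLp {F : Ω → ℂ} (hF : IsBddMeas F) (f : Lp ℂ 2 μ) :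
    MemLp (fun x => F x * f x) 2 μ := by
  obtain ⟨M, hM⟩ := hF.bounded
  refine MemLp.of_le_mul (c := M) (Lp.memLp f)
    (hF.measurable.aestronglyMeasurable.mul (Lp.aestronglyMeasurable f))
    (Eventually.of_forall fun x => ?_)
  rw [norm_mul]
  exact mul_le_mul_of_nonneg_right (hM x) (norm_nonneg _)

theorem IsBddMeas.exists_mulOp (μ : Measure Ω) {F : Ω → ℂ} (hF : IsBddMeas F) :
    ∃ D : Lp ℂ 2 μ →L[ℂ] Lp ℂ 2 μ, ∀ f, D f =ᵐ[μ] fun x => F x * f x := by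
  obtain ⟨M, hM⟩ := hF.bounded
  let L : Lp ℂ 2 μ →ₗ[ℂ] Lp ℂ 2 μ :=
    { toFun := fun f => (hF.memLp f).toLp _
      map_add' := fun f g => by
        refine Lp.ext ?_
        filter_upwards [(hF.memLp (f + g)).coeFn_toLp, (hF.memLp f).coeFn_toLp,
          (hF.memLp g).coeFn_toLp, Lp.coeFn_add f g, Lp.coeFn_add ((hF.memLp f).toLp _)
          ((hF.memLp g).toLp _)] with x h1 h2 h3 h4 h5
        rw [h1, h5, Pi.add_apply, h2, h3, h4, Pi.add_apply, mul_add]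
      map_smul' := fun c f => by
        refine Lp.ext ?_
        filter_upwards [(hF.memLp (c • f)).coeFn_toLp, (hF.memLp f).coeFn_toLp,
          Lp.coeFn_smul c f, Lp.coeFn_smul c ((hF.memLp f).toLp _)] with x h1 h2 h3 h4
        rw [h1, RingHom.id_apply, h4, Pi.smul_apply, h2, h3, Pi.smul_apply, smul_eq_mul,
          smul_eq_mul]
        ring }
  have hL : ∀ f, L f =ᵐ[μ] fun x => F x * f x := fun f => (hF.memLp f).coeFn_toLp
  refine ⟨L.mkContinuous M fun f => ?_, fun f => hL f⟩
  refine Lp.norm_le_mul_norm_of_ae_le_mul ?_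
  filter_upwards [hL f] with x hx
  rw [hx, norm_mul]
  exact mul_le_mul_of_nonneg_right (hM x) (norm_nonneg _)

open Classical in
/-- Multiplication by a bounded measurable function on `L²`. -/
def mulOp (μ : Measure Ω) (F : Ω → ℂ) : Lp ℂ 2 μ →L[ℂ] Lp ℂ 2 μ :=
  if h : IsBddMeas F then (h.exists_mulOp μ).choose else 0

theorem IsBddMeas.mulOp_ae {F : Ω → ℂ} (hF : IsBddMeas F) (f : Lp ℂ 2 μ) :
    mulOp μ F f =ᵐ[μ] fun x => F x * f x := by
  rw [mulOp, dif_pos hF]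
  exact (hF.exists_mulOp μ).choose_spec f

theorem IsBddMeas.conj {F : Ω → ℂ} (hF : IsBddMeas F) : IsBddMeas fun x => conj (F x) :=
  ⟨Complex.continuous_conj.measurable.comp hF.measurable, by simpa using hF.bounded⟩

theorem IsBddMeas.mul {F G : Ω → ℂ} (hF : IsBddMeas F) (hG : IsBddMeas G) :
    IsBddMeas fun x => F x * G x := by
  obtain ⟨M, hM⟩ := hF.bounded
  obtain ⟨N, hN⟩ := hG.bounded
  refine ⟨hF.measurable.mul hG.measurable, M * N, fun x => ?_⟩
  rw [norm_mul]
  exact mul_le_mul (hM x) (hN x) (norm_nonneg _) ((norm_nonneg _).trans (hM x))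

theorem IsBddMeas.mulOp_mul {F G : Ω → ℂ} (hF : IsBddMeas F) (hG : IsBddMeas G) :
    mulOp μ F * mulOp μ G = mulOp μ fun x => F x * G x := by
  ext1 f
  refine Lp.ext ?_
  rw [mul_apply_eq_comp]
  filter_upwards [hF.mulOp_ae (mulOp μ G f), hG.mulOp_ae f, (hF.mul hG).mulOp_ae f] with x h1 h2 h3
  rw [h1, h2, h3, mul_assoc]

theorem IsBddMeas.inner_mulOp {F : Ω → ℂ} (hF : IsBddMeas F) (f g : Lp ℂ 2 μ) :
    inner ℂ f (mulOp μ F g) = ∫ x, F x * (g x * conj (f x)) ∂μ := by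
  rw [L2.inner_def]
  refine integral_congr_ae ?_
  filter_upwards [hF.mulOp_ae g] with x hx
  rw [hx, RCLike.inner_apply, mul_assoc]

theorem IsBddMeas.adjoint_mulOp {F : Ω → ℂ} (hF : IsBddMeas F) :
    ContinuousLinearMap.adjoint (mulOp μ F) = mulOp μ fun x => conj (F x) := by
  refine clm_ext_inner fun f => ?_
  rw [ContinuousLinearMap.adjoint_inner_right, ← inner_conj_symm, hF.inner_mulOp,
    hF.conj.inner_mulOp, ← integral_conj]
  refine integral_congr_ae (Eventually.of_forall fun x => ?_)
  simp only [map_mul, Complex.conj_conj]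
  ring

theorem isBddMeas_const (c : ℂ) : IsBddMeas fun _ : Ω => c := ⟨measurable_const, ‖c‖, fun _ => le_rfl⟩

theorem mulOp_one : mulOp μ (fun _ => 1) = 1 := by
  ext1 f
  refine Lp.ext ?_
  filter_upwards [(isBddMeas_const (1 : ℂ)).mulOp_ae f] with x hx
  simp [hx]

theorem isBddMeas_indicator {s : Set Ω} (hs : MeasurableSet s) :
    IsBddMeas (s.indicator fun _ => (1 : ℂ)) := by
  refine ⟨measurable_const.indicator hs, 1, fun x => ?_⟩
  by_cases h : x ∈ s <;> simp [h]

theorem IsBddMeas.comp {F : ℝ → ℂ} (hF : IsBddMeas F) {m : Ω → ℝ} (hm : Measurable m) :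
    IsBddMeas fun x => F (m x) := by
  obtain ⟨M, hM⟩ := hF.bounded
  exact ⟨hF.measurable.comp hm, M, fun x => hM _⟩

theorem inner_mulOp_indicator {s : Set Ω} (hs : MeasurableSet s) (f g : Lp ℂ 2 μ) :
    inner ℂ f (mulOp μ (s.indicator fun _ => (1 : ℂ)) g) = ∫ x in s, g x * conj (f x) ∂μ := by
  rw [(isBddMeas_indicator hs).inner_mulOp, ← integral_indicator hs]
  congr 1
  ext x
  by_cases h : x ∈ s <;> simp [h]

theorem norm_sq_mulOp_indicator {s : Set Ω} (hs : MeasurableSet s) (f : Lp ℂ 2 μ) :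
    ENNReal.ofReal (‖mulOp μ (s.indicator fun _ => (1 : ℂ)) f‖ ^ 2) = ∫⁻ x in s, ‖f x‖ₑ ^ 2 ∂μ := by
  rw [ofReal_norm_sq_eq_lintegral, ← lintegral_indicator hs]
  refine lintegral_congr_ae ?_
  filter_upwards [(isBddMeas_indicator hs).mulOp_ae f] with x hx
  rw [hx]
  by_cases h : x ∈ s <;> simp [h]

/-- The pieces are orthogonal with summable squared norms, so the series converges. Its sum is
identified by pairing with `g`, where the claim is countable additivity of a set integral. -/
theorem hasSum_mulOp_indicator {B : ℕ → Set Ω} (hB : ∀ n, MeasurableSet (B n))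
    (hd : Pairwise (Function.onFun Disjoint B)) (f : Lp ℂ 2 μ) :
    HasSum (fun n => mulOp μ ((B n).indicator fun _ => (1 : ℂ)) f)
      (mulOp μ ((⋃ n, B n).indicator fun _ => (1 : ℂ)) f) := by
  set v : ℕ → Lp ℂ 2 μ := fun n => mulOp μ ((B n).indicator fun _ => (1 : ℂ)) f with hv
  have hU : MeasurableSet (⋃ n, B n) := MeasurableSet.iUnion hB
  have h0 : ∀ m n, m ≠ n → ∀ g : Lp ℂ 2 μ, inner ℂ (v m) (mulOp μ ((B n).indicator fun _ => (1 : ℂ)) g) = 0 := by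
    intro m n hmn g
    rw [inner_mulOp_indicator (hB n), setIntegral_eq_zero_of_ae_eq_zero]
    filter_upwards [(isBddMeas_indicator (hB m)).mulOp_ae f] with x hx hxn
    have : x ∉ B m := fun h => Set.disjoint_left.1 (hd hmn) h hxn
    simp [hv, hx, this]
  have hs : Summable v := by
    have ho : OrthogonalFamily ℂ (fun n => (ℂ ∙ v n : Submodule ℂ (Lp ℂ 2 μ)))
        fun n => (ℂ ∙ v n : Submodule ℂ (Lp ℂ 2 μ)).subtypeₗᵢ := by
      intro m n hmn x y
      obtain ⟨a, ha⟩ := Submodule.mem_span_singleton.1 x.2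
      obtain ⟨b, hb⟩ := Submodule.mem_span_singleton.1 y.2
      simp only [Submodule.coe_subtypeₗᵢ, Submodule.subtype_apply, ← ha, ← hb, inner_smul_left,
        inner_smul_right, hv]
      rw [h0 m n hmn]
      simp
    have h1 := ho.summable_iff_norm_sq_summable fun n =>
      ⟨v n, Submodule.mem_span_singleton_self _⟩
    simp only [Submodule.coe_subtypeₗᵢ, Submodule.subtype_apply, Submodule.coe_norm] at h1
    rw [h1]
    have h2 : ∀ n, ENNReal.ofReal (‖v n‖ ^ 2) = ∫⁻ x in B n, ‖f x‖ₑ ^ 2 ∂μ := fun n =>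
      norm_sq_mulOp_indicator (hB n) f
    have h3 : ∑' n, ENNReal.ofReal (‖v n‖ ^ 2) ≠ ⊤ := by
      simp_rw [h2]
      rw [← lintegral_iUnion hB hd]
      refine ((setLIntegral_le_lintegral _ _).trans_lt ?_).ne
      rw [← ofReal_norm_sq_eq_lintegral]
      exact ENNReal.ofReal_lt_top
    have := ENNReal.summable_toReal h3
    refine this.congr fun n => ?_
    rw [ENNReal.toReal_ofReal (by positivity)]
  obtain ⟨w, hw⟩ := hs
  suffices w = mulOp μ ((⋃ n, B n).indicator fun _ => (1 : ℂ)) f by rwa [← this]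
  refine ext_inner_left ℂ fun g => ?_
  have h3 := hw.mapL (innerSL ℂ g)
  simp only [innerSL_apply_apply, hv, inner_mulOp_indicator (hB _)] at h3
  rw [inner_mulOp_indicator hU]
  refine h3.unique (hasSum_integral_iUnion hB hd ?_)
  have := L2.integrable_inner (𝕜 := ℂ) g f
  simp only [RCLike.inner_apply] at this
  exact this.integrableOn

end Multiplication

/-! ## Operators diagonalized by a unitary involution -/

section Model

variable {Ω : Type*} [MeasurableSpace Ω] {μ : Measure Ω}

/-- A self-adjoint unitary operator. -/
structure IsUnitaryInvolution {H : Type*} [NormedAddCommGroup H] [InnerProductSpace ℂ H]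
    [CompleteSpace H] (Ψ : H →L[ℂ] H) : Prop where
  adjoint_eq : ContinuousLinearMap.adjoint Ψ = Ψ
  mul_self : Ψ * Ψ = 1

theorem IsUnitaryInvolution.apply_apply {H : Type*} [NormedAddCommGroup H] [InnerProductSpace ℂ H]
    [CompleteSpace H] {Ψ : H →L[ℂ] H} (h : IsUnitaryInvolution Ψ) (u : H) : Ψ (Ψ u) = u := by
  rw [← mul_apply_eq_comp, h.mul_self]; rfl

theorem IsUnitaryInvolution.inner_left {H : Type*} [NormedAddCommGroup H] [InnerProductSpace ℂ H]
    [CompleteSpace H] {Ψ : H →L[ℂ] H} (h : IsUnitaryInvolution Ψ) (u v : H) :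
    inner ℂ (Ψ u) v = inner ℂ u (Ψ v) := by
  rw [← ContinuousLinearMap.adjoint_inner_right, h.adjoint_eq]

theorem IsUnitaryInvolution.norm_map {H : Type*} [NormedAddCommGroup H] [InnerProductSpace ℂ H]
    [CompleteSpace H] {Ψ : H →L[ℂ] H} (h : IsUnitaryInvolution Ψ) (u : H) : ‖Ψ u‖ = ‖u‖ := by
  rw [← sq_eq_sq₀ (norm_nonneg _) (norm_nonneg _), ← inner_self_eq_norm_sq (𝕜 := ℂ),
    ← inner_self_eq_norm_sq (𝕜 := ℂ), h.inner_left, h.apply_apply]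

variable {Ψ : Lp ℂ 2 μ →L[ℂ] Lp ℂ 2 μ} {m : Ω → ℝ}

theorem isBddMeas_preimage (hm : Measurable m) {B : Set ℝ} (hB : MeasurableSet B) :
    IsBddMeas ((m ⁻¹' B).indicator fun _ => (1 : ℂ)) :=
  isBddMeas_indicator (hm hB)

/-- The projection-valued measure `B ↦ Ψ 1_B(m) Ψ`. -/
def modelPVM (hΨ : IsUnitaryInvolution Ψ) (hm : Measurable m) :
    ProjectionValuedMeasure (Lp ℂ 2 μ) where
  proj B := Ψ * mulOp μ ((m ⁻¹' B).indicator fun _ => (1 : ℂ)) * Ψ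
  isStarProjection B hB := by
    have hb := isBddMeas_preimage hm hB
    have h1 : mulOp μ ((m ⁻¹' B).indicator fun _ => (1 : ℂ)) *
        mulOp μ ((m ⁻¹' B).indicator fun _ => (1 : ℂ)) =
        mulOp μ ((m ⁻¹' B).indicator fun _ => (1 : ℂ)) := by
      rw [hb.mulOp_mul hb]
      congr 1
      ext x
      by_cases h : x ∈ m ⁻¹' B <;> simp [h]
    have h2 : star (mulOp μ ((m ⁻¹' B).indicator fun _ => (1 : ℂ))) =
        mulOp μ ((m ⁻¹' B).indicator fun _ => (1 : ℂ)) := by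
      rw [ContinuousLinearMap.star_eq_adjoint, hb.adjoint_mulOp]
      congr 1
      ext x
      by_cases h : x ∈ m ⁻¹' B <;> simp [h]
    have h3 : star Ψ = Ψ := hΨ.adjoint_eq
    constructor
    · change _ * _ = _
      calc _ = Ψ * (mulOp μ ((m ⁻¹' B).indicator fun _ => (1 : ℂ)) * (Ψ * Ψ) *
            mulOp μ ((m ⁻¹' B).indicator fun _ => (1 : ℂ))) * Ψ := by simp only [mul_assoc]
        _ = _ := by rw [hΨ.mul_self, mul_one, h1]
    · change star _ = _
      rw [star_mul, star_mul, h2, h3, mul_assoc]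
  univ := by
    simp only [preimage_univ, indicator_univ, mulOp_one, mul_one, hΨ.mul_self]
  inter B B' hB hB' := by
    calc _ = Ψ * (mulOp μ ((m ⁻¹' B).indicator fun _ => (1 : ℂ)) * (Ψ * Ψ) *
            mulOp μ ((m ⁻¹' B').indicator fun _ => (1 : ℂ))) * Ψ := by
          rw [hΨ.mul_self, mul_one,
            (isBddMeas_preimage hm hB).mulOp_mul (isBddMeas_preimage hm hB')]
          congr 3
          ext x
          by_cases h : x ∈ m ⁻¹' B <;> by_cases h' : x ∈ m ⁻¹' B' <;>
            simp_all
      _ = _ := by simp only [mul_assoc]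
  hasSum B hB hd u := by
    have h := hasSum_mulOp_indicator (μ := μ) (B := fun n => m ⁻¹' (B n)) (fun n => hm (hB n))
      (fun i j hij => (hd hij).preimage m) (Ψ u)
    have h' := h.mapL Ψ
    simpa only [preimage_iUnion, mul_apply_eq_comp] using h'

theorem modelPVM_measure (hΨ : IsUnitaryInvolution Ψ) (hm : Measurable m) (u : Lp ℂ 2 μ) :
    (modelPVM hΨ hm).measure u = (μ.withDensity fun x => ‖Ψ u x‖ₑ ^ 2).map m := by
  ext B hB
  rw [ProjectionValuedMeasure.measure_apply _ _ hB, Measure.map_apply hm hB,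
    withDensity_apply _ (hm hB), ← norm_sq_mulOp_indicator (hm hB)]
  change ENNReal.ofReal (‖Ψ _‖ ^ 2) = _
  rw [hΨ.norm_map]
  rfl

theorem lintegral_modelPVM (hΨ : IsUnitaryInvolution Ψ) (hm : Measurable m) (u : Lp ℂ 2 μ)
    {G : ℝ → ℝ≥0∞} (hG : Measurable G) :
    ∫⁻ x, G x ∂((modelPVM hΨ hm).measure u) = ∫⁻ x, ‖Ψ u x‖ₑ ^ 2 * G (m x) ∂μ := by
  rw [modelPVM_measure, lintegral_map hG hm]
  exact lintegral_withDensity_eq_lintegral_mul₀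
    ((Lp.aestronglyMeasurable (Ψ u)).enorm.pow_const 2) (hG.comp hm).aemeasurable

theorem integral_modelPVM (hΨ : IsUnitaryInvolution Ψ) (hm : Measurable m) (u : Lp ℂ 2 μ)
    {G : ℝ → ℂ} (hG : Measurable G) :
    ∫ x, G x ∂((modelPVM hΨ hm).measure u) = ∫ x, G (m x) * (Ψ u x * conj (Ψ u x)) ∂μ := by
  rw [modelPVM_measure, integral_map hm.aemeasurable hG.aestronglyMeasurable,
    integral_withDensity_eq_integral_toReal_smul₀
      ((Lp.aestronglyMeasurable (Ψ u)).enorm.pow_const 2)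
      (Eventually.of_forall fun x => by simp)]
  refine integral_congr_ae (Eventually.of_forall fun x => ?_)
  simp only [ENNReal.toReal_pow, toReal_enorm, Complex.real_smul, Complex.mul_conj']
  push_cast
  ring

/-- The graph condition `Ψ f = m Ψ u`. -/
def IsDiagonalizedBy (T : Lp ℂ 2 μ →ₗ.[ℂ] Lp ℂ 2 μ) (Ψ : Lp ℂ 2 μ →L[ℂ] Lp ℂ 2 μ) (m : Ω → ℝ) :
    Prop :=
  ∀ u f, (u, f) ∈ T.graph ↔ ∀ᵐ x ∂μ, Ψ f x = m x * Ψ u x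

theorem IsDiagonalizedBy.isSpectralMeasure {T : Lp ℂ 2 μ →ₗ.[ℂ] Lp ℂ 2 μ}
    (hT : IsDiagonalizedBy T Ψ m) (hΨ : IsUnitaryInvolution Ψ) (hm : Measurable m) :
    IsSpectralMeasure T (modelPVM hΨ hm) := by
  have key : ∀ u, ∫⁻ x, ENNReal.ofReal (x ^ 2) ∂((modelPVM hΨ hm).measure u) =
      ∫⁻ x, ‖(m x : ℂ) * Ψ u x‖ₑ ^ 2 ∂μ := by
    intro u
    rw [lintegral_modelPVM hΨ hm u (by fun_prop)]
    refine lintegral_congr fun x => ?_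
    rw [enorm_mul, mul_pow, mul_comm, ← ofReal_norm (m x : ℂ), ← ENNReal.ofReal_pow (norm_nonneg _),
      Complex.norm_real, Real.norm_eq_abs, sq_abs]
  have hms : ∀ u, AEStronglyMeasurable (fun x => (m x : ℂ) * Ψ u x) μ := fun u =>
    (Complex.measurable_ofReal.comp hm).aestronglyMeasurable.mul (Lp.aestronglyMeasurable _)
  constructor
  · intro u
    rw [key, ← memLp_two_iff_lintegral (hms u), LinearPMap.mem_domain_iff]
    constructor
    · rintro ⟨f, hf⟩
      exact (Lp.memLp (Ψ f)).ae_eq ((hT u f).1 hf)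
    · intro h
      -- The image of `u` under `T` can only be `Ψ (m Ψ u)`.
      refine ⟨Ψ (h.toLp _), (hT _ _).2 ?_⟩
      rw [hΨ.apply_apply]
      exact h.coeFn_toLp
  · intro u
    have h1 := (hT u (T u)).1 (T.mem_graph u)
    rw [integral_modelPVM hΨ hm _ Complex.measurable_ofReal, ← hΨ.apply_apply (u : Lp ℂ 2 μ),
      hΨ.inner_left, hΨ.apply_apply, L2.inner_def]
    refine integral_congr_ae ?_
    filter_upwards [h1] with x hx
    rw [hx, RCLike.inner_apply, mul_assoc]

theorem IsDiagonalizedBy.isFunctionOf {T : Lp ℂ 2 μ →ₗ.[ℂ] Lp ℂ 2 μ}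
    (hT : IsDiagonalizedBy T Ψ m) (hΨ : IsUnitaryInvolution Ψ) (hm : Measurable m) {F : ℝ → ℂ}
    (hF : IsBddMeas F) : IsFunctionOf T F (Ψ * mulOp μ (fun x => F (m x)) * Ψ) := by
  refine ⟨modelPVM hΨ hm, hT.isSpectralMeasure hΨ hm, fun u => ?_⟩
  rw [mul_apply_eq_comp, mul_apply_eq_comp, ← hΨ.inner_left, (hF.comp hm).inner_mulOp,
    integral_modelPVM hΨ hm _ hF.measurable]

theorem isBddMeas_resolvent (hm : Measurable m) (hm0 : ∀ x, 0 ≤ m x) :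
    IsBddMeas fun x => (((1 + m x)⁻¹ : ℝ) : ℂ) := by
  refine ⟨by fun_prop, 1, fun x => ?_⟩
  rw [Complex.norm_real, Real.norm_of_nonneg (by have := hm0 x; positivity)]
  exact inv_le_one_of_one_le₀ (by linarith [hm0 x])

/-- A Friedrichs operator whose resolvent at `-1` is `Ψ (1 + m)⁻¹ Ψ`. -/
theorem isDiagonalizedBy_friedrichs {V : Type*} [AddCommGroup V] [Module ℂ V]
    {j : V → Lp ℂ 2 μ} {q : V → V → ℂ} (hΨ : IsUnitaryInvolution Ψ) (hm : Measurable m)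
    (hm0 : ∀ x, 0 ≤ m x)
    (h : ∀ u f, (u, f) ∈ formGraph j q ↔
      (Ψ * mulOp μ (fun x => (((1 + m x)⁻¹ : ℝ) : ℂ)) * Ψ) (u + f) = u) :
    IsDiagonalizedBy (friedrichs j q) Ψ m := by
  have hb := isBddMeas_resolvent hm hm0
  set R := Ψ * mulOp μ (fun x => (((1 + m x)⁻¹ : ℝ) : ℂ)) * Ψ with hR
  -- After conjugation by `Ψ` the equation reads `(1 + m)⁻¹ (Ψ u + Ψ f) = Ψ u`, which is `Ψ f = m Ψ
  -- u` pointwise.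
  have key : ∀ u f, R (u + f) = u ↔ ∀ᵐ x ∂μ, Ψ f x = m x * Ψ u x := by
    intro u f
    have e1 : R (u + f) = u ↔ mulOp μ (fun x => (((1 + m x)⁻¹ : ℝ) : ℂ)) (Ψ (u + f)) = Ψ u := by
      rw [hR, mul_apply_eq_comp, mul_apply_eq_comp]
      refine ⟨fun h => ?_, fun h => ?_⟩
      · rw [← h, hΨ.apply_apply, h]
      · rw [h, hΨ.apply_apply]
    rw [e1, Lp.ext_iff]
    have h3 := hb.mulOp_ae (μ := μ) (Ψ (u + f))
    rw [map_add] at h3 ⊢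
    have hx0 : ∀ x, (1 : ℂ) + (m x : ℂ) ≠ 0 := fun x h => by
      have : (1 : ℝ) + m x = 0 := by exact_mod_cast h
      linarith [hm0 x]
    constructor
    · intro h
      filter_upwards [h, h3, Lp.coeFn_add (Ψ u) (Ψ f)] with x h1 h2 h4
      rw [h1, h4, Pi.add_apply] at h2
      push_cast at h2
      have := hx0 x
      field_simp at h2
      linear_combination -h2
    · intro h
      filter_upwards [h, h3, Lp.coeFn_add (Ψ u) (Ψ f)] with x h1 h2 h4
      rw [h2, h4, Pi.add_apply, h1]
      push_cast
      have := hx0 x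
      field_simp
  -- The condition `R (u + f) = u` is linear in the pair, so the span in `friedrichs` adds nothing.
  let G : Submodule ℂ (Lp ℂ 2 μ × Lp ℂ 2 μ) :=
    { carrier := formGraph j q
      add_mem' := by
        rintro ⟨u, f⟩ ⟨u', f'⟩ h1 h2
        rw [h] at h1 h2
        change (u + u', f + f') ∈ _
        rw [h, add_add_add_comm, map_add, h1, h2]
      zero_mem' := by
        change ((0 : Lp ℂ 2 μ), (0 : Lp ℂ 2 μ)) ∈ _
        rw [h]
        simp
      smul_mem' := by
        rintro c ⟨u, f⟩ h1
        rw [h] at h1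
        change (c • u, c • f) ∈ _
        rw [h, ← smul_add, map_smul, h1] }
  have hG : Submodule.span ℂ (formGraph j q) = G := Submodule.span_eq G
  have hg : (friedrichs j q).graph = G := by
    rw [friedrichs, hG]
    -- The graph is single-valued: `u = 0` forces `Ψ f = 0`, hence `f = 0`.
    refine Submodule.toLinearPMap_graph_eq _ ?_
    rintro ⟨u, f⟩ h1 h2
    have h1' := (key u f).1 ((h u f).1 h1)
    simp only at h2
    subst h2
    have : Ψ f = 0 := by
      refine Lp.ext ?_
      filter_upwards [h1', Lp.coeFn_zero ℂ 2 μ] with x hx hz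
      rw [hx, map_zero, hz]
      simp
    simpa [this] using (hΨ.apply_apply f).symm
  intro u f
  rw [hg, ← key u f]
  exact h u f

end Model

/-! ## Injectivity of the Laplace transform -/

section Laplace

instance : PolishSpace (Ioi (0 : ℝ)) := isOpen_Ioi.polishSpace

/-- The function `r ↦ exp (-r² / 2)` on the half line. -/
def gaussBCF : BoundedContinuousFunction (Ioi (0 : ℝ)) ℝ :=
  BoundedContinuousFunction.ofNormedAddCommGroup (fun r => Real.exp (-((r : ℝ) ^ 2 / 2)))
    (by fun_prop) 1 (fun r => by
      rw [Real.norm_of_nonneg (Real.exp_pos _).le, Real.exp_le_one_iff]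
      have : (0 : ℝ) ≤ (r : ℝ) ^ 2 / 2 := by positivity
      linarith)

theorem gaussBCF_apply (r : Ioi (0 : ℝ)) : gaussBCF r = Real.exp (-((r : ℝ) ^ 2 / 2)) := rfl

variable {ρ : Measure (Ioi (0 : ℝ))}

/-- Put `G = F exp(-r²/2)`. The hypothesis at the integers `s = n + 1` says that `G` is orthogonal
to all polynomials in `exp(-r²/2)`. These form an algebra that separates the points of `(0, ∞)`, so
the positive and negative parts of `G` are densities of the same finite measure. -/
theorem ae_eq_zero_of_laplace_real {F : Ioi (0 : ℝ) → ℝ}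
    (hi : ∀ s : ℝ, 0 < s → Integrable (fun r => F r * Real.exp (-(s * (r : ℝ) ^ 2 / 2))) ρ)
    (h0 : ∀ s : ℝ, 0 < s → ∫ r, F r * Real.exp (-(s * (r : ℝ) ^ 2 / 2)) ∂ρ = 0) : F =ᵐ[ρ] 0 := by
  set G : Ioi (0 : ℝ) → ℝ := fun r => F r * Real.exp (-(1 * (r : ℝ) ^ 2 / 2)) with hG
  have hGi : Integrable G ρ := hi 1 one_pos
  have hfin : ∀ u : ℝ → ℝ≥0∞, (∀ x, u x ≤ ‖x‖ₑ) → ∫⁻ r, u (G r) ∂ρ ≠ ⊤ := fun u hu =>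
    ((lintegral_mono fun r => hu (G r)).trans_lt hGi.hasFiniteIntegral).ne
  have hu1 : ∀ x : ℝ, ENNReal.ofReal x ≤ ‖x‖ₑ := fun x => by
    rw [← ofReal_norm]; exact ENNReal.ofReal_le_ofReal (le_abs_self x)
  have hu2 : ∀ x : ℝ, ENNReal.ofReal (-x) ≤ ‖x‖ₑ := fun x => by
    rw [← ofReal_norm]; exact ENNReal.ofReal_le_ofReal (neg_le_abs x)
  set P := ρ.withDensity fun r => ENNReal.ofReal (G r) with hP
  set N := ρ.withDensity fun r => ENNReal.ofReal (-G r) with hN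
  have mP : AEMeasurable (fun r => ENNReal.ofReal (G r)) ρ := hGi.aemeasurable.ennreal_ofReal
  have mN : AEMeasurable (fun r => ENNReal.ofReal (-G r)) ρ := hGi.aemeasurable.neg.ennreal_ofReal
  have fP : ∫⁻ r, ENNReal.ofReal (G r) ∂ρ ≠ ⊤ := hfin _ hu1
  have fN : ∫⁻ r, ENNReal.ofReal (-G r) ∂ρ ≠ ⊤ := hfin (fun x => ENNReal.ofReal (-x)) hu2
  have : IsFiniteMeasure P := isFiniteMeasure_withDensity fP
  have : IsFiniteMeasure N := isFiniteMeasure_withDensity fN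
  have hpoly : ∀ p : Polynomial ℝ, Integrable (fun r => G r * p.eval (gaussBCF r)) ρ ∧
      ∫ r, G r * p.eval (gaussBCF r) ∂ρ = 0 := by
    intro p
    induction p using Polynomial.induction_on' with
    | add p q hp hq =>
      simp only [Polynomial.eval_add, mul_add]
      exact ⟨hp.1.add hq.1, by rw [integral_add hp.1 hq.1, hp.2, hq.2, add_zero]⟩
    | monomial n c =>
      have : (fun r : Ioi (0 : ℝ) => G r * (Polynomial.monomial n c).eval (gaussBCF r)) =
          fun r => c * (F r * Real.exp (-(((n : ℝ) + 1) * (r : ℝ) ^ 2 / 2))) := by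
        ext r
        rw [Polynomial.eval_monomial, gaussBCF_apply, ← Real.exp_nat_mul, hG]
        have : Real.exp (-(((n : ℝ) + 1) * (r : ℝ) ^ 2 / 2)) =
            Real.exp (-(1 * (r : ℝ) ^ 2 / 2)) * Real.exp (n * -((r : ℝ) ^ 2 / 2)) := by
          rw [← Real.exp_add]; congr 1; ring
        rw [this]
        ring
      rw [this]
      exact ⟨(hi _ (by positivity)).const_mul c, by
        rw [integral_const_mul, h0 _ (by positivity), mul_zero]⟩
  let A : StarSubalgebra ℝ (BoundedContinuousFunction (Ioi (0 : ℝ)) ℝ) :=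
    { carrier := {g | ∃ p : Polynomial ℝ, ∀ r, g r = p.eval (gaussBCF r)}
      mul_mem' := by
        rintro g g' ⟨p, hp⟩ ⟨p', hp'⟩
        exact ⟨p * p', fun r => by simp [hp, hp']⟩
      add_mem' := by
        rintro g g' ⟨p, hp⟩ ⟨p', hp'⟩
        exact ⟨p + p', fun r => by simp [hp, hp']⟩
      algebraMap_mem' := fun c => ⟨Polynomial.C c, fun r => by simp⟩
      star_mem' := by
        rintro g ⟨p, hp⟩
        exact ⟨p, fun r => by simp [hp]⟩ }
  have hPN : P = N := by
    refine ext_of_forall_mem_subalgebra_integral_eq_of_polish (A := A) ?_ ?_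
    · intro x y hxy
      refine ⟨gaussBCF, ⟨gaussBCF.toContinuousMapStarₐ ℝ,
        ⟨gaussBCF, ⟨Polynomial.X, fun r => by simp⟩, rfl⟩, rfl⟩, fun h => hxy ?_⟩
      have h1 : gaussBCF x = gaussBCF y := h
      rw [gaussBCF_apply, gaussBCF_apply, Real.exp_eq_exp] at h1
      have hx : (0 : ℝ) < x := x.2
      have hy : (0 : ℝ) < y := y.2
      have h2 : (x : ℝ) ^ 2 = (y : ℝ) ^ 2 := by linarith
      exact Subtype.ext ((pow_left_inj₀ hx.le hy.le two_ne_zero).1 h2)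
    · rintro g ⟨p, hp⟩
      rw [hP, hN, integral_withDensity_eq_integral_toReal_smul₀ mP
        (Eventually.of_forall fun _ => ENNReal.ofReal_lt_top),
        integral_withDensity_eq_integral_toReal_smul₀ mN
        (Eventually.of_forall fun _ => ENNReal.ofReal_lt_top), ← sub_eq_zero, ← integral_sub]
      · refine Eq.trans ?_ (hpoly p).2
        refine integral_congr_ae (Eventually.of_forall fun r => ?_)
        simp only [smul_eq_mul, ← sub_mul, ← hp]
        congr 1
        rw [ENNReal.toReal_ofReal', ENNReal.toReal_ofReal']
        exact max_zero_sub_eq_self (G r)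
      · rw [← integrable_withDensity_iff_integrable_smul₀' mP
          (Eventually.of_forall fun _ => ENNReal.ofReal_lt_top)]
        exact g.integrable P
      · rw [← integrable_withDensity_iff_integrable_smul₀' mN
          (Eventually.of_forall fun _ => ENNReal.ofReal_lt_top)]
        exact g.integrable N
  rw [hP, hN, withDensity_eq_iff mP mN fP] at hPN
  filter_upwards [hPN] with r hr
  have h1 : G r = 0 := by
    rcases le_total 0 (G r) with h | h
    · rw [ENNReal.ofReal_of_nonpos (neg_nonpos.2 h), ENNReal.ofReal_eq_zero] at hr
      exact le_antisymm hr h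
    · rw [ENNReal.ofReal_of_nonpos h, eq_comm, ENNReal.ofReal_eq_zero] at hr
      linarith
  exact (mul_eq_zero.1 h1).resolve_right (Real.exp_ne_zero _)

theorem ae_eq_zero_of_laplace {F : Ioi (0 : ℝ) → ℂ}
    (hi : ∀ s : ℝ, 0 < s →
      Integrable (fun r => F r * (Real.exp (-(s * (r : ℝ) ^ 2 / 2)) : ℂ)) ρ)
    (h0 : ∀ s : ℝ, 0 < s → ∫ r, F r * (Real.exp (-(s * (r : ℝ) ^ 2 / 2)) : ℂ) ∂ρ = 0) :
    F =ᵐ[ρ] 0 := by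
  have h1 : (fun r => (F r).re) =ᵐ[ρ] 0 := by
    refine ae_eq_zero_of_laplace_real (fun s hs => ?_) fun s hs => ?_
    · simpa only [Complex.re_mul_ofReal, RCLike.re_to_complex] using (hi s hs).re
    · have h2 := integral_re (hi s hs)
      rw [h0 s hs] at h2
      simpa only [Complex.re_mul_ofReal, RCLike.re_to_complex, map_zero, Complex.zero_re] using h2
  have h2 : (fun r => (F r).im) =ᵐ[ρ] 0 := by
    refine ae_eq_zero_of_laplace_real (fun s hs => ?_) fun s hs => ?_
    · simpa only [Complex.im_mul_ofReal, RCLike.im_to_complex] using (hi s hs).im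
    · have h2 := integral_im (hi s hs)
      rw [h0 s hs] at h2
      simpa only [Complex.im_mul_ofReal, RCLike.im_to_complex, map_zero, Complex.zero_im] using h2
  filter_upwards [h1, h2] with r hr1 hr2
  exact Complex.ext hr1 hr2

end Laplace

/-! ## Radial Gaussian integrals -/

section Radial

variable {d : ℕ} {E : Type*} [NormedAddCommGroup E] [NormedSpace ℝ E]

theorem measurable_radialDensity (d : ℕ) :
    Measurable fun r : Ioi (0 : ℝ) => ENNReal.ofReal ((r : ℝ) ^ (d - 1)) := by fun_prop

theorem integrable_radial_iff {f : ℝ → E} :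
    Integrable (fun r : Ioi (0 : ℝ) => f r) (radialMeasure d) ↔
      IntegrableOn (fun r : ℝ => r ^ (d - 1) • f r) (Ioi 0) := by
  rw [integrableOn_iff_comap_subtypeVal measurableSet_Ioi, radialMeasure, Measure.volumeIoiPow,
    integrable_withDensity_iff_integrable_smul' (measurable_radialDensity d)
      (Eventually.of_forall fun _ => ENNReal.ofReal_lt_top)]
  refine integrable_congr (Eventually.of_forall fun r => ?_)
  have hr : (0 : ℝ) < r := r.2
  simp only [Function.comp_def, ENNReal.toReal_ofReal (pow_nonneg hr.le _)]

theorem integral_radial (f : ℝ → E) :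
    ∫ r : Ioi (0 : ℝ), f r ∂(radialMeasure d) = ∫ r in Ioi (0 : ℝ), r ^ (d - 1) • f r := by
  rw [radialMeasure, Measure.volumeIoiPow,
    integral_withDensity_eq_integral_toReal_smul (measurable_radialDensity d)
      (Eventually.of_forall fun _ => ENNReal.ofReal_lt_top),
    ← integral_subtype_comap measurableSet_Ioi fun r : ℝ => r ^ (d - 1) • f r]
  refine integral_congr_ae (Eventually.of_forall fun r => ?_)
  have hr : (0 : ℝ) < r := r.2
  simp only [ENNReal.toReal_ofReal (pow_nonneg hr.le _)]

theorem radial_integrand_eq (hd : 1 ≤ d) (q s : ℝ) {r : ℝ} (hr : r ∈ Ioi (0 : ℝ)) :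
    r ^ (d - 1) • (r ^ q * Real.exp (-(s * r ^ 2 / 2))) =
      r ^ (q + d - 1) * Real.exp (-(s / 2) * r ^ (2 : ℝ)) := by
  have hr' : (0 : ℝ) < r := hr
  rw [smul_eq_mul, ← mul_assoc, ← Real.rpow_natCast, ← Real.rpow_add hr', Real.rpow_two,
    Nat.cast_sub hd]
  congr 2
  · push_cast; ring
  · ring

theorem integrable_radial_moment (hd : 1 ≤ d) {q s : ℝ} (hq : 0 < q + d) (hs : 0 < s) :
    Integrable (fun r : Ioi (0 : ℝ) => (r : ℝ) ^ q * Real.exp (-(s * (r : ℝ) ^ 2 / 2)))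
      (radialMeasure d) := by
  rw [integrable_radial_iff (f := fun r => r ^ q * Real.exp (-(s * r ^ 2 / 2))),
    integrableOn_congr_fun (fun r hr => radial_integrand_eq hd q s hr) measurableSet_Ioi]
  exact integrableOn_rpow_mul_exp_neg_mul_rpow (by linarith) two_pos (by positivity)

theorem integral_radial_moment (hd : 1 ≤ d) {q s : ℝ} (hq : 0 < q + d) (hs : 0 < s) :
    ∫ r : Ioi (0 : ℝ), (r : ℝ) ^ q * Real.exp (-(s * (r : ℝ) ^ 2 / 2)) ∂(radialMeasure d) =
      (s / 2) ^ (-((q + d) / 2)) * (1 / 2) * Real.Gamma ((q + d) / 2) := by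
  rw [integral_radial (fun r => r ^ q * Real.exp (-(s * r ^ 2 / 2))),
    setIntegral_congr_fun measurableSet_Ioi (fun r hr => radial_integrand_eq hd q s hr),
    integral_rpow_mul_exp_neg_mul_rpow two_pos (by linarith) (by positivity)]
  congr 3 <;> ring

end Radial

/-! ## Operators determined on total families -/

section Total

variable {ι H : Type*} [NormedAddCommGroup H] [InnerProductSpace ℂ H]

theorem inner_linearCombination (v w : ι → H) (x y : ι →₀ ℂ) :
    inner ℂ (Finsupp.linearCombination ℂ v x) (Finsupp.linearCombination ℂ w y) =
      x.sum fun i a => y.sum fun j b => conj a * (b * inner ℂ (v i) (w j)) := by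
  simp only [Finsupp.linearCombination_apply, Finsupp.sum, sum_inner, inner_sum, inner_smul_left,
    inner_smul_right, Finset.mul_sum]
  rw [Finset.sum_comm]
  refine Finset.sum_congr rfl fun i _ => Finset.sum_congr rfl fun j _ => ?_
  ring

variable [CompleteSpace H]

/-- A family whose linear span is dense. -/
def IsTotal (v : ι → H) : Prop := ∀ f : H, (∀ i, inner ℂ (v i) f = 0) → f = 0

theorem IsTotal.denseRange {v : ι → H} (hv : IsTotal v) :
    DenseRange (Finsupp.linearCombination ℂ v) := by
  have h1 : (LinearMap.range (Finsupp.linearCombination ℂ v)).topologicalClosure = ⊤ := by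
    rw [Submodule.topologicalClosure_eq_top_iff, Submodule.eq_bot_iff]
    intro f hf
    refine hv f fun i => (Submodule.mem_orthogonal _ _).1 hf _ ⟨Finsupp.single i 1, ?_⟩
    simp
  intro x
  have : x ∈ (LinearMap.range (Finsupp.linearCombination ℂ v)).topologicalClosure := by
    rw [h1]; trivial
  exact this

theorem IsTotal.clm_ext {H' : Type*} [NormedAddCommGroup H'] [InnerProductSpace ℂ H'] {v : ι → H}
    (hv : IsTotal v) {S T : H →L[ℂ] H'} (h : ∀ i, S (v i) = T (v i)) : S = T := by
  have := hv.denseRange.equalizer S.continuous T.continuous (by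
    ext x
    induction x using Finsupp.induction_linear with
    | zero => simp
    | add x y hx hy => simp only [Function.comp_apply, map_add] at *; rw [hx, hy]
    | single i c => simp [h])
  exact DFunLike.coe_injective this

/-- A symmetric, Gram-matrix preserving map of a total family extends to a unitary involution. -/
theorem IsTotal.exists_involution {v w : ι → H} (hv : IsTotal v)
    (h1 : ∀ i j, inner ℂ (w i) (w j) = inner ℂ (v i) (v j))
    (h2 : ∀ i j, inner ℂ (w i) (v j) = inner ℂ (v i) (w j)) :
    ∃ U : H →L[ℂ] H, IsUnitaryInvolution U ∧ ∀ i, U (v i) = w i := by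
  -- Equal Gram matrices make the map `∑ cᵢ vᵢ ↦ ∑ cᵢ wᵢ` well defined and isometric.
  have hn : ∀ x, ‖Finsupp.linearCombination ℂ w x‖ = ‖Finsupp.linearCombination ℂ v x‖ := by
    intro x
    rw [← sq_eq_sq₀ (norm_nonneg _) (norm_nonneg _), ← inner_self_eq_norm_sq (𝕜 := ℂ),
      ← inner_self_eq_norm_sq (𝕜 := ℂ), inner_linearCombination, inner_linearCombination]
    simp only [h1]
  set U := (Finsupp.linearCombination ℂ w).extendOfNorm (Finsupp.linearCombination ℂ v) with hU
  have hUe : ∀ x, U (Finsupp.linearCombination ℂ v x) = Finsupp.linearCombination ℂ w x :=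
    fun x => LinearMap.extendOfNorm_eq hv.denseRange ⟨1, fun x => by rw [one_mul, hn]⟩ x
  have hUv : ∀ i, U (v i) = w i := fun i => by simpa using hUe (Finsupp.single i 1)
  -- The mixed Gram condition `h2` is the symmetry of `U` on the family; together with `h1` it gives
  -- `U² = U* U = 1`.
  have hadj : ContinuousLinearMap.adjoint U = U := by
    refine hv.clm_ext fun j => sub_eq_zero.1 (hv _ fun i => ?_)
    rw [inner_sub_right, ContinuousLinearMap.adjoint_inner_right, hUv, hUv, h2, sub_self]
  refine ⟨U, ⟨hadj, hv.clm_ext fun j => sub_eq_zero.1 (hv _ fun i => ?_)⟩, hUv⟩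
  rw [inner_sub_right, mul_apply_eq_comp]
  nth_rw 1 [← hadj]
  rw [ContinuousLinearMap.adjoint_inner_right, hUv, hUv, h1]
  simp

end Total

/-! ## Gaussians in `L²((0, ∞), r^{d-1} dr)` -/

section Gauss

/-- The function `r^{ν-(d-2)/2} exp (-s r² / 2)`. -/
def gaussFun (d : ℕ) (ν s r : ℝ) : ℝ := r ^ (ν - ((d : ℝ) - 2) / 2) * Real.exp (-(s * r ^ 2 / 2))

theorem gaussFun_pos (d : ℕ) (ν s : ℝ) {r : ℝ} (hr : 0 < r) : 0 < gaussFun d ν s r := by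
  rw [gaussFun]; positivity

theorem measurable_gaussFun (d : ℕ) (ν s : ℝ) : Measurable (gaussFun d ν s) := by
  unfold gaussFun; fun_prop

theorem gaussFun_mul (d : ℕ) (ν s t : ℝ) {r : ℝ} (hr : 0 < r) :
    gaussFun d ν s r * gaussFun d ν t r =
      r ^ (2 * ν - ((d : ℝ) - 2)) * Real.exp (-((s + t) * r ^ 2 / 2)) := by
  rw [gaussFun, gaussFun, mul_mul_mul_comm, ← Real.rpow_add hr, ← Real.exp_add]
  congr 2 <;> ring

variable {d : ℕ} {ν : ℝ}

theorem integrable_pow_gauss (hd : 1 ≤ d) (hν : 0 ≤ ν) (n : ℕ) {s t : ℝ} (hs : 0 < s) (ht : 0 < t) :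
    Integrable (fun r : Ioi (0 : ℝ) => (r : ℝ) ^ n * (gaussFun d ν s r * gaussFun d ν t r))
      (radialMeasure d) := by
  have h := integrable_radial_moment (d := d) hd (q := n + (2 * ν - ((d : ℝ) - 2))) (s := s + t)
    (by have : (0 : ℝ) ≤ n := Nat.cast_nonneg n; linarith) (by positivity)
  refine h.congr (Eventually.of_forall fun r => ?_)
  have hr : (0 : ℝ) < r := r.2
  simp only
  rw [gaussFun_mul d ν s t hr, ← mul_assoc, Real.rpow_add hr, Real.rpow_natCast]

/-- The Gram matrix of the Gaussians, as a function of `s + t`. -/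
def gaussGram (ν a : ℝ) : ℝ := (a / 2) ^ (-(ν + 1)) * (1 / 2) * Real.Gamma (ν + 1)

theorem integral_gauss (hd : 1 ≤ d) (hν : 0 ≤ ν) {s t : ℝ} (hs : 0 < s) (ht : 0 < t) :
    ∫ r : Ioi (0 : ℝ), gaussFun d ν s r * gaussFun d ν t r ∂(radialMeasure d) =
      gaussGram ν (s + t) := by
  have h := integral_radial_moment (d := d) hd (q := 2 * ν - ((d : ℝ) - 2)) (s := s + t)
    (by linarith) (by positivity)
  rw [gaussGram, ← show (2 * ν - ((d : ℝ) - 2) + d) / 2 = ν + 1 by ring, ← h]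
  refine integral_congr_ae (Eventually.of_forall fun r => ?_)
  exact gaussFun_mul d ν s t r.2

/-- The additional `r²` replaces `Γ(ν + 1)` by `Γ(ν + 2)`, and the functional equation of the Gamma
function yields the ratio `2(ν + 1)/(s + t)`. -/
theorem integral_sq_gauss (hd : 1 ≤ d) (hν : 0 ≤ ν) {s t : ℝ} (hs : 0 < s) (ht : 0 < t) :
    ∫ r : Ioi (0 : ℝ), (r : ℝ) ^ 2 * (gaussFun d ν s r * gaussFun d ν t r) ∂(radialMeasure d) =
      2 * (ν + 1) / (s + t) * gaussGram ν (s + t) := by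
  have h := integral_radial_moment (d := d) hd (q := 2 + (2 * ν - ((d : ℝ) - 2))) (s := s + t)
    (by linarith) (by positivity)
  have h1 : ∫ r : Ioi (0 : ℝ), (r : ℝ) ^ 2 * (gaussFun d ν s r * gaussFun d ν t r)
      ∂(radialMeasure d) = ∫ r : Ioi (0 : ℝ), (r : ℝ) ^ (2 + (2 * ν - ((d : ℝ) - 2))) *
        Real.exp (-((s + t) * (r : ℝ) ^ 2 / 2)) ∂(radialMeasure d) := by
    refine integral_congr_ae (Eventually.of_forall fun r => ?_)
    have hr : (0 : ℝ) < r := r.2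
    simp only
    rw [gaussFun_mul d ν s t hr, ← mul_assoc, Real.rpow_add hr, Real.rpow_two]
  have hst : 0 < (s + t) / 2 := by positivity
  rw [h1, h, gaussGram, show (2 + (2 * ν - ((d : ℝ) - 2)) + d) / 2 = ν + 1 + 1 by ring,
    Real.Gamma_add_one (by positivity), show -(ν + 1 + 1) = -(ν + 1) + (-1) by ring,
    Real.rpow_add hst, Real.rpow_neg_one]
  field_simp

theorem memLp_gauss (hd : 1 ≤ d) (hν : 0 ≤ ν) (b c : ℝ) {s : ℝ} (hs : 0 < s) :
    MemLp (fun r : Ioi (0 : ℝ) => (((b + c * (r : ℝ) ^ 2) * gaussFun d ν s r : ℝ) : ℂ)) 2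
      (radialMeasure d) := by
  have hm : Measurable fun r : Ioi (0 : ℝ) =>
      (((b + c * (r : ℝ) ^ 2) * gaussFun d ν s r : ℝ) : ℂ) := by
    have := (measurable_gaussFun d ν s).comp (measurable_subtype_coe (p := fun r : ℝ => r ∈ Ioi 0))
    refine Complex.measurable_ofReal.comp (Measurable.mul (by fun_prop) this)
  rw [memLp_two_iff_integrable_sq_norm hm.aestronglyMeasurable]
  have h := (((integrable_pow_gauss hd hν 0 hs hs).const_mul (b ^ 2)).add
    ((integrable_pow_gauss hd hν 2 hs hs).const_mul (2 * b * c))).add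
    ((integrable_pow_gauss hd hν 4 hs hs).const_mul (c ^ 2))
  refine h.congr (Eventually.of_forall fun r => ?_)
  simp only [Pi.add_apply, Complex.norm_real, Real.norm_eq_abs, sq_abs]
  ring

open Classical in
/-- The function `(b + c r²) r^{ν-(d-2)/2} exp (-s r² / 2)` in `L²`. -/
def gaussLp (d : ℕ) (ν b c s : ℝ) : L2Radial d :=
  if h : MemLp (fun r : Ioi (0 : ℝ) => (((b + c * (r : ℝ) ^ 2) * gaussFun d ν s r : ℝ) : ℂ)) 2
    (radialMeasure d) then h.toLp _ else 0

theorem gaussLp_ae (hd : 1 ≤ d) (hν : 0 ≤ ν) (b c : ℝ) {s : ℝ} (hs : 0 < s) :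
    gaussLp d ν b c s =ᵐ[radialMeasure d]
      fun r => (((b + c * (r : ℝ) ^ 2) * gaussFun d ν s r : ℝ) : ℂ) := by
  rw [gaussLp, dif_pos (memLp_gauss hd hν b c hs)]
  exact MemLp.coeFn_toLp _

theorem inner_gaussLp (hd : 1 ≤ d) (hν : 0 ≤ ν) (b c : ℝ) {s t : ℝ} (hs : 0 < s) (ht : 0 < t) :
    inner ℂ (gaussLp d ν b c s) (gaussLp d ν 1 0 t) =
      (((b + c * (2 * (ν + 1) / (s + t))) * gaussGram ν (s + t) : ℝ) : ℂ) := by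
  have h1 : (((b + c * (2 * (ν + 1) / (s + t))) * gaussGram ν (s + t) : ℝ)) =
      ∫ r : Ioi (0 : ℝ), (b + c * (r : ℝ) ^ 2) * (gaussFun d ν s r * gaussFun d ν t r)
        ∂(radialMeasure d) := by
    have h0 := integrable_pow_gauss (d := d) hd hν 0 hs ht
    simp only [pow_zero, one_mul] at h0
    have h2 := integrable_pow_gauss (d := d) hd hν 2 hs ht
    simp only [add_mul, mul_assoc]
    rw [integral_add (h0.const_mul b) (h2.const_mul c), integral_const_mul, integral_const_mul,
      integral_gauss hd hν hs ht, integral_sq_gauss hd hν hs ht]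
  rw [h1, ← integral_complex_ofReal, L2.inner_def]
  refine integral_congr_ae ?_
  filter_upwards [gaussLp_ae hd hν b c hs, gaussLp_ae hd hν 1 0 ht] with r h2 h3
  rw [h2, h3, RCLike.inner_apply, Complex.conj_ofReal]
  push_cast
  ring

/-- Orthogonality to the family says that a positive weight times `f` has vanishing Laplace
transform in the variable `r²/2`. The factor `b + c r²` is kept general so as to cover both `g_s`
and `(1 + r²) g_s`. -/
theorem isTotal_gaussLp (hd : 1 ≤ d) (hν : 0 ≤ ν) {b c : ℝ} (hb : 0 < b) (hc : 0 ≤ c) :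
    IsTotal fun s : Ioi (0 : ℝ) => gaussLp d ν b c s := by
  intro f hf
  have key : ∀ s : ℝ, 0 < s → (fun r => inner ℂ (gaussLp d ν b c s r) (f r)) =ᵐ[radialMeasure d]
      fun r : Ioi (0 : ℝ) => (((b + c * (r : ℝ) ^ 2) * (r : ℝ) ^ (ν - ((d : ℝ) - 2) / 2) : ℝ) : ℂ) *
        f r * (Real.exp (-(s * (r : ℝ) ^ 2 / 2)) : ℂ) := by
    intro s hs
    filter_upwards [gaussLp_ae hd hν b c hs] with r hr
    rw [hr, RCLike.inner_apply, Complex.conj_ofReal, gaussFun]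
    push_cast
    ring
  have h0 : (fun r : Ioi (0 : ℝ) => (((b + c * (r : ℝ) ^ 2) *
      (r : ℝ) ^ (ν - ((d : ℝ) - 2) / 2) : ℝ) : ℂ) * f r) =ᵐ[radialMeasure d] 0 := by
    refine ae_eq_zero_of_laplace (fun s hs => ?_) fun s hs => ?_
    · exact (L2.integrable_inner (𝕜 := ℂ) (gaussLp d ν b c s) f).congr (key s hs)
    · rw [← integral_congr_ae (key s hs), ← L2.inner_def]
      exact hf ⟨s, hs⟩
  refine Lp.ext ?_
  filter_upwards [h0, Lp.coeFn_zero ℂ 2 (radialMeasure d)] with r hr hz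
  rw [hz]
  refine (mul_eq_zero.1 hr).resolve_left ?_
  have : (0 : ℝ) < r := r.2
  have : (0 : ℝ) < (b + c * (r : ℝ) ^ 2) * (r : ℝ) ^ (ν - ((d : ℝ) - 2) / 2) := by positivity
  exact_mod_cast this.ne'

/-- The Gram function is homogeneous of degree `-(ν + 1)`, so it absorbs the normalizing factors of
`gaussImage`. -/
theorem gaussGram_mul {a s : ℝ} (ha : 0 < a) (hs : 0 < s) :
    s ^ (-(ν + 1)) * gaussGram ν a = gaussGram ν (s * a) := by
  rw [gaussGram, gaussGram, ← mul_assoc, ← mul_assoc, ← Real.mul_rpow hs.le (by positivity)]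
  ring_nf

/-- The image `s^{-ν-1} g_{1/s}` of a Gaussian under the Hankel transform. -/
def gaussImage (d : ℕ) (ν b c s : ℝ) : L2Radial d :=
  ((s ^ (-(ν + 1)) : ℝ) : ℂ) • gaussLp d ν b c s⁻¹

/-- By homogeneity the two Gram conditions become `s t (s⁻¹ + t⁻¹) = s + t` and `s (s⁻¹ + t) = t (s
+ t⁻¹)`. -/
theorem exists_hankelOp (hd : 1 ≤ d) (hν : 0 ≤ ν) :
    ∃ U : L2Radial d →L[ℂ] L2Radial d, IsUnitaryInvolution U ∧
      ∀ s : Ioi (0 : ℝ), U (gaussLp d ν 1 0 s) = gaussImage d ν 1 0 s := by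
  refine (isTotal_gaussLp hd hν one_pos le_rfl).exists_involution (fun s t => ?_) fun s t => ?_
  all_goals
    obtain ⟨s, hs⟩ := s
    obtain ⟨t, ht⟩ := t
    rw [mem_Ioi] at hs ht
    simp only [gaussImage, inner_smul_left, inner_smul_right, Complex.conj_ofReal]
  · rw [inner_gaussLp hd hν 1 0 (inv_pos.2 hs) (inv_pos.2 ht), inner_gaussLp hd hν 1 0 hs ht,
      ← Complex.ofReal_mul, ← Complex.ofReal_mul]
    simp only [zero_mul, add_zero, one_mul]
    rw [gaussGram_mul (a := s⁻¹ + t⁻¹) (by positivity) hs, gaussGram_mul (by positivity) ht]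
    congr 2
    field_simp
    ring
  · rw [inner_gaussLp hd hν 1 0 (inv_pos.2 hs) ht, inner_gaussLp hd hν 1 0 hs (inv_pos.2 ht),
      ← Complex.ofReal_mul, ← Complex.ofReal_mul]
    simp only [zero_mul, add_zero, one_mul]
    rw [gaussGram_mul (by positivity) ht, gaussGram_mul (by positivity) hs]
    congr 2
    field_simp
    ring

open Classical in
/-- The Hankel transform as a unitary involution. -/
def hankelOp (d : ℕ) (ν : ℝ) : L2Radial d →L[ℂ] L2Radial d :=
  if h : 1 ≤ d ∧ 0 ≤ ν then (exists_hankelOp h.1 h.2).choose else 0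

theorem hankelOp_involution (hd : 1 ≤ d) (hν : 0 ≤ ν) : IsUnitaryInvolution (hankelOp d ν) := by
  rw [hankelOp, dif_pos ⟨hd, hν⟩]
  exact (exists_hankelOp hd hν).choose_spec.1

theorem hankelOp_gaussLp (hd : 1 ≤ d) (hν : 0 ≤ ν) {s : ℝ} (hs : 0 < s) :
    hankelOp d ν (gaussLp d ν 1 0 s) = gaussImage d ν 1 0 s := by
  rw [hankelOp, dif_pos ⟨hd, hν⟩]
  exact (exists_hankelOp hd hν).choose_spec.2 ⟨s, hs⟩

/-- The Hankel transform intertwines `1 + L` with multiplication by `1 + ξ²`, where `L` is the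
Bessel operator. -/
theorem hankelOp_bessel (hd : 1 ≤ d) (hν : 0 ≤ ν) {s : ℝ} (hs : 0 < s) :
    hankelOp d ν (gaussLp d ν (1 + 2 * (ν + 1) * s) (-s ^ 2) s) = gaussImage d ν 1 1 s := by
  -- The argument on the left is `(1 + L) g_s`. Pairing with `g_t` and moving the involution onto
  -- `g_t` leaves a rational identity in `s` and `t`.
  refine sub_eq_zero.1 (isTotal_gaussLp hd hν one_pos le_rfl _ fun t => ?_)
  obtain ⟨t, ht⟩ := t
  rw [mem_Ioi] at ht
  rw [inner_sub_right, ← (hankelOp_involution hd hν).inner_left, hankelOp_gaussLp hd hν ht,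
    ← inner_conj_symm, ← inner_conj_symm (gaussLp d ν 1 0 t)]
  simp only [gaussImage, inner_smul_left, inner_smul_right, Complex.conj_ofReal]
  rw [inner_gaussLp hd hν _ _ hs (inv_pos.2 ht), inner_gaussLp hd hν _ _ (inv_pos.2 hs) ht,
    ← map_sub, ← Complex.ofReal_mul, ← Complex.ofReal_mul, ← Complex.ofReal_sub, map_eq_zero,
    Complex.ofReal_eq_zero]
  rw [mul_left_comm, mul_left_comm (s ^ (-(ν + 1))), gaussGram_mul (by positivity) ht,
    gaussGram_mul (by positivity) hs, show t * (s + t⁻¹) = s * (s⁻¹ + t) by field_simp; ring,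
    ← sub_mul]
  have : 1 + 2 * (ν + 1) * s + -s ^ 2 * (2 * (ν + 1) / (s + t⁻¹)) -
      (1 + 1 * (2 * (ν + 1) / (s⁻¹ + t))) = 0 := by
    have : s * t + 1 ≠ 0 := by positivity
    have : 1 + s * t ≠ 0 := by positivity
    field_simp
    ring
  rw [this, zero_mul]

end Gauss

/-! ## Bessel functions and Gaussians -/

section Bessel

variable {d : ℕ} {ν : ℝ}

/-- The terms of the power series of the Bessel function. -/
def besselTerm (ν x : ℝ) (k : ℕ) : ℝ :=
  (-1) ^ k / (k.factorial * Real.Gamma (k + ν + 1)) * (x / 2) ^ (2 * (k : ℝ) + ν)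

theorem besselJ_eq_tsum (ν x : ℝ) : besselJ ν x = ∑' k, besselTerm ν x k := rfl

theorem measurable_besselTerm (ν : ℝ) (k : ℕ) : Measurable fun x => besselTerm ν x k := by
  unfold besselTerm; fun_prop

theorem measurable_besselJ (ν : ℝ) : Measurable (besselJ ν) :=
  Measurable.tsum fun k => measurable_besselTerm ν k

/-- The kernel of the Hankel transform. -/
def hankelKernel (d : ℕ) (ν x : ℝ) : ℝ := x ^ (-(((d : ℝ) - 2) / 2)) * besselJ ν x

theorem measurable_hankelKernel (d : ℕ) (ν : ℝ) : Measurable (hankelKernel d ν) :=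
  Measurable.mul (by fun_prop) (measurable_besselJ ν)

/-- Each term of the Bessel series against a Gaussian is a single radial Gaussian moment. -/
theorem hankelTerm_mul_gauss {s r ξ : ℝ} (hr : 0 < r) (hξ : 0 < ξ) (k : ℕ) :
    (r * ξ) ^ (-(((d : ℝ) - 2) / 2)) * besselTerm ν (r * ξ) k * gaussFun d ν s r =
      ((-1) ^ k / (k.factorial * Real.Gamma (k + ν + 1)) * 2 ^ (-(2 * (k : ℝ) + ν)) *
        ξ ^ (2 * (k : ℝ) + ν - ((d : ℝ) - 2) / 2)) *
      (r ^ (2 * (k : ℝ) + 2 * ν - ((d : ℝ) - 2)) * Real.exp (-(s * r ^ 2 / 2))) := by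
  have h1 : r ^ (2 * (k : ℝ) + 2 * ν - ((d : ℝ) - 2)) =
      r ^ (-(((d : ℝ) - 2) / 2)) * r ^ (2 * (k : ℝ) + ν) * r ^ (ν - ((d : ℝ) - 2) / 2) := by
    rw [← Real.rpow_add hr, ← Real.rpow_add hr]; congr 1; ring
  have h2 : ξ ^ (2 * (k : ℝ) + ν - ((d : ℝ) - 2) / 2) =
      ξ ^ (-(((d : ℝ) - 2) / 2)) * ξ ^ (2 * (k : ℝ) + ν) := by
    rw [← Real.rpow_add hξ]; congr 1; ring
  rw [besselTerm, gaussFun, Real.mul_rpow hr.le hξ.le, Real.div_rpow (by positivity) two_pos.le,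
    Real.mul_rpow hr.le hξ.le, h1, h2, Real.rpow_neg two_pos.le]
  ring

/-- The factor `Γ(k + ν + 1)` of the moment cancels the one in the Bessel series, and an exponential
series in `ξ²/(2s)` remains. The parameter `c` is `(-1)^k` for the integral of a term and `1` for
the integral of its absolute value. -/
theorem hankelTerm_coeff (hν : 0 ≤ ν) {s ξ : ℝ} (hs : 0 < s) (hξ : 0 < ξ) (k : ℕ) (c : ℝ) :
    (c / (k.factorial * Real.Gamma (k + ν + 1)) * 2 ^ (-(2 * (k : ℝ) + ν)) *
        ξ ^ (2 * (k : ℝ) + ν - ((d : ℝ) - 2) / 2)) *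
      ((s / 2) ^ (-((2 * (k : ℝ) + 2 * ν - ((d : ℝ) - 2) + d) / 2)) * (1 / 2) *
        Real.Gamma ((2 * (k : ℝ) + 2 * ν - ((d : ℝ) - 2) + d) / 2)) =
      s ^ (-(ν + 1)) * ξ ^ (ν - ((d : ℝ) - 2) / 2) *
        (c * (ξ ^ 2 / (2 * s)) ^ k / k.factorial) := by
  have h1 : (2 * (k : ℝ) + 2 * ν - ((d : ℝ) - 2) + d) / 2 = k + ν + 1 := by ring
  have hG : Real.Gamma (k + ν + 1) ≠ 0 := (Real.Gamma_pos_of_pos (by positivity)).ne'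
  have h2 : (s / 2) ^ (-((k : ℝ) + ν + 1)) =
      s ^ (-(ν + 1)) * (s ^ k)⁻¹ * 2 ^ ((k : ℝ) + ν + 1) := by
    rw [Real.div_rpow hs.le two_pos.le, Real.rpow_neg two_pos.le, div_inv_eq_mul,
      show -((k : ℝ) + ν + 1) = -(ν + 1) + -(k : ℝ) by ring, Real.rpow_add hs,
      Real.rpow_neg hs.le (k : ℝ), Real.rpow_natCast]
  have h3 : ξ ^ (2 * (k : ℝ) + ν - ((d : ℝ) - 2) / 2) =
      ξ ^ (ν - ((d : ℝ) - 2) / 2) * (ξ ^ 2) ^ k := by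
    rw [← pow_mul, ← Real.rpow_natCast ξ (2 * k), ← Real.rpow_add hξ]; congr 1; push_cast; ring
  have h4 : (2 : ℝ) ^ (-(2 * (k : ℝ) + ν)) * 2 ^ ((k : ℝ) + ν + 1) * (1 / 2) = (2 ^ k)⁻¹ := by
    rw [← Real.rpow_add two_pos, show -(2 * (k : ℝ) + ν) + ((k : ℝ) + ν + 1) = -(k : ℝ) + 1 by ring,
      Real.rpow_add two_pos, Real.rpow_neg two_pos.le, Real.rpow_natCast, Real.rpow_one]
    ring
  rw [h1, h2, h3, div_pow, mul_pow]
  generalize (2 : ℝ) ^ (-(2 * (k : ℝ) + ν)) = A at h4 ⊢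
  generalize (2 : ℝ) ^ ((k : ℝ) + ν + 1) = B at h4 ⊢
  field_simp
  field_simp at h4
  linear_combination c * h4

theorem integrable_hankelTerm (hd : 1 ≤ d) (hν : 0 ≤ ν) {s : ℝ} (hs : 0 < s) (ξ : Ioi (0 : ℝ))
    (k : ℕ) : Integrable (fun r : Ioi (0 : ℝ) => (r * ξ : ℝ) ^ (-(((d : ℝ) - 2) / 2)) *
      besselTerm ν (r * ξ) k * gaussFun d ν s r) (radialMeasure d) := by
  have hq : 0 < 2 * (k : ℝ) + 2 * ν - ((d : ℝ) - 2) + d := by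
    have : (0 : ℝ) ≤ k := Nat.cast_nonneg k
    linarith
  refine Integrable.congr ((integrable_radial_moment hd hq hs).const_mul _)
    (Eventually.of_forall fun r => (hankelTerm_mul_gauss r.2 ξ.2 k).symm)

theorem integral_hankelTerm (hd : 1 ≤ d) (hν : 0 ≤ ν) {s : ℝ} (hs : 0 < s) (ξ : Ioi (0 : ℝ))
    (k : ℕ) : ∫ r : Ioi (0 : ℝ), (r * ξ : ℝ) ^ (-(((d : ℝ) - 2) / 2)) *
      besselTerm ν (r * ξ) k * gaussFun d ν s r ∂(radialMeasure d) =
      s ^ (-(ν + 1)) * (ξ : ℝ) ^ (ν - ((d : ℝ) - 2) / 2) *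
        ((-1) ^ k * ((ξ : ℝ) ^ 2 / (2 * s)) ^ k / k.factorial) := by
  have hq : 0 < 2 * (k : ℝ) + 2 * ν - ((d : ℝ) - 2) + d := by
    have : (0 : ℝ) ≤ k := Nat.cast_nonneg k
    linarith
  rw [integral_congr_ae (Eventually.of_forall fun r => hankelTerm_mul_gauss r.2 ξ.2 k),
    integral_const_mul, integral_radial_moment hd hq hs]
  exact hankelTerm_coeff hν hs ξ.2 k _

theorem integral_norm_hankelTerm (hd : 1 ≤ d) (hν : 0 ≤ ν) {s : ℝ} (hs : 0 < s) (ξ : Ioi (0 : ℝ))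
    (k : ℕ) : ∫ r : Ioi (0 : ℝ), ‖(r * ξ : ℝ) ^ (-(((d : ℝ) - 2) / 2)) *
      besselTerm ν (r * ξ) k * gaussFun d ν s r‖ ∂(radialMeasure d) =
      s ^ (-(ν + 1)) * (ξ : ℝ) ^ (ν - ((d : ℝ) - 2) / 2) *
        (((ξ : ℝ) ^ 2 / (2 * s)) ^ k / k.factorial) := by
  have hq : 0 < 2 * (k : ℝ) + 2 * ν - ((d : ℝ) - 2) + d := by
    have : (0 : ℝ) ≤ k := Nat.cast_nonneg k
    linarith
  have hξ : (0 : ℝ) < ξ := ξ.2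
  have hG : 0 < Real.Gamma (k + ν + 1) := Real.Gamma_pos_of_pos (by positivity)
  have h := hankelTerm_coeff (d := d) hν hs hξ k 1
  rw [one_mul] at h
  rw [← h, ← integral_radial_moment hd hq hs, ← integral_const_mul]
  refine integral_congr_ae (Eventually.of_forall fun r => ?_)
  have hr : (0 : ℝ) < r := r.2
  simp only
  rw [hankelTerm_mul_gauss hr hξ k, norm_mul, norm_mul, norm_mul, norm_div, norm_pow, norm_neg,
    norm_one, one_pow, Real.norm_of_nonneg (by positivity), Real.norm_of_nonneg (by positivity),
    Real.norm_of_nonneg (by positivity), Real.norm_of_nonneg (by positivity)]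

/-- The Hankel transform of a Gaussian, as an absolutely convergent integral. -/
theorem integral_hankelKernel_gauss (hd : 1 ≤ d) (hν : 0 ≤ ν) {s : ℝ} (hs : 0 < s)
    (ξ : Ioi (0 : ℝ)) :
    ∫ r : Ioi (0 : ℝ), hankelKernel d ν (r * ξ) * gaussFun d ν s r ∂(radialMeasure d) =
      s ^ (-(ν + 1)) * gaussFun d ν s⁻¹ ξ := by
  have hsum : HasSum (fun k : ℕ => ((ξ : ℝ) ^ 2 / (2 * s)) ^ k / k.factorial)
      (Real.exp ((ξ : ℝ) ^ 2 / (2 * s))) := by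
    rw [Real.exp_eq_exp_ℝ]
    exact NormedSpace.expSeries_div_hasSum_exp _
  have hsum' : HasSum (fun k : ℕ => (-1) ^ k * ((ξ : ℝ) ^ 2 / (2 * s)) ^ k / k.factorial)
      (Real.exp (-((ξ : ℝ) ^ 2 / (2 * s)))) := by
    rw [Real.exp_eq_exp_ℝ]
    simp_rw [← mul_pow, neg_one_mul]
    exact NormedSpace.expSeries_div_hasSum_exp _
  -- The series of absolute integrals sums to a multiple of `exp(ξ²/(2s))`, which permits the
  -- interchange of sum and integral.
  have h := hasSum_integral_of_summable_integral_norm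
    (fun k => integrable_hankelTerm hd hν hs ξ k) (by
      simp_rw [integral_norm_hankelTerm hd hν hs ξ]
      exact hsum.summable.mul_left _)
  simp_rw [integral_hankelTerm hd hν hs ξ] at h
  have h2 := (hsum'.mul_left (s ^ (-(ν + 1)) * (ξ : ℝ) ^ (ν - ((d : ℝ) - 2) / 2))).unique h
  rw [gaussFun, ← mul_assoc, show s⁻¹ * (ξ : ℝ) ^ 2 / 2 = (ξ : ℝ) ^ 2 / (2 * s) by field_simp, h2]
  refine integral_congr_ae (Eventually.of_forall fun r => ?_)
  simp only [hankelKernel, besselJ_eq_tsum]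
  rw [tsum_mul_right, tsum_mul_left]

/-- Absolute values inside the series turn `exp(-ξ²/(2s))` into `exp(ξ²/(2s))`, hence the parameter
`-s⁻¹`. The growth is harmless against functions supported in `r ≤ R`. -/
theorem lintegral_hankelKernel_gauss_le (hd : 1 ≤ d) (hν : 0 ≤ ν) {s : ℝ} (hs : 0 < s)
    (ξ : Ioi (0 : ℝ)) :
    ∫⁻ r : Ioi (0 : ℝ), ‖hankelKernel d ν (r * ξ) * gaussFun d ν s r‖ₑ ∂(radialMeasure d) ≤
      ENNReal.ofReal (s ^ (-(ν + 1)) * gaussFun d ν (-s⁻¹) ξ) := by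
  have hξ : (0 : ℝ) < ξ := ξ.2
  have hsum : HasSum (fun k : ℕ => ((ξ : ℝ) ^ 2 / (2 * s)) ^ k / k.factorial)
      (Real.exp ((ξ : ℝ) ^ 2 / (2 * s))) := by
    rw [Real.exp_eq_exp_ℝ]
    exact NormedSpace.expSeries_div_hasSum_exp _
  have h2 := hsum.mul_left (s ^ (-(ν + 1)) * (ξ : ℝ) ^ (ν - ((d : ℝ) - 2) / 2))
  calc ∫⁻ r : Ioi (0 : ℝ), ‖hankelKernel d ν (r * ξ) * gaussFun d ν s r‖ₑ ∂(radialMeasure d)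
      ≤ ∫⁻ r : Ioi (0 : ℝ), ∑' k, ‖(r * ξ : ℝ) ^ (-(((d : ℝ) - 2) / 2)) *
      besselTerm ν (r * ξ) k * gaussFun d ν s r‖ₑ ∂(radialMeasure d) := by
        refine lintegral_mono fun r => ?_
        simp only [hankelKernel, besselJ_eq_tsum]
        rw [← tsum_mul_left, ← tsum_mul_right]
        exact enorm_tsum_le_tsum_enorm
    _ = ∑' k, ∫⁻ r : Ioi (0 : ℝ), ‖(r * ξ : ℝ) ^ (-(((d : ℝ) - 2) / 2)) *
      besselTerm ν (r * ξ) k * gaussFun d ν s r‖ₑ ∂(radialMeasure d) :=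
        lintegral_tsum fun k => (integrable_hankelTerm hd hν hs ξ k).aestronglyMeasurable.enorm
    _ = ∑' k, ENNReal.ofReal (s ^ (-(ν + 1)) * (ξ : ℝ) ^ (ν - ((d : ℝ) - 2) / 2) *
        (((ξ : ℝ) ^ 2 / (2 * s)) ^ k / k.factorial)) := by
        congr 1
        ext k
        rw [← integral_norm_hankelTerm hd hν hs ξ,
          ofReal_integral_norm_eq_lintegral_enorm (integrable_hankelTerm hd hν hs ξ k)]
    _ = ENNReal.ofReal (∑' k : ℕ, s ^ (-(ν + 1)) * (ξ : ℝ) ^ (ν - ((d : ℝ) - 2) / 2) *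
        (((ξ : ℝ) ^ 2 / (2 * s)) ^ k / k.factorial)) := by
        rw [ENNReal.ofReal_tsum_of_nonneg _ h2.summable]
        intro k
        positivity
    _ = _ := by
        rw [h2.tsum_eq, gaussFun, ← mul_assoc]
        congr 3
        field_simp

end Bessel

/-! ## The Plancherel theorem for the Hankel transform -/

section Plancherel

variable {d : ℕ} {ν : ℝ}

/-- The restriction of a radial function to `(0, R]`. -/
def cutoff (R : ℝ) (f : L2Radial d) : L2Radial d :=
  mulOp (radialMeasure d) ({r : Ioi (0 : ℝ) | (r : ℝ) ≤ R}.indicator fun _ => (1 : ℂ)) f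

theorem measurableSet_cutoff (R : ℝ) : MeasurableSet {r : Ioi (0 : ℝ) | (r : ℝ) ≤ R} :=
  measurableSet_le measurable_subtype_coe measurable_const

theorem cutoff_ae (R : ℝ) (f : L2Radial d) :
    cutoff R f =ᵐ[radialMeasure d] {r : Ioi (0 : ℝ) | (r : ℝ) ≤ R}.indicator f := by
  filter_upwards [(isBddMeas_indicator (measurableSet_cutoff R)).mulOp_ae f] with r hr
  rw [cutoff, hr]
  by_cases h : r ∈ {r : Ioi (0 : ℝ) | (r : ℝ) ≤ R}
  · rw [indicator_of_mem h, indicator_of_mem h, one_mul]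
  · rw [indicator_of_notMem h, indicator_of_notMem h, zero_mul]

theorem truncatedHankel_eq (ν R : ℝ) (f : L2Radial d) (ξ : Ioi (0 : ℝ)) :
    truncatedHankel ν R f ξ =
      ∫ r, ((hankelKernel d ν (r * ξ) : ℝ) : ℂ) * cutoff R f r ∂(radialMeasure d) := by
  rw [truncatedHankel, ← integral_indicator (measurableSet_cutoff R)]
  refine integral_congr_ae ?_
  filter_upwards [cutoff_ae R f] with r hr
  rw [hr]
  by_cases h : r ∈ {r : Ioi (0 : ℝ) | (r : ℝ) ≤ R}
  · rw [indicator_of_mem h, indicator_of_mem h]; rfl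
  · rw [indicator_of_notMem h, indicator_of_notMem h, mul_zero]

/-- The parameter `s` may be negative: on `r ≤ R` the function `g_s` is bounded by a multiple of
`g_1`, which lies in `L²`. -/
theorem lintegral_gauss_cutoff_lt_top (hd : 1 ≤ d) (hν : 0 ≤ ν) (s R : ℝ) (f : L2Radial d) :
    ∫⁻ r, ENNReal.ofReal (gaussFun d ν s r) * ‖cutoff R f r‖ₑ ∂(radialMeasure d) < ⊤ := by
  have h1 := L2.integrable_inner (𝕜 := ℂ) (gaussLp d ν 1 0 1) f
  have h2 := (h1.norm.const_mul (Real.exp (|1 - s| * R ^ 2 / 2))).lintegral_lt_top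
  refine lt_of_le_of_lt (lintegral_mono_ae ?_) h2
  filter_upwards [cutoff_ae R f, gaussLp_ae hd hν 1 0 one_pos] with r hr hg
  rw [hr]
  by_cases h : r ∈ {r : Ioi (0 : ℝ) | (r : ℝ) ≤ R}
  · have hr0 : (0 : ℝ) < r := r.2
    have hrR : (r : ℝ) ≤ R := h
    rw [indicator_of_mem h, ← ofReal_norm, ← ENNReal.ofReal_mul (gaussFun_pos d ν s hr0).le, hg,
      RCLike.inner_apply, Complex.conj_ofReal, norm_mul, Complex.norm_real, zero_mul, add_zero,
      one_mul, Real.norm_of_nonneg (gaussFun_pos d ν 1 hr0).le]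
    refine ENNReal.ofReal_le_ofReal ?_
    have h3 : gaussFun d ν s r ≤ Real.exp (|1 - s| * R ^ 2 / 2) * gaussFun d ν 1 r := by
      rw [gaussFun, gaussFun, mul_left_comm, ← Real.exp_add]
      gcongr
      have h4 : (1 - s) * (r : ℝ) ^ 2 ≤ |1 - s| * R ^ 2 := by
        have := le_abs_self (1 - s)
        have := abs_nonneg (1 - s)
        gcongr
      linarith
    calc _ ≤ _ := mul_le_mul_of_nonneg_right h3 (norm_nonneg _)
      _ = _ := by ring
  · rw [indicator_of_notMem h]
    simp

/-- This is the integrability needed for Fubini in `truncatedHankel_ae`. Integration over the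
Gaussian variable costs `exp(r²/(2t))`, which the cutoff makes affordable. -/
theorem integrable_hankelKernel_prod (hd : 1 ≤ d) (hν : 0 ≤ ν) {t : ℝ} (ht : 0 < t) (R : ℝ)
    (f : L2Radial d) :
    Integrable (fun p : Ioi (0 : ℝ) × Ioi (0 : ℝ) =>
      ((hankelKernel d ν (p.1 * p.2) * gaussFun d ν t p.1 : ℝ) : ℂ) * cutoff R f p.2)
      ((radialMeasure d).prod (radialMeasure d)) := by
  have hm : Measurable fun p : Ioi (0 : ℝ) × Ioi (0 : ℝ) =>
      ((hankelKernel d ν (p.1 * p.2) * gaussFun d ν t p.1 : ℝ) : ℂ) := by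
    refine Complex.measurable_ofReal.comp (Measurable.mul ?_ ?_)
    · exact (measurable_hankelKernel d ν).comp (by fun_prop)
    · exact (measurable_gaussFun d ν t).comp (by fun_prop)
  have hsm : AEStronglyMeasurable (fun p : Ioi (0 : ℝ) × Ioi (0 : ℝ) =>
      ((hankelKernel d ν (p.1 * p.2) * gaussFun d ν t p.1 : ℝ) : ℂ) * cutoff R f p.2)
      ((radialMeasure d).prod (radialMeasure d)) := hm.aestronglyMeasurable.mul (Lp.aestronglyMeasurable (cutoff R f)).comp_snd
  refine ⟨hsm, ?_⟩
  rw [hasFiniteIntegral_iff_enorm, lintegral_prod_symm _ hsm.enorm]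
  refine lt_of_le_of_lt (lintegral_mono (g := fun r : Ioi (0 : ℝ) => ENNReal.ofReal (t ^ (-(ν + 1))) *
    (ENNReal.ofReal (gaussFun d ν (-t⁻¹) r) * ‖cutoff R f r‖ₑ)) fun r => ?_) ?_
  · simp_rw [enorm_mul]
    rw [lintegral_mul_const' _ _ enorm_ne_top, ← mul_assoc, ← ENNReal.ofReal_mul (by positivity)]
    gcongr
    refine le_trans (le_of_eq ?_) (lintegral_hankelKernel_gauss_le hd hν ht r)
    refine lintegral_congr fun ξ => ?_
    rw [← ofReal_norm, ← ofReal_norm, Complex.norm_real]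
  · rw [lintegral_const_mul' _ _ ENNReal.ofReal_ne_top]
    exact ENNReal.mul_lt_top ENNReal.ofReal_lt_top (lintegral_gauss_cutoff_lt_top hd hν _ R f)

/-- Both sides have the same integral against every `g_t`: on the left by Fubini and the explicit
transform of a Gaussian, on the right because `hankelOp` is self-adjoint. As the left side is not
yet known to be in `L²`, injectivity of the Laplace transform is used in place of totality in `L²`.
-/
theorem truncatedHankel_ae (hd : 1 ≤ d) (hν : 0 ≤ ν) (R : ℝ) (f : L2Radial d) :
    truncatedHankel ν R f =ᵐ[radialMeasure d] hankelOp d ν (cutoff R f) := by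
  set ρ := radialMeasure d
  set fR := cutoff R f with hfR
  set h := truncatedHankel ν R f with hh
  have hH : ∀ t : ℝ, ∀ ξ : Ioi (0 : ℝ), ∫ r, ((hankelKernel d ν (ξ * r) * gaussFun d ν t ξ : ℝ) : ℂ) *
      fR r ∂ρ = h ξ * ((gaussFun d ν t ξ : ℝ) : ℂ) := by
    intro t ξ
    rw [hh, truncatedHankel_eq, ← integral_mul_const]
    refine integral_congr_ae (Eventually.of_forall fun r => ?_)
    simp only
    rw [mul_comm (ξ : ℝ) r]
    push_cast
    ring
  have hhi : ∀ t : ℝ, 0 < t → Integrable (fun ξ => h ξ * ((gaussFun d ν t ξ : ℝ) : ℂ)) ρ := by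
    intro t ht
    refine (integrable_hankelKernel_prod hd hν ht R f).integral_prod_left.congr
      (Eventually.of_forall fun ξ => ?_)
    exact hH t ξ
  have hg : ∀ (t : ℝ), 0 < t → ∀ u : L2Radial d, (fun ξ => inner ℂ (gaussLp d ν 1 0 t ξ) (u ξ))
      =ᵐ[ρ] fun ξ => u ξ * ((gaussFun d ν t ξ : ℝ) : ℂ) := by
    intro t ht u
    filter_upwards [gaussLp_ae hd hν 1 0 ht] with r hr
    rw [hr, RCLike.inner_apply, Complex.conj_ofReal, zero_mul, add_zero, one_mul]
  have hui : ∀ t : ℝ, 0 < t → ∀ u : L2Radial d,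
      Integrable (fun ξ => u ξ * ((gaussFun d ν t ξ : ℝ) : ℂ)) ρ := fun t ht u =>
    (L2.integrable_inner (𝕜 := ℂ) (gaussLp d ν 1 0 t) u).congr (hg t ht u)
  have hhe : ∀ t : ℝ, 0 < t → ∫ ξ, h ξ * ((gaussFun d ν t ξ : ℝ) : ℂ) ∂ρ =
      ∫ ξ, hankelOp d ν fR ξ * ((gaussFun d ν t ξ : ℝ) : ℂ) ∂ρ := by
    intro t ht
    rw [← integral_congr_ae (hg t ht (hankelOp d ν fR)), ← L2.inner_def,
      ← (hankelOp_involution hd hν).inner_left, hankelOp_gaussLp hd hν ht, gaussImage,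
      inner_smul_left, Complex.conj_ofReal, L2.inner_def,
      integral_congr_ae (hg t⁻¹ (inv_pos.2 ht) fR), ← integral_const_mul]
    rw [← integral_congr_ae (Eventually.of_forall (hH t)),
      integral_integral_swap (integrable_hankelKernel_prod hd hν ht R f)]
    refine integral_congr_ae (Eventually.of_forall fun r => ?_)
    simp only
    rw [integral_mul_const, integral_complex_ofReal, integral_hankelKernel_gauss hd hν ht r]
    push_cast
    ring
  have key : (fun ξ : Ioi (0 : ℝ) => (h ξ - hankelOp d ν fR ξ) *
      (((ξ : ℝ) ^ (ν - ((d : ℝ) - 2) / 2) : ℝ) : ℂ)) =ᵐ[ρ] 0 := by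
    have e : ∀ t : ℝ, (fun ξ : Ioi (0 : ℝ) => (h ξ - hankelOp d ν fR ξ) *
      (((ξ : ℝ) ^ (ν - ((d : ℝ) - 2) / 2) : ℝ) : ℂ) *
        (Real.exp (-(t * (ξ : ℝ) ^ 2 / 2)) : ℂ)) = fun ξ : Ioi (0 : ℝ) =>
        h ξ * ((gaussFun d ν t ξ : ℝ) : ℂ) - hankelOp d ν fR ξ * ((gaussFun d ν t ξ : ℝ) : ℂ) := by
      intro t
      ext ξ
      rw [gaussFun]
      push_cast
      ring
    refine ae_eq_zero_of_laplace (fun t ht => ?_) fun t ht => ?_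
    · rw [e t]
      exact (hhi t ht).sub (hui t ht _)
    · rw [e t, integral_sub (hhi t ht) (hui t ht _), hhe t ht, sub_self]
  filter_upwards [key] with ξ hξ
  have h0 : (((ξ : ℝ) ^ (ν - ((d : ℝ) - 2) / 2) : ℝ) : ℂ) ≠ 0 := by
    have : (0 : ℝ) < ξ := ξ.2
    have : (0 : ℝ) < (ξ : ℝ) ^ (ν - ((d : ℝ) - 2) / 2) := by positivity
    exact_mod_cast this.ne'
  exact sub_eq_zero.1 ((mul_eq_zero.1 hξ).resolve_right h0)

theorem tendsto_cutoff (f : L2Radial d) : Tendsto (fun R => cutoff R f) atTop (𝓝 f) := by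
  rw [tendsto_iff_norm_sub_tendsto_zero]
  have h1 : ∀ R, ENNReal.ofReal (‖cutoff R f - f‖ ^ 2) =
      ∫⁻ r, ‖{r : Ioi (0 : ℝ) | (r : ℝ) ≤ R}.indicator f r - f r‖ₑ ^ 2 ∂(radialMeasure d) := by
    intro R
    rw [ofReal_norm_sq_eq_lintegral]
    refine lintegral_congr_ae ?_
    filter_upwards [cutoff_ae R f, Lp.coeFn_sub (cutoff R f) f] with r h2 h3
    rw [h3, Pi.sub_apply, h2]
  have h2 : Tendsto (fun R => ENNReal.ofReal (‖cutoff R f - f‖ ^ 2)) atTop (𝓝 0) := by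
    simp_rw [h1]
    have := tendsto_lintegral_filter_of_dominated_convergence (μ := radialMeasure d) (l := atTop)
      (F := fun (R : ℝ) r => ‖{r : Ioi (0 : ℝ) | (r : ℝ) ≤ R}.indicator f r - f r‖ₑ ^ 2)
      (f := fun _ => 0) (fun r => ‖f r‖ₑ ^ 2)
      (Eventually.of_forall fun R => ?_)
      (Eventually.of_forall fun R => Eventually.of_forall fun r => ?_) ?_
      (Eventually.of_forall fun r => ?_)
    · simpa using this
    · exact ((((Lp.stronglyMeasurable f).indicator (measurableSet_cutoff R)).sub
        (Lp.stronglyMeasurable f)).enorm).pow_const 2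
    · by_cases h : r ∈ {r : Ioi (0 : ℝ) | (r : ℝ) ≤ R}
      · rw [indicator_of_mem h]; simp
      · rw [indicator_of_notMem h]; simp
    · rw [← ofReal_norm_sq_eq_lintegral]
      exact ENNReal.ofReal_ne_top
    · refine tendsto_const_nhds.congr' ?_
      filter_upwards [eventually_ge_atTop (r : ℝ)] with R hR
      rw [indicator_of_mem (show r ∈ {r : Ioi (0 : ℝ) | (r : ℝ) ≤ R} from hR)]
      simp
  have h3 := (ENNReal.tendsto_toReal ENNReal.zero_ne_top).comp h2
  simp only [Function.comp_def, ENNReal.toReal_zero] at h3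
  have h4 := h3.sqrt
  rw [Real.sqrt_zero] at h4
  refine h4.congr fun R => ?_
  rw [ENNReal.toReal_ofReal (by positivity), Real.sqrt_sq (norm_nonneg _)]

theorem isHankel_hankelOp (hd : 1 ≤ d) (hν : 0 ≤ ν) (f : L2Radial d) :
    IsHankel ν f (hankelOp d ν f) := by
  have h1 : ∀ R, eLpNorm (fun ξ => truncatedHankel ν R f ξ - hankelOp d ν f ξ) 2
      (radialMeasure d) = ENNReal.ofReal ‖hankelOp d ν (cutoff R f) - hankelOp d ν f‖ := by
    intro R
    rw [Lp.norm_def, ENNReal.ofReal_toReal (Lp.eLpNorm_ne_top _)]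
    refine eLpNorm_congr_ae ?_
    filter_upwards [truncatedHankel_ae hd hν R f,
      Lp.coeFn_sub (hankelOp d ν (cutoff R f)) (hankelOp d ν f)] with ξ h2 h3
    rw [h2, h3, Pi.sub_apply]
  unfold IsHankel
  simp_rw [h1]
  have h2 := tendsto_iff_norm_sub_tendsto_zero.1
    (((hankelOp d ν).continuous.tendsto f).comp (tendsto_cutoff f))
  have h3 := (ENNReal.continuous_ofReal.tendsto 0).comp h2
  rwa [ENNReal.ofReal_zero] at h3

theorem IsHankel.unique (hd : 1 ≤ d) (hν : 0 ≤ ν) {f g g' : L2Radial d} (h : IsHankel ν f g)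
    (h' : IsHankel ν f g') : g = g' := by
  have hm : ∀ R, AEStronglyMeasurable (truncatedHankel ν R f) (radialMeasure d) := fun R =>
    (Lp.aestronglyMeasurable _).congr (truncatedHankel_ae hd hν R f).symm
  have h1 : eLpNorm (⇑g - ⇑g') 2 (radialMeasure d) ≤ 0 := by
    have h2 := h.add h'
    rw [add_zero] at h2
    refine ge_of_tendsto h2 (Eventually.of_forall fun R => ?_)
    have e : (⇑g - ⇑g') = (fun ξ => truncatedHankel ν R f ξ - g' ξ) -
        fun ξ => truncatedHankel ν R f ξ - g ξ := by
      ext ξ; simp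
    rw [e, add_comm]
    exact eLpNorm_sub_le ((hm R).sub (Lp.aestronglyMeasurable _))
      ((hm R).sub (Lp.aestronglyMeasurable _)) (by norm_num)
  rw [nonpos_iff_eq_zero, eLpNorm_eq_zero_iff ((Lp.aestronglyMeasurable _).sub
    (Lp.aestronglyMeasurable _)) (by norm_num)] at h1
  refine Lp.ext ?_
  filter_upwards [h1] with ξ hξ
  exact sub_eq_zero.1 hξ

theorem hankel_eq (hd : 1 ≤ d) (hν : 0 ≤ ν) (f : L2Radial d) : hankel ν f = hankelOp d ν f := by
  have h : ∃ g, IsHankel ν f g := ⟨_, isHankel_hankelOp hd hν f⟩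
  rw [hankel, dif_pos h]
  exact h.choose_spec.unique hd hν (isHankel_hankelOp hd hν f)

end Plancherel

/-! ## Polar coordinates -/

section Polar

variable {d : ℕ}

/-- The map `(θ, r) ↦ r θ`. -/
def polarMap (p : Sph d × Ioi (0 : ℝ)) : Space d := (p.2 : ℝ) • (p.1 : Space d)

theorem norm_polarMap (p : Sph d × Ioi (0 : ℝ)) : ‖polarMap p‖ = p.2 := by
  rw [polarMap, norm_smul, norm_eq_of_mem_sphere, mul_one, Real.norm_of_nonneg p.2.2.le]

theorem polarMap_ne_zero (p : Sph d × Ioi (0 : ℝ)) : polarMap p ≠ 0 := by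
  rw [← norm_ne_zero_iff, norm_polarMap]
  exact p.2.2.ne'

theorem coe_polar_symm (p : Sph d × Ioi (0 : ℝ)) :
    (((polar d).symm p : ({0}ᶜ : Set (Space d))) : Space d) = polarMap p := by
  simp [polarMap]

theorem ofPolar_polarMap {β : Type*} [Zero β] (G : Sph d × Ioi (0 : ℝ) → β)
    (p : Sph d × Ioi (0 : ℝ)) : ofPolar G (polarMap p) = G p := by
  have hp : polarMap p ∈ ({0}ᶜ : Set (Space d)) := polarMap_ne_zero p
  rw [ofPolar, dif_pos hp]
  congr 1
  have h : (⟨polarMap p, hp⟩ : ({0}ᶜ : Set (Space d))) = (polar d).symm p :=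
    Subtype.ext (coe_polar_symm p).symm
  rw [h, Homeomorph.apply_symm_apply]

theorem homExt_polarMap {β : Type*} [Zero β] (f : Sph d → β) (p : Sph d × Ioi (0 : ℝ)) :
    homExt f (polarMap p) = f p.1 := ofPolar_polarMap _ p

theorem measurableEmbedding_polarMap : MeasurableEmbedding (polarMap (d := d)) := by
  have h : polarMap (d := d) = Subtype.val ∘ (polar d).symm := by
    funext p
    exact (coe_polar_symm p).symm
  rw [h]
  exact (MeasurableEmbedding.subtype_coe (measurableSet_singleton _).compl).comp
    (polar d).symm.measurableEmbedding

theorem measurePreserving_polarMap (hd : 1 ≤ d) :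
    MeasurePreserving (polarMap (d := d)) ((surfaceMeasure d).prod (radialMeasure d)) volume := by
  -- In positive dimension the origin is a null set, so nothing is lost by removing it.
  have : Nonempty (Fin d) := ⟨⟨0, hd⟩⟩
  have h1 := (measurePreserving_polar d).symm (polar d).toMeasurableEquiv
  refine ⟨measurableEmbedding_polarMap.measurable, ?_⟩
  have h : polarMap (d := d) = Subtype.val ∘ (polar d).symm := by
    funext p
    exact (coe_polar_symm p).symm
  rw [h, ← Measure.map_map measurable_subtype_coe (polar d).symm.measurable]
  have h2 : Measure.map (polar d).symm ((surfaceMeasure d).prod (radialMeasure d)) =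
    (volume : Measure (Space d)).comap (↑) := h1.map_eq
  rw [h2, map_comap_subtype_coe (measurableSet_singleton _).compl, restrict_compl_singleton]

theorem ae_polarMap (hd : 1 ≤ d) {P : Space d → Prop} (h : ∀ᵐ x, P x) :
    ∀ᵐ p ∂((surfaceMeasure d).prod (radialMeasure d)), P (polarMap p) :=
  (measurePreserving_polarMap hd).quasiMeasurePreserving.ae h

theorem ae_of_ae_polarMap (hd : 1 ≤ d) {P : Space d → Prop}
    (h : ∀ᵐ p ∂((surfaceMeasure d).prod (radialMeasure d)), P (polarMap p)) : ∀ᵐ x, P x := by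
  rw [← (measurePreserving_polarMap hd).map_eq, measurableEmbedding_polarMap.ae_map_iff]
  exact h

theorem integral_polarMap (hd : 1 ≤ d) {E : Type*} [NormedAddCommGroup E] [NormedSpace ℝ E]
    (f : Space d → E) :
    ∫ p, f (polarMap p) ∂((surfaceMeasure d).prod (radialMeasure d)) = ∫ x, f x :=
  (measurePreserving_polarMap hd).integral_comp measurableEmbedding_polarMap f

theorem integrable_polarMap (hd : 1 ≤ d) {E : Type*} [NormedAddCommGroup E]
    {f : Space d → E} :
    Integrable (fun p => f (polarMap p)) ((surfaceMeasure d).prod (radialMeasure d)) ↔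
      Integrable f :=
  (measurePreserving_polarMap hd).integrable_comp_emb measurableEmbedding_polarMap

theorem ae_ae_swap {P : Sph d × Ioi (0 : ℝ) → Prop}
    (h : ∀ᵐ p ∂((surfaceMeasure d).prod (radialMeasure d)), P p) :
    ∀ᵐ r ∂(radialMeasure d), ∀ᵐ θ ∂(surfaceMeasure d), P (θ, r) :=
  Measure.ae_ae_of_ae_prod (Measure.measurePreserving_swap.quasiMeasurePreserving.ae h)

theorem separated_ae (hd : 1 ≤ d) (g : L2Radial d) (ψ : L2Sphere d) :
    ∀ᵐ p ∂((surfaceMeasure d).prod (radialMeasure d)),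
      separated g ψ (polarMap p) = g p.2 * ψ p.1 := by
  filter_upwards [ae_polarMap hd (memLp_ofPolar g ψ).coeFn_toLp] with p hp
  rw [separated, hp, ofPolar_polarMap]

theorem coeff_ae (ψ : L2Sphere d) (f : L2Space d) :
    coeff ψ f =ᵐ[radialMeasure d] fun r =>
      ∫ θ : Sph d, f (polarMap (θ, r)) * conj (ψ θ) ∂(surfaceMeasure d) :=
  (memLp_coeff ψ f).coeFn_toLp

theorem inner_L2_eq {Ω : Type*} [MeasurableSpace Ω] {μ : Measure Ω} (f g : Lp ℂ 2 μ) :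
    inner ℂ f g = ∫ x, g x * conj (f x) ∂μ := by
  rw [L2.inner_def]
  rfl

theorem integrable_inner_L2 {Ω : Type*} [MeasurableSpace Ω] {μ : Measure Ω} (f g : Lp ℂ 2 μ) :
    Integrable (fun x => g x * conj (f x)) μ := L2.integrable_inner f g

/-- Fubini: `coeff ψ` is the adjoint of `g ↦ separated g ψ`. The linearity of both in their `L²`
arguments is deduced from this duality. -/
theorem inner_separated (hd : 1 ≤ d) (g : L2Radial d) (ψ : L2Sphere d) (f : L2Space d) :
    inner ℂ (separated g ψ) f = inner ℂ g (coeff ψ f) := by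
  have hi := (integrable_polarMap hd).2 (integrable_inner_L2 (separated g ψ) f)
  rw [inner_L2_eq, inner_L2_eq, ← integral_polarMap hd]
  rw [integral_prod_symm _ hi]
  refine integral_congr_ae ?_
  have h2 := ae_ae_swap (separated_ae hd g ψ)
  filter_upwards [coeff_ae ψ f, h2] with r hr hr2
  rw [hr, ← integral_mul_const]
  refine integral_congr_ae ?_
  filter_upwards [hr2] with θ hθ
  rw [hθ, map_mul]
  ring

theorem separated_add (hd : 1 ≤ d) (g g' : L2Radial d) (ψ : L2Sphere d) :
    separated (g + g') ψ = separated g ψ + separated g' ψ :=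
  ext_inner_right ℂ fun f => by
    simp only [inner_separated hd, inner_add_left]

theorem separated_smul (hd : 1 ≤ d) (c : ℂ) (g : L2Radial d) (ψ : L2Sphere d) :
    separated (c • g) ψ = c • separated g ψ :=
  ext_inner_right ℂ fun f => by
    simp only [inner_separated hd, inner_smul_left]

theorem coeff_add (hd : 1 ≤ d) (ψ : L2Sphere d) (f f' : L2Space d) :
    coeff ψ (f + f') = coeff ψ f + coeff ψ f' :=
  ext_inner_left ℂ fun g => by
    simp only [← inner_separated hd, inner_add_right]

theorem coeff_smul (hd : 1 ≤ d) (c : ℂ) (ψ : L2Sphere d) (f : L2Space d) :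
    coeff ψ (c • f) = c • coeff ψ f :=
  ext_inner_left ℂ fun g => by
    simp only [← inner_separated hd, inner_smul_right]

theorem coeff_separated (hd : 1 ≤ d) (g : L2Radial d) (ψ φ : L2Sphere d) :
    coeff ψ (separated g φ) = inner ℂ ψ φ • g := by
  refine Lp.ext ?_
  filter_upwards [coeff_ae ψ (separated g φ), ae_ae_swap (separated_ae hd g φ),
    Lp.coeFn_smul (inner ℂ ψ φ) g] with r h1 h2 h3
  rw [h1, h3, Pi.smul_apply, inner_L2_eq, smul_eq_mul, mul_comm, ← integral_const_mul]
  refine integral_congr_ae ?_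
  filter_upwards [h2] with θ hθ
  rw [hθ, mul_assoc]

theorem inner_separated_separated (hd : 1 ≤ d) (g g' : L2Radial d) (ψ ψ' : L2Sphere d) :
    inner ℂ (separated g ψ) (separated g' ψ') = inner ℂ ψ ψ' * inner ℂ g g' := by
  rw [inner_separated hd, coeff_separated hd, inner_smul_right]

theorem norm_separated (hd : 1 ≤ d) (g : L2Radial d) (ψ : L2Sphere d) :
    ‖separated g ψ‖ = ‖g‖ * ‖ψ‖ := by
  have h := inner_separated_separated hd g g ψ ψ
  rw [inner_self_ofReal, inner_self_ofReal, inner_self_ofReal, ← Complex.ofReal_mul,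
    Complex.ofReal_inj] at h
  rw [← abs_of_nonneg (norm_nonneg (separated g ψ)), ← abs_of_nonneg
    (mul_nonneg (norm_nonneg g) (norm_nonneg ψ)), ← sq_eq_sq_iff_abs_eq_abs, h]
  ring

theorem separated_add_right (hd : 1 ≤ d) (g : L2Radial d) (ψ ψ' : L2Sphere d) :
    separated g (ψ + ψ') = separated g ψ + separated g ψ' := by
  refine Lp.ext (ae_of_ae_polarMap hd ?_)
  filter_upwards [separated_ae hd g (ψ + ψ'), separated_ae hd g ψ, separated_ae hd g ψ',
    ae_polarMap hd (Lp.coeFn_add (separated g ψ) (separated g ψ')),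
    Measure.quasiMeasurePreserving_fst.ae (Lp.coeFn_add ψ ψ')] with p h1 h2 h3 h4 h5
  rw [h1, h4, Pi.add_apply, h2, h3, h5, Pi.add_apply, mul_add]

theorem separated_smul_right (hd : 1 ≤ d) (c : ℂ) (g : L2Radial d) (ψ : L2Sphere d) :
    separated g (c • ψ) = c • separated g ψ := by
  refine Lp.ext (ae_of_ae_polarMap hd ?_)
  filter_upwards [separated_ae hd g (c • ψ), separated_ae hd g ψ,
    ae_polarMap hd (Lp.coeFn_smul c (separated g ψ)),
    Measure.quasiMeasurePreserving_fst.ae (Lp.coeFn_smul c ψ)] with p h1 h2 h4 h5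
  rw [h1, h4, Pi.smul_apply, h2, h5, Pi.smul_apply, smul_eq_mul, smul_eq_mul]
  ring

/-- The map `ψ ↦ separated g ψ` as a continuous linear map. -/
def separatedRight (hd : 1 ≤ d) (g : L2Radial d) : L2Sphere d →L[ℂ] L2Space d :=
  LinearMap.mkContinuous ⟨⟨separated g, separated_add_right hd g⟩,
    fun c ψ => separated_smul_right hd c g ψ⟩ ‖g‖ fun ψ => (norm_separated hd g ψ).le

/-- The map `g ↦ separated g ψ` as a continuous linear map. -/
def separatedLeft (hd : 1 ≤ d) (ψ : L2Sphere d) : L2Radial d →L[ℂ] L2Space d :=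
  LinearMap.mkContinuous ⟨⟨fun g => separated g ψ, fun g g' => separated_add hd g g' ψ⟩,
    fun c g => separated_smul hd c g ψ⟩ ‖ψ‖
    fun g => ((norm_separated hd g ψ).trans (mul_comm _ _)).le

theorem separatedLeft_apply (hd : 1 ≤ d) (ψ : L2Sphere d) (g : L2Radial d) :
    separatedLeft hd ψ g = separated g ψ := rfl

theorem memLp_slice (hd : 1 ≤ d) (f : L2Space d) :
    ∀ᵐ r ∂(radialMeasure d),
      MemLp (fun θ : Sph d => f (polarMap (θ, r))) 2 (surfaceMeasure d) := by
  have h1 : MemLp (fun p => f (polarMap p)) 2 ((surfaceMeasure d).prod (radialMeasure d)) :=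
    (Lp.memLp f).comp_measurePreserving (measurePreserving_polarMap hd)
  have h2 : ∫⁻ r, ∫⁻ θ, ‖f (polarMap (θ, r))‖ₑ ^ 2 ∂(surfaceMeasure d) ∂(radialMeasure d) < ⊤ := by
    have := (memLp_two_iff_lintegral h1.aestronglyMeasurable).1 h1
    rwa [lintegral_prod_symm _ (h1.aestronglyMeasurable.enorm.pow_const _)] at this
  have h3 : AEMeasurable (fun r => ∫⁻ θ, ‖f (polarMap (θ, r))‖ₑ ^ 2 ∂(surfaceMeasure d))
      (radialMeasure d) :=
    (h1.aestronglyMeasurable.prod_swap.enorm.pow_const 2).lintegral_prod_right'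
  filter_upwards [ae_lt_top' h3 h2.ne, h1.aestronglyMeasurable.prod_swap.prodMk_left] with r hr hm
  exact (memLp_two_iff_lintegral hm).2 hr

/-- A function all of whose coefficients with respect to an orthonormal basis vanish is zero. -/
theorem eq_zero_of_coeff {ι : Type*} [Countable ι] (hd : 1 ≤ d)
    (e : HilbertBasis ι ℂ (L2Sphere d)) {f : L2Space d} (h : ∀ α, coeff (e α) f = 0) : f = 0 := by
  have h1 : ∀ᵐ r ∂(radialMeasure d), ∀ α,
      ∫ θ : Sph d, f (polarMap (θ, r)) * conj (e α θ) ∂(surfaceMeasure d) = 0 := by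
    rw [ae_all_iff]
    intro α
    have h2 : coeff (e α) f =ᵐ[radialMeasure d] 0 := by
      rw [h α]
      exact Lp.coeFn_zero ..
    filter_upwards [coeff_ae (e α) f, h2] with r h3 h4
    rw [← h3, h4, Pi.zero_apply]
  have h2 : ∀ᵐ r ∂(radialMeasure d), ∀ᵐ θ ∂(surfaceMeasure d), f (polarMap (θ, r)) = 0 := by
    filter_upwards [h1, memLp_slice hd f] with r hr hm
    have h3 : hm.toLp _ = 0 := by
      refine e.repr.injective (lp.ext (funext fun α => ?_))
      rw [e.repr_apply_apply, map_zero, inner_L2_eq, lp.coeFn_zero, Pi.zero_apply, ← hr α]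
      refine integral_congr_ae ?_
      filter_upwards [hm.coeFn_toLp] with θ hθ
      rw [hθ]
    filter_upwards [(Lp.eq_zero_iff_ae_eq_zero).1 h3, hm.coeFn_toLp] with θ h4 h5
    rw [← h5, h4, Pi.zero_apply]
  refine (Lp.eq_zero_iff_ae_eq_zero).2 (ae_of_ae_polarMap hd ?_)
  have hm : AEStronglyMeasurable (fun p => f (polarMap p))
      ((surfaceMeasure d).prod (radialMeasure d)) :=
    ((Lp.memLp f).comp_measurePreserving (measurePreserving_polarMap hd)).aestronglyMeasurable
  -- The exceptional null set on the sphere depends on `r`; Tonelli for `‖f‖` converts vanishing on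
  -- almost every slice into vanishing almost everywhere on the product.
  have h3 : ∀ᵐ p ∂((radialMeasure d).prod (surfaceMeasure d)), f (polarMap p.swap) = 0 := by
    have h4 := hm.prod_swap
    have h5 : ∫⁻ p, ‖f (polarMap p.swap)‖ₑ ∂((radialMeasure d).prod (surfaceMeasure d)) = 0 := by
      rw [lintegral_prod _ h4.enorm]
      rw [lintegral_eq_zero_iff' h4.enorm.lintegral_prod_right']
      filter_upwards [h2] with r hr
      simp only [Prod.swap, Pi.zero_apply]
      rw [lintegral_congr_ae (g := 0), lintegral_zero_fun]
      filter_upwards [hr] with θ hθ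
      simp [hθ]
    filter_upwards [(lintegral_eq_zero_iff' h4.enorm).1 h5] with p hp
    simpa using hp
  exact Measure.measurePreserving_swap.quasiMeasurePreserving.ae h3

end Polar

set_option linter.unusedSectionVars false

/-! ## Operators which are diagonal with respect to separation of variables -/

section Transport

variable {d : ℕ} {ι : Type*} [Countable ι]

theorem eq_of_coeff_eq (hd : 1 ≤ d) (e : HilbertBasis ι ℂ (L2Sphere d)) {f g : L2Space d}
    (h : ∀ α, coeff (e α) f = coeff (e α) g) : f = g := by
  refine sub_eq_zero.1 (eq_zero_of_coeff hd e fun α => ?_)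
  rw [sub_eq_add_neg, coeff_add hd, ← neg_one_smul ℂ g, coeff_smul hd, h α]
  simp

/-- The isometric embedding `g ↦ separated g (e α)`. -/
def separatedIsometry (hd : 1 ≤ d) (e : HilbertBasis ι ℂ (L2Sphere d)) (α : ι) :
    L2Radial d →ₗᵢ[ℂ] L2Space d :=
  ⟨(separatedLeft hd (e α) : L2Radial d →ₗ[ℂ] L2Space d), fun g => by
    simp [separatedLeft_apply, norm_separated hd, e.orthonormal.1 α]⟩

theorem separatedIsometry_apply (hd : 1 ≤ d) (e : HilbertBasis ι ℂ (L2Sphere d)) (α : ι)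
    (g : L2Radial d) : separatedIsometry hd e α g = separated g (e α) := rfl

theorem orthogonalFamily_separated (hd : 1 ≤ d) (e : HilbertBasis ι ℂ (L2Sphere d)) :
    OrthogonalFamily ℂ (fun _ : ι => L2Radial d) (separatedIsometry hd e) := by
  intro α β hαβ g g'
  rw [separatedIsometry_apply, separatedIsometry_apply, inner_separated_separated hd,
    e.orthonormal.2 hαβ, zero_mul]

/-- A function orthogonal to all summands has vanishing coefficients, so it is zero by
`eq_zero_of_coeff`. -/
theorem isHilbertSum_separated (hd : 1 ≤ d) (e : HilbertBasis ι ℂ (L2Sphere d)) :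
    IsHilbertSum ℂ (fun _ : ι => L2Radial d) (separatedIsometry hd e) := by
  refine IsHilbertSum.mk (orthogonalFamily_separated hd e) ?_
  rw [top_le_iff, Submodule.topologicalClosure_eq_top_iff]
  rw [Submodule.eq_bot_iff]
  intro f hf
  refine eq_zero_of_coeff hd e fun α => ext_inner_left ℂ fun g => ?_
  rw [← inner_separated hd, inner_zero_right]
  refine hf _ (Submodule.mem_iSup_of_mem α ⟨g, rfl⟩)

theorem hilbertSum_apply (hd : 1 ≤ d) (e : HilbertBasis ι ℂ (L2Sphere d)) (f : L2Space d)
    (α : ι) : (isHilbertSum_separated hd e).linearIsometryEquiv f α = coeff (e α) f := by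
  classical
  refine ext_inner_left ℂ fun g => ?_
  have h := lp.inner_single_left (𝕜 := ℂ) (G := fun _ : ι => L2Radial d) α g
    ((isHilbertSum_separated hd e).linearIsometryEquiv f)
  rw [← h, ← inner_separated hd,
    ← (isHilbertSum_separated hd e).linearIsometryEquiv.symm.inner_map_map,
    LinearIsometryEquiv.symm_apply_apply,
    (isHilbertSum_separated hd e).linearIsometryEquiv_symm_apply_single]
  rfl

theorem hasSum_norm_sq_coeff (hd : 1 ≤ d) (e : HilbertBasis ι ℂ (L2Sphere d)) (f : L2Space d) :
    HasSum (fun α => ‖coeff (e α) f‖ ^ 2) (‖f‖ ^ 2) := by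
  have h := lp.hasSum_norm (p := 2) (by simp)
    ((isHilbertSum_separated hd e).linearIsometryEquiv f)
  simpa [hilbertSum_apply, LinearIsometryEquiv.norm_map] using h

theorem coeff_of_hasSum (hd : 1 ≤ d) (e : HilbertBasis ι ℂ (L2Sphere d)) {g : ι → L2Radial d}
    {f : L2Space d} (h : HasSum (fun α => separated (g α) (e α)) f) (α : ι) :
    coeff (e α) f = g α := by
  classical
  refine ext_inner_left ℂ fun k => ?_
  have h1 := h.mapL (innerSL ℂ (separated k (e α)))
  simp only [innerSL_apply_apply, inner_separated_separated hd] at h1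
  rw [← inner_separated hd]
  refine h1.unique ?_
  have h2 := hasSum_ite_eq α (inner ℂ k (g α))
  refine h2.congr_fun ?_ 
  intro β
  simp only [orthonormal_iff_ite.1 e.orthonormal]
  by_cases hβ : β = α
  · simp [hβ]
  · simp [hβ, Ne.symm hβ]

/-- By Parseval along `e`, contractions keep the coefficients square summable, so the series
converges in the orthogonal sum along `φ`. Linearity and the norm bound are then checked on
coefficients. -/
theorem exists_transport (hd : 1 ≤ d) (e φ : HilbertBasis ι ℂ (L2Sphere d))
    (T : ι → L2Radial d →L[ℂ] L2Radial d) (hT : ∀ α g, ‖T α g‖ ≤ ‖g‖) :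
    ∃ D : L2Space d →L[ℂ] L2Space d,
      ∀ f, HasSum (fun α => separated (T α (coeff (e α) f)) (φ α)) (D f) := by
  have hs : ∀ f, ∃ g, HasSum (fun α => separated (T α (coeff (e α) f)) (φ α)) g := by
    intro f
    refine ((orthogonalFamily_separated hd φ).summable_iff_norm_sq_summable _).2 ?_
    refine Summable.of_nonneg_of_le (fun α => sq_nonneg _) (fun α => ?_)
      (hasSum_norm_sq_coeff hd e f).summable
    gcongr
    exact hT α _
  choose D hD using hs
  have hc : ∀ f α, coeff (φ α) (D f) = T α (coeff (e α) f) := fun f =>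
    coeff_of_hasSum hd φ (hD f)
  have hadd : ∀ f g, D (f + g) = D f + D g := fun f g => by
    refine eq_of_coeff_eq hd φ fun α => ?_
    rw [coeff_add hd, hc, hc, hc, coeff_add hd, map_add]
  have hsmul : ∀ (c : ℂ) f, D (c • f) = c • D f := fun c f => by
    refine eq_of_coeff_eq hd φ fun α => ?_
    rw [coeff_smul hd, hc, hc, coeff_smul hd, map_smul]
  let L : L2Space d →ₗ[ℂ] L2Space d := { toFun := D, map_add' := hadd, map_smul' := hsmul }
  have hL : ∀ f, ‖L f‖ ≤ 1 * ‖f‖ := fun f => by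
    rw [one_mul]
    refine (pow_le_pow_iff_left₀ (norm_nonneg _) (norm_nonneg _) two_ne_zero).1 ?_
    refine hasSum_le (fun α => ?_) (hasSum_norm_sq_coeff hd φ (D f))
      (hasSum_norm_sq_coeff hd e f)
    rw [hc]
    gcongr
    exact hT α _
  exact ⟨L.mkContinuous 1 hL, hD⟩

open Classical in
/-- The operator which maps `∑ α, f_α e_α` to `∑ α, (T α f_α) φ_α`, for contractions `T α`. -/
def transport (e φ : HilbertBasis ι ℂ (L2Sphere d)) (T : ι → L2Radial d →L[ℂ] L2Radial d) :
    L2Space d →L[ℂ] L2Space d :=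
  if h : ∃ D : L2Space d →L[ℂ] L2Space d,
    ∀ f, HasSum (fun α => separated (T α (coeff (e α) f)) (φ α)) (D f) then h.choose else 0

variable {e φ χ : HilbertBasis ι ℂ (L2Sphere d)} {S T : ι → L2Radial d →L[ℂ] L2Radial d}

theorem hasSum_transport (hd : 1 ≤ d) (hT : ∀ α g, ‖T α g‖ ≤ ‖g‖) (f : L2Space d) :
    HasSum (fun α => separated (T α (coeff (e α) f)) (φ α)) (transport e φ T f) := by
  rw [transport, dif_pos (exists_transport hd e φ T hT)]
  exact (exists_transport hd e φ T hT).choose_spec f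

theorem coeff_transport (hd : 1 ≤ d) (hT : ∀ α g, ‖T α g‖ ≤ ‖g‖) (f : L2Space d) (α : ι) :
    coeff (φ α) (transport e φ T f) = T α (coeff (e α) f) :=
  coeff_of_hasSum hd φ (hasSum_transport hd hT f) α

theorem transport_mul (hd : 1 ≤ d) (hT : ∀ α g, ‖T α g‖ ≤ ‖g‖) (hS : ∀ α g, ‖S α g‖ ≤ ‖g‖) :
    transport φ χ S * transport e φ T = transport e χ fun α => S α * T α := by
  have hST : ∀ α g, ‖(S α * T α) g‖ ≤ ‖g‖ := fun α g => (hS α _).trans (hT α g)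
  refine ContinuousLinearMap.ext fun f => eq_of_coeff_eq hd χ fun α => ?_
  rw [mul_apply_eq_comp, coeff_transport hd hS, coeff_transport hd hT, coeff_transport hd hST]
  rfl

theorem norm_one_apply_le (_ : ι) (g : L2Radial d) :
    ‖(1 : L2Radial d →L[ℂ] L2Radial d) g‖ ≤ ‖g‖ := le_rfl

theorem transport_one (hd : 1 ≤ d) : transport e e (fun _ => 1) = 1 := by
  refine ContinuousLinearMap.ext fun f => eq_of_coeff_eq hd e fun α => ?_
  rw [coeff_transport hd norm_one_apply_le]
  rfl

theorem inner_transport (hd : 1 ≤ d) (hT : ∀ α g, ‖T α g‖ ≤ ‖g‖) (f g : L2Space d) :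
    HasSum (fun α => inner ℂ (coeff (φ α) g) (T α (coeff (e α) f)))
      (inner ℂ g (transport e φ T f)) := by
  have h := (hasSum_transport (e := e) (φ := φ) hd hT f).mapL (innerSL ℂ g)
  simp only [innerSL_apply_apply] at h
  refine h.congr_fun fun α => ?_
  rw [← inner_conj_symm, ← inner_separated hd, inner_conj_symm]

theorem adjoint_transport (hd : 1 ≤ d) (hT : ∀ α g, ‖T α g‖ ≤ ‖g‖) (hS : ∀ α g, ‖S α g‖ ≤ ‖g‖)
    (hST : ∀ α, ContinuousLinearMap.adjoint (T α) = S α) :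
    ContinuousLinearMap.adjoint (transport e φ T) = transport φ e S := by
  refine ContinuousLinearMap.ext fun f => ext_inner_left ℂ fun g => ?_
  rw [ContinuousLinearMap.adjoint_inner_right]
  have h1 := inner_transport (e := e) (φ := φ) hd hT g f
  have h2 := inner_transport (e := φ) (φ := e) hd hS f g
  have h3 := (Complex.hasSum_conj'.2 h1)
  simp only [inner_conj_symm] at h3
  refine h3.unique (h2.congr_fun fun α => ?_)
  rw [← hST α, ContinuousLinearMap.adjoint_inner_right]

theorem norm_hankelOp_mul_le (hd : 1 ≤ d) {ν : ι → ℝ} (hν : ∀ α, 0 ≤ ν α) (α : ι)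
    (g : L2Radial d) : ‖hankelOp d (ν α) g‖ ≤ ‖g‖ :=
  ((hankelOp_involution hd (hν α)).norm_map g).le

/-- The operator which acts as the Hankel transform of order `ν α` on the component along `φ α`. -/
def hankelTransport (φ : HilbertBasis ι ℂ (L2Sphere d)) (ν : ι → ℝ) : L2Space d →L[ℂ] L2Space d :=
  transport φ φ fun α => hankelOp d (ν α)

theorem hankelTransport_involution (hd : 1 ≤ d) {ν : ι → ℝ} (hν : ∀ α, 0 ≤ ν α) :
    IsUnitaryInvolution (hankelTransport φ ν) where
  adjoint_eq := adjoint_transport hd (norm_hankelOp_mul_le hd hν) (norm_hankelOp_mul_le hd hν)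
    fun α => (hankelOp_involution hd (hν α)).adjoint_eq
  mul_self := by
    rw [hankelTransport, transport_mul hd (norm_hankelOp_mul_le hd hν)
      (norm_hankelOp_mul_le hd hν)]
    simp_rw [(hankelOp_involution hd (hν _)).mul_self]
    exact transport_one hd

theorem hankelTransport_separated (hd : 1 ≤ d) {ν : ι → ℝ} (hν : ∀ α, 0 ≤ ν α) (g : L2Radial d)
    (α : ι) : hankelTransport φ ν (separated g (φ α)) = separated (hankelOp d (ν α) g) (φ α) := by
  classical
  refine eq_of_coeff_eq hd φ fun β => ?_
  rw [hankelTransport, coeff_transport hd (norm_hankelOp_mul_le hd hν), coeff_separated hd,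
    coeff_separated hd, map_smul, orthonormal_iff_ite.1 φ.orthonormal]
  by_cases h : β = α
  · subst h; rfl
  · simp [h]

theorem isBddMeas_radial {F : ℝ → ℂ} (hF : IsBddMeas F) :
    IsBddMeas (fun r : Ioi (0 : ℝ) => F ((r : ℝ) ^ 2)) :=
  hF.comp (measurable_subtype_coe.pow_const 2)

theorem isBddMeas_norm_sq {F : ℝ → ℂ} (hF : IsBddMeas F) :
    IsBddMeas (fun x : Space d => F (‖x‖ ^ 2)) := hF.comp (measurable_norm.pow_const 2)

theorem mulOp_separated (hd : 1 ≤ d) {F : ℝ → ℂ} (hF : IsBddMeas F) (g : L2Radial d)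
    (ψ : L2Sphere d) :
    mulOp volume (fun x : Space d => F (‖x‖ ^ 2)) (separated g ψ) =
      separated (mulOp (radialMeasure d) (fun r => F ((r : ℝ) ^ 2)) g) ψ := by
  refine Lp.ext (ae_of_ae_polarMap hd ?_)
  filter_upwards [ae_polarMap hd ((isBddMeas_norm_sq hF).mulOp_ae (separated g ψ)),
    separated_ae hd g ψ, separated_ae hd
      (mulOp (radialMeasure d) (fun r => F ((r : ℝ) ^ 2)) g) ψ,
    Measure.quasiMeasurePreserving_snd.ae ((isBddMeas_radial hF).mulOp_ae g)] with p h1 h2 h3 h4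
  rw [h1, h2, h3, h4, norm_polarMap, mul_assoc]

theorem coeff_mulOp (hd : 1 ≤ d) {F : ℝ → ℂ} (hF : IsBddMeas F) (ψ : L2Sphere d)
    (f : L2Space d) :
    coeff ψ (mulOp volume (fun x : Space d => F (‖x‖ ^ 2)) f) =
      mulOp (radialMeasure d) (fun r => F ((r : ℝ) ^ 2)) (coeff ψ f) := by
  refine ext_inner_left ℂ fun g => ?_
  rw [← inner_separated hd, ← ContinuousLinearMap.adjoint_inner_left,
    (isBddMeas_norm_sq hF).adjoint_mulOp, mulOp_separated hd hF.conj, inner_separated hd,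
    ← (isBddMeas_radial hF).adjoint_mulOp, ContinuousLinearMap.adjoint_inner_left]

/-- A function of `|x|` acts on the radial factor only, the change of basis on the angular factor
only. -/
theorem transport_one_mul_mulOp (hd : 1 ≤ d) {F : ℝ → ℂ} (hF : IsBddMeas F) :
    transport e φ (fun _ => 1) * mulOp volume (fun x : Space d => F (‖x‖ ^ 2)) =
      mulOp volume (fun x : Space d => F (‖x‖ ^ 2)) * transport e φ (fun _ => 1) := by
  refine ContinuousLinearMap.ext fun f => eq_of_coeff_eq hd φ fun α => ?_
  rw [mul_apply_eq_comp, mul_apply_eq_comp, coeff_transport hd norm_one_apply_le,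
    coeff_mulOp hd hF, coeff_mulOp hd hF, coeff_transport hd norm_one_apply_le]
  rfl

/-- The operator `∑ α, f_α e_α ↦ ∑ α, (𝓗_{ν α} 𝓗_{μ α} f_α) φ_α`. -/
def waveOperator (e φ : HilbertBasis ι ℂ (L2Sphere d)) (μ ν : ι → ℝ) : L2Space d →L[ℂ] L2Space d :=
  transport e φ fun α => hankelOp d (ν α) * hankelOp d (μ α)

variable {μ ν : ι → ℝ}

theorem norm_hankelOp_hankelOp_le (hd : 1 ≤ d) (hμ : ∀ α, 0 ≤ μ α) (hν : ∀ α, 0 ≤ ν α) (α : ι)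
    (g : L2Radial d) : ‖(hankelOp d (ν α) * hankelOp d (μ α)) g‖ ≤ ‖g‖ :=
  (norm_hankelOp_mul_le hd hν α _).trans (norm_hankelOp_mul_le hd hμ α g)

theorem hasSum_waveOperator (hd : 1 ≤ d) (hμ : ∀ α, 0 ≤ μ α) (hν : ∀ α, 0 ≤ ν α) (f : L2Space d) :
    HasSum (fun α => separated (hankel (ν α) (hankel (μ α) (coeff (e α) f))) (φ α))
      (waveOperator e φ μ ν f) := by
  refine (hasSum_transport hd (norm_hankelOp_hankelOp_le hd hμ hν) f).congr_fun fun α => ?_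
  rw [hankel_eq hd (hμ α), hankel_eq hd (hν α)]
  rfl

theorem star_waveOperator (hd : 1 ≤ d) (hμ : ∀ α, 0 ≤ μ α) (hν : ∀ α, 0 ≤ ν α) :
    star (waveOperator e φ μ ν) = waveOperator φ e ν μ := by
  rw [ContinuousLinearMap.star_eq_adjoint]
  refine adjoint_transport hd (norm_hankelOp_hankelOp_le hd hμ hν)
    (norm_hankelOp_hankelOp_le hd hν hμ) fun α => ?_
  rw [← ContinuousLinearMap.star_eq_adjoint, star_mul, ContinuousLinearMap.star_eq_adjoint,
    ContinuousLinearMap.star_eq_adjoint, (hankelOp_involution hd (hν α)).adjoint_eq,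
    (hankelOp_involution hd (hμ α)).adjoint_eq]

/-- This is the factorization `Ψ_φ V Ψ_e`, in which only the middle factor connects the two bases.
-/
theorem waveOperator_eq (hd : 1 ≤ d) (hμ : ∀ α, 0 ≤ μ α) (hν : ∀ α, 0 ≤ ν α) :
    waveOperator e φ μ ν =
      hankelTransport φ ν * transport e φ (fun _ => 1) * hankelTransport e μ := by
  have h1 : ∀ α g, ‖(hankelOp d (ν α) * 1) g‖ ≤ ‖g‖ := norm_hankelOp_mul_le hd hν
  rw [hankelTransport, hankelTransport, transport_mul hd norm_one_apply_le
    (norm_hankelOp_mul_le hd hν), transport_mul hd (norm_hankelOp_mul_le hd hμ) h1, waveOperator]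
  simp only [mul_one]

theorem waveOperator_mul_star (hd : 1 ≤ d) (hμ : ∀ α, 0 ≤ μ α) (hν : ∀ α, 0 ≤ ν α) :
    waveOperator e φ μ ν * star (waveOperator e φ μ ν) = 1 := by
  rw [star_waveOperator hd hμ hν, waveOperator, waveOperator,
    transport_mul hd (norm_hankelOp_hankelOp_le hd hν hμ) (norm_hankelOp_hankelOp_le hd hμ hν)]
  have : ∀ α, hankelOp d (ν α) * hankelOp d (μ α) * (hankelOp d (μ α) * hankelOp d (ν α)) = 1 := by
    intro α
    rw [mul_assoc, ← mul_assoc (hankelOp d (μ α)), (hankelOp_involution hd (hμ α)).mul_self,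
      one_mul, (hankelOp_involution hd (hν α)).mul_self]
  simp_rw [this]
  exact transport_one hd

theorem star_mul_waveOperator (hd : 1 ≤ d) (hμ : ∀ α, 0 ≤ μ α) (hν : ∀ α, 0 ≤ ν α) :
    star (waveOperator e φ μ ν) * waveOperator e φ μ ν = 1 := by
  have h := waveOperator_mul_star (e := φ) (φ := e) hd hν hμ
  rwa [star_waveOperator hd hν hμ, ← star_waveOperator hd hμ hν] at h

/-- The inner factors `Ψ` cancel in pairs; then `V` moves past `M` and cancels against `V'`. -/
theorem conj_mul_conj_eq {R : Type*} [Monoid R] {Φ Ψ V V' M : R} (h1 : Ψ * Ψ = 1) (h2 : V * V' = 1)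
    (h3 : V * M = M * V) : Φ * V * Ψ * (Ψ * M * Ψ) * (Ψ * V' * Φ) = Φ * M * Φ := by
  have h4 : M * (V * (V' * Φ)) = M * Φ := by rw [← mul_assoc V, h2, one_mul]
  have h5 : ∀ X, Ψ * (Ψ * X) = X := fun X => by rw [← mul_assoc, h1, one_mul]
  have h6 : ∀ X, V * (M * X) = M * (V * X) := fun X => by rw [← mul_assoc, h3, mul_assoc]
  simp only [mul_assoc]
  rw [h5, h5, h6, h4]

/-- The wave operator intertwines the functions of the two diagonalized operators. -/
theorem waveOperator_conj (hd : 1 ≤ d) (hμ : ∀ α, 0 ≤ μ α) (hν : ∀ α, 0 ≤ ν α) {F : ℝ → ℂ}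
    (hF : IsBddMeas F) :
    waveOperator e φ μ ν * (hankelTransport e μ * mulOp volume (fun x : Space d => F (‖x‖ ^ 2)) *
        hankelTransport e μ) * star (waveOperator e φ μ ν) =
      hankelTransport φ ν * mulOp volume (fun x : Space d => F (‖x‖ ^ 2)) *
        hankelTransport φ ν := by
  rw [star_waveOperator hd hμ hν, waveOperator_eq hd hμ hν, waveOperator_eq hd hν hμ]
  refine conj_mul_conj_eq (hankelTransport_involution hd hμ).mul_self ?_ (transport_one_mul_mulOp hd hF)
  rw [transport_mul hd norm_one_apply_le norm_one_apply_le]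
  simp only [mul_one]
  exact transport_one hd

end Transport

/-! ## Weak limits in the graph of a form -/

section WeakLimit

theorem tendsto_inner_of_dense {K V : Type*} [NormedAddCommGroup K] [InnerProductSpace ℂ K]
    {ι : V → K} (hι : DenseRange ι) {x : ℕ → K} {B : ℝ} (hB : ∀ n, ‖x n‖ ≤ B)
    (h : ∀ ψ, Tendsto (fun n => inner ℂ (ι ψ) (x n)) atTop (𝓝 0)) (v : K) :
    Tendsto (fun n => inner ℂ v (x n)) atTop (𝓝 0) := by
  have hB0 : 0 ≤ B := (norm_nonneg _).trans (hB 0)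
  rw [Metric.tendsto_atTop]
  intro ε hε
  obtain ⟨ψ, hψ⟩ := hι.exists_dist_lt v (show 0 < ε / (2 * (B + 1)) by positivity)
  obtain ⟨N, hN⟩ := (Metric.tendsto_atTop.1 (h ψ)) (ε / 2) (by positivity)
  refine ⟨N, fun n hn => ?_⟩
  have h1 := hN n hn
  rw [dist_zero_right] at h1 ⊢
  have h2 : inner ℂ v (x n) = inner ℂ (v - ι ψ) (x n) + inner ℂ (ι ψ) (x n) := by
    rw [inner_sub_left]; ring
  have h3 : ‖inner ℂ (v - ι ψ) (x n)‖ ≤ ε / (2 * (B + 1)) * (B + 1) := by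
    refine (norm_inner_le_norm _ _).trans ?_
    rw [dist_eq_norm] at hψ
    exact mul_le_mul hψ.le ((hB n).trans (by linarith)) (norm_nonneg _) (by positivity)
  have h4 : ε / (2 * (B + 1)) * (B + 1) = ε / 2 := by field_simp
  rw [h2]
  refine (norm_add_le _ _).trans_lt ?_
  linarith

universe u
variable {V : Type u} {H : Type*} [AddCommGroup V] [Module ℂ V] [NormedAddCommGroup H]
  [InnerProductSpace ℂ H] [CompleteSpace H]

/-- A weak limit of elements of the form graph with bounded energy belongs to the form graph. -/
theorem IsPosForm.mem_formGraph_of_bounded {q : V → V → ℂ} (hq : IsPosForm q) (j : V →ₗ[ℂ] H)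
    {u f : H} {un fn : ℕ → H} (hmem : ∀ n, (un n, fn n) ∈ formGraph j q) {B : ℝ}
    (hB : ∀ n, (inner ℂ (un n) (un n + fn n)).re ≤ B)
    (hu : ∀ v, Tendsto (fun n => inner ℂ v (un n)) atTop (𝓝 (inner ℂ v u)))
    (hf : ∀ ψ, Tendsto (fun n => inner ℂ (j ψ) (fn n)) atTop (𝓝 (inner ℂ (j ψ) f))) :
    (u, f) ∈ formGraph j q := by
  obtain ⟨K, _, _, _, ι, J, hd, hJ, hι⟩ := hq.exists_energy j
  simp only [energy_mem_formGraph hd hJ hι] at hmem ⊢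
  set x : ℕ → K := fun n => ContinuousLinearMap.adjoint J (un n + fn n) with hx
  set k : K := ContinuousLinearMap.adjoint J (u + f) with hk
  -- Since `J (x n) = un n`, the hypothesis `hB` is a bound for the energy norm of the lifts `x n`.
  have hxB : ∀ n, ‖x n‖ ^ 2 ≤ B := fun n => by
    rw [← inner_self_eq_norm_sq (𝕜 := ℂ), hx, ContinuousLinearMap.adjoint_inner_right, hmem]
    exact hB n
  have hbd : ∀ n, ‖x n - k‖ ≤ √B + ‖k‖ := fun n =>
    (norm_sub_le _ _).trans (by gcongr; exact Real.le_sqrt_of_sq_le (hxB n))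
  have hweak : ∀ v, Tendsto (fun n => inner ℂ v (x n - k)) atTop (𝓝 0) := by
    refine tendsto_inner_of_dense hd hbd fun ψ => ?_
    have h1 := ((hu (j ψ)).add (hf ψ)).sub_const (inner ℂ (j ψ) u + inner ℂ (j ψ) f)
    rw [sub_self] at h1
    refine h1.congr fun n => ?_
    rw [inner_sub_right, hx, hk, ContinuousLinearMap.adjoint_inner_right,
      ContinuousLinearMap.adjoint_inner_right, hJ, inner_add_right, inner_add_right]
  -- The lifts converge weakly to `k`, so `J k` is the weak limit of `un n = J (x n)`, which is `u`.
  refine ext_inner_left ℂ fun v => ?_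
  have h1 := hweak (ContinuousLinearMap.adjoint J v)
  have h2 := (hu v).sub_const (inner ℂ v (J k))
  have h3 : (fun n => inner ℂ (ContinuousLinearMap.adjoint J v) (x n - k)) =
      fun n => inner ℂ v (un n) - inner ℂ v (J k) := by
    funext n
    rw [inner_sub_right, ContinuousLinearMap.adjoint_inner_left,
      ContinuousLinearMap.adjoint_inner_left, hx, hmem]
  rw [h3] at h1
  exact (sub_eq_zero.1 (tendsto_nhds_unique h2 h1)).symm

end WeakLimit

/-! ## Functions supported in an annulus -/

section Annular

variable {d : ℕ}

/-- The function vanishes near the origin and near infinity. -/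
def IsAnnular {E : Type*} [Zero E] (F : Sph d × Ioi (0 : ℝ) → E) : Prop :=
  ∃ δ R : ℝ, 0 < δ ∧ ∀ p, (p.2 : ℝ) ∉ Icc δ R → F p = 0

theorem isCompact_annulus {δ : ℝ} (hδ : 0 < δ) (R : ℝ) :
    IsCompact ((univ : Set (Sph d)) ×ˢ ((↑) ⁻¹' Icc δ R : Set (Ioi (0 : ℝ)))) := by
  refine isCompact_univ.prod ?_
  rw [Topology.IsInducing.subtypeVal.isCompact_preimage_iff]
  · exact isCompact_Icc
  · rw [Subtype.range_coe]
    exact fun r hr => lt_of_lt_of_le hδ hr.1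

theorem radialMeasure_Icc_lt_top (δ R : ℝ) :
    radialMeasure d ((↑) ⁻¹' Icc δ R : Set (Ioi (0 : ℝ))) < ⊤ := by
  have h : ((↑) ⁻¹' Icc δ R : Set (Ioi (0 : ℝ))) ⊆ Iio ⟨|R| + 1, by
      rw [mem_Ioi]; positivity⟩ := by
    intro r hr
    rw [mem_Iio, ← Subtype.coe_lt_coe]
    exact lt_of_le_of_lt (hr.2.trans (le_abs_self R)) (lt_add_one _)
  refine (measure_mono h).trans_lt ?_
  rw [Measure.volumeIoiPow_apply_Iio]
  exact ENNReal.ofReal_lt_top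

theorem IsAnnular.mul_left {F : Sph d × Ioi (0 : ℝ) → ℂ} (hF : IsAnnular F)
    (G : Sph d × Ioi (0 : ℝ) → ℂ) : IsAnnular fun p => G p * F p := by
  obtain ⟨δ, R, hδ, h⟩ := hF
  exact ⟨δ, R, hδ, fun p hp => by simp only [h p hp, mul_zero]⟩

theorem IsAnnular.exists_bound {F : Sph d × Ioi (0 : ℝ) → ℂ} (hF : IsAnnular F)
    (hc : Continuous F) : ∃ M : ℝ, 0 ≤ M ∧ ∀ p, ‖F p‖ ≤ M := by
  obtain ⟨δ, R, hδ, h⟩ := hF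
  obtain ⟨M, hM⟩ := (isCompact_annulus (d := d) hδ R).exists_bound_of_continuousOn hc.continuousOn
  refine ⟨|M|, abs_nonneg _, fun p => ?_⟩
  by_cases hp : (p.2 : ℝ) ∈ Icc δ R
  · exact (hM p ⟨mem_univ _, hp⟩).trans (le_abs_self _)
  · rw [h p hp, norm_zero]
    exact abs_nonneg _

theorem IsAnnular.integrable {F : Sph d × Ioi (0 : ℝ) → ℂ} (hF : IsAnnular F)
    (hm : AEStronglyMeasurable F ((surfaceMeasure d).prod (radialMeasure d))) {M : ℝ}
    (hM : ∀ᵐ p ∂((surfaceMeasure d).prod (radialMeasure d)), ‖F p‖ ≤ M) :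
    Integrable F ((surfaceMeasure d).prod (radialMeasure d)) := by
  obtain ⟨δ, R, hδ, h⟩ := hF
  set S := (univ : Set (Sph d)) ×ˢ ((↑) ⁻¹' Icc δ R : Set (Ioi (0 : ℝ))) with hS
  have h1 : IntegrableOn F S ((surfaceMeasure d).prod (radialMeasure d)) := by
    refine Measure.integrableOn_of_bounded (M := M) ?_ hm (ae_restrict_of_ae hM)
    rw [hS, Measure.prod_prod]
    exact (ENNReal.mul_lt_top (measure_lt_top _ _) (radialMeasure_Icc_lt_top δ R)).ne
  refine (integrableOn_iff_integrable_of_support_subset fun p hp => ?_).1 h1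
  by_contra hc
  exact hp (h p fun h' => hc ⟨mem_univ _, h'⟩)

theorem IsAnnular.integrable_of_continuous {F : Sph d × Ioi (0 : ℝ) → ℂ} (hF : IsAnnular F)
    (hc : Continuous F) : Integrable F ((surfaceMeasure d).prod (radialMeasure d)) := by
  obtain ⟨M, -, hM⟩ := hF.exists_bound hc
  exact hF.integrable hc.aestronglyMeasurable (Eventually.of_forall hM)

end Annular

/-! ## Test functions in polar coordinates -/

section TestFunctions

variable {d : ℕ}

theorem continuous_polarMap : Continuous (polarMap (d := d)) := by
  unfold polarMap
  fun_prop

theorem homExt_of_ne {β : Type*} [Zero β] (f : Sph d → β) {x : Space d} (hx : x ≠ 0) :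
    homExt f x = f ⟨‖x‖⁻¹ • x, by
      rw [mem_sphere_zero_iff_norm, norm_smul, norm_inv, norm_norm,
        inv_mul_cancel₀ (norm_ne_zero_iff.2 hx)]⟩ := by
  rw [homExt, ofPolar, dif_pos (show x ∈ ({0}ᶜ : Set (Space d)) from hx)]
  congr 1
  exact Subtype.ext (homeomorphUnitSphereProd_apply_fst_coe (Space d) _)

theorem sphere_ne_zero (θ : Sph d) : (θ : Space d) ≠ 0 := by
  rw [← norm_ne_zero_iff, norm_eq_of_mem_sphere]
  exact one_ne_zero

theorem contDiffOn_normalize (r : ℝ) :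
    ContDiffOn ℝ ∞ (fun x : Space d => r • ‖x‖⁻¹ • x) {0}ᶜ := by
  have h1 : ContDiffOn ℝ ∞ (fun x : Space d => ‖x‖) {0}ᶜ := fun x hx =>
    (contDiffAt_norm ℝ hx).contDiffWithinAt
  have h2 : ContDiffOn ℝ ∞ (fun x : Space d => ‖x‖⁻¹ • x) {0}ᶜ :=
    (h1.inv fun x hx => norm_ne_zero_iff.2 hx).smul contDiffOn_id
  exact h2.const_smul r

/-- The restriction of a test function to the sphere of radius `r`, as a function on the unit
sphere. -/
def slice (u : TestSpace d) (r : ℝ) : SmoothSphere d :=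
  ⟨fun θ => u (r • (θ : Space d)), by
    change ContDiffOn ℝ ∞ _ _
    refine (u.contDiff.comp_contDiffOn (contDiffOn_normalize r)).congr fun x hx => ?_
    rw [homExt_of_ne _ hx]
    rfl⟩

theorem slice_apply (u : TestSpace d) (r : ℝ) (θ : Sph d) :
    (slice u r).1 θ = u (r • (θ : Space d)) := rfl

/-- The radial derivative of a test function, in polar coordinates. -/
def radialDeriv (u : TestSpace d) (p : Sph d × Ioi (0 : ℝ)) : ℂ :=
  fderiv ℝ u (polarMap p) (p.1 : Space d)

/-- At a unit vector, `x ↦ x/|x|` has the tangential projection as its derivative; the norm is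
differentiated as `√(‖x‖²)`. -/
theorem hasFDerivAt_normalize (r : ℝ) (θ : Sph d) :
    HasFDerivAt (fun x : Space d => r • ‖x‖⁻¹ • x)
      (r • (ContinuousLinearMap.id ℝ (Space d) -
        (innerSL ℝ (θ : Space d)).smulRight (θ : Space d))) (θ : Space d) := by
  have hn : ‖(θ : Space d)‖ = 1 := norm_eq_of_mem_sphere θ
  have h1 : HasFDerivAt (fun x : Space d => ‖x‖ ^ 2) (2 • innerSL ℝ (θ : Space d)) (θ : Space d) :=
    (hasStrictFDerivAt_norm_sq (θ : Space d)).hasFDerivAt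
  have h2 := h1.sqrt (by rw [hn]; norm_num)
  have h3 : (fun x : Space d => √(‖x‖ ^ 2)) = fun x => ‖x‖ := by
    funext x
    exact Real.sqrt_sq (norm_nonneg x)
  rw [h3] at h2
  have h4 := ((hasDerivAt_inv (by rw [hn]; norm_num)).comp_hasFDerivAt (θ : Space d) h2)
  have h5 := (h4.smul (hasFDerivAt_id (θ : Space d))).const_smul r
  refine h5.congr_fderiv ?_
  ext v
  simp [hn]
  ring

theorem fderiv_slice (u : TestSpace d) (r : ℝ) (θ : Sph d) (v : Space d) :
    fderiv ℝ (homExt (slice u r).1) (θ : Space d) v =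
      r • fderiv ℝ u (r • (θ : Space d)) v -
        (r * inner ℝ (θ : Space d) v) • fderiv ℝ u (r • (θ : Space d)) (θ : Space d) := by
  have h1 : homExt (slice u r).1 =ᶠ[𝓝 (θ : Space d)] fun x => u (r • ‖x‖⁻¹ • x) := by
    filter_upwards [isOpen_compl_singleton.mem_nhds (sphere_ne_zero θ)] with x hx
    rw [homExt_of_ne _ hx]
    rfl
  have h2 : DifferentiableAt ℝ u (r • ‖(θ : Space d)‖⁻¹ • (θ : Space d)) :=
    (u.contDiff.differentiable (by simp)).differentiableAt
  have h3 : HasFDerivAt (fun x : Space d => u (r • ‖x‖⁻¹ • x)) _ (θ : Space d) :=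
    h2.hasFDerivAt.comp (θ : Space d) (hasFDerivAt_normalize r θ)
  rw [h1.fderiv_eq, h3.fderiv]
  simp [norm_eq_of_mem_sphere θ, smul_sub, mul_assoc]

theorem sum_coord_smul_single (x : Space d) :
    ∑ i, x i • EuclideanSpace.single i (1 : ℝ) = x := by
  ext j
  simp [Finset.sum_apply, Pi.single_apply]

/-- The gradient part is tangential because the extension is homogeneous of degree zero, and the
potential part because `A` is transversal. This orthogonality removes the mixed terms in
`hamiltonianDensity_polarMap`. -/
theorem sum_mul_sphericalMagneticGrad_slice {A : Sph d → Space d}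
    (hA : ∀ θ : Sph d, inner ℝ (A θ) (θ : Space d) = 0) (u : TestSpace d) (r : ℝ) (θ : Sph d) :
    ∑ i, (((θ : Space d) i : ℝ) : ℂ) * sphericalMagneticGrad A (slice u r).1 θ i = 0 := by
  have h1 : ∑ i, (((θ : Space d) i : ℝ) : ℂ) * fderiv ℝ (homExt (slice u r).1) (θ : Space d)
      (EuclideanSpace.single i 1) = 0 := by
    have h2 : fderiv ℝ (homExt (slice u r).1) (θ : Space d) (θ : Space d) = 0 := by
      rw [fderiv_slice, real_inner_self_eq_norm_sq, norm_eq_of_mem_sphere]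
      simp
    have h3 : fderiv ℝ (homExt (slice u r).1) (θ : Space d)
        (∑ i, (θ : Space d) i • EuclideanSpace.single i (1 : ℝ)) = 0 := by
      rwa [sum_coord_smul_single]
    rw [map_sum] at h3
    rw [← h3]
    refine Finset.sum_congr rfl fun i _ => ?_
    rw [map_smul, Complex.real_smul]
  have h3 : ∑ i, (((θ : Space d) i : ℝ) : ℂ) * ((A θ i : ℝ) : ℂ) = 0 := by
    have := hA θ
    rw [PiLp.inner_apply] at this
    exact_mod_cast this
  simp only [sphericalMagneticGrad, mul_add, Finset.sum_add_distrib, h1, zero_add]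
  calc _ = ∑ i, ((((θ : Space d) i : ℝ) : ℂ) * ((A θ i : ℝ) : ℂ)) * (Complex.I * (slice u r).1 θ) :=
        Finset.sum_congr rfl fun i _ => by ring
    _ = 0 := by rw [← Finset.sum_mul, h3, zero_mul]

theorem magneticGrad_polarMap (A : Sph d → Space d) (u : TestSpace d) (p : Sph d × Ioi (0 : ℝ))
    (i : Fin d) :
    magneticGrad A u (polarMap p) i = (((p.1 : Space d) i : ℝ) : ℂ) * radialDeriv u p +
      (((p.2 : ℝ) : ℂ))⁻¹ * sphericalMagneticGrad A (slice u p.2).1 p.1 i := by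
  have hr : ((p.2 : ℝ) : ℂ) ≠ 0 := Complex.ofReal_ne_zero.2 p.2.2.ne'
  have hi : inner ℝ (p.1 : Space d) (EuclideanSpace.single i 1) = (p.1 : Space d) i := by
    rw [EuclideanSpace.inner_single_right]
    simp
  rw [magneticGrad, sphericalMagneticGrad, fderiv_slice, hi, norm_polarMap, homExt_polarMap,
    radialDeriv, slice_apply]
  simp only [polarMap, Complex.real_smul]
  push_cast
  field_simp
  ring

/-- The integrand of the spherical form. -/
def sphericalDensity (A : Sph d → Space d) (a : Sph d → ℝ) (φ ψ : Sph d → ℂ) (θ : Sph d) : ℂ :=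
  (∑ i, conj (sphericalMagneticGrad A φ θ i) * sphericalMagneticGrad A ψ θ i) +
    ((a θ : ℝ) : ℂ) * (conj (φ θ) * ψ θ)

/-- The integrand of the form of the Hamiltonian. -/
def hamiltonianDensity (A : Sph d → Space d) (a : Sph d → ℝ) (u v : TestSpace d) (x : Space d) :
    ℂ :=
  (∑ i, conj (magneticGrad A u x i) * magneticGrad A v x i) +
    ((homExt a x / ‖x‖ ^ 2 : ℝ) : ℂ) * (conj (u x) * v x)

/-- Pythagoras: the magnetic gradient is its radial part along `θ` plus `r⁻¹` times a tangential
part, and the potential scales like `r⁻²` as well. -/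
theorem hamiltonianDensity_polarMap {A : Sph d → Space d}
    (hA : ∀ θ : Sph d, inner ℝ (A θ) (θ : Space d) = 0) (a : Sph d → ℝ) (u v : TestSpace d)
    (p : Sph d × Ioi (0 : ℝ)) :
    hamiltonianDensity A a u v (polarMap p) = conj (radialDeriv u p) * radialDeriv v p +
      (((p.2 : ℝ) ^ 2)⁻¹ : ℝ) *
        sphericalDensity A a (slice u p.2).1 (slice v p.2).1 p.1 := by
  have hr : ((p.2 : ℝ) : ℂ) ≠ 0 := Complex.ofReal_ne_zero.2 p.2.2.ne'
  have h1 : ∑ i, ((((p.1 : Space d) i : ℝ) : ℂ) * (((p.1 : Space d) i : ℝ) : ℂ)) = 1 := by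
    have := real_inner_self_eq_norm_sq (p.1 : Space d)
    rw [norm_eq_of_mem_sphere, PiLp.inner_apply] at this
    norm_num at this
    exact_mod_cast (by simpa [pow_two] using this)
  have hu := sum_mul_sphericalMagneticGrad_slice hA u p.2 p.1
  have hv := sum_mul_sphericalMagneticGrad_slice hA v p.2 p.1
  have hu' := congrArg conj hu
  simp only [map_sum, map_mul, Complex.conj_ofReal, map_zero] at hu'
  rw [hamiltonianDensity, sphericalDensity, homExt_polarMap, norm_polarMap]
  simp only [magneticGrad_polarMap, slice_apply, map_add, map_mul, map_inv₀, Complex.conj_ofReal]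
  set D := radialDeriv u p
  set E := radialDeriv v p
  set S := fun i => sphericalMagneticGrad A (slice u p.2).1 p.1 i
  set T := fun i => sphericalMagneticGrad A (slice v p.2).1 p.1 i
  calc _ = (∑ i, ((((p.1 : Space d) i : ℝ) : ℂ) * (((p.1 : Space d) i : ℝ) : ℂ)) * (conj D * E)) +
          (∑ i, ((((p.1 : Space d) i : ℝ) : ℂ) * T i)) * (conj D * ((p.2 : ℝ) : ℂ)⁻¹) +
          (∑ i, ((((p.1 : Space d) i : ℝ) : ℂ) * conj (S i))) * (E * ((p.2 : ℝ) : ℂ)⁻¹) +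
          ((p.2 : ℝ) : ℂ)⁻¹ ^ 2 * (∑ i, conj (S i) * T i) +
          ((a p.1 / (p.2 : ℝ) ^ 2 : ℝ) : ℂ) * (conj (u (polarMap p)) * v (polarMap p)) := by
        rw [Finset.sum_mul, Finset.sum_mul, Finset.mul_sum, ← Finset.sum_mul, Finset.sum_mul,
          ← Finset.sum_add_distrib, ← Finset.sum_add_distrib, ← Finset.sum_add_distrib]
        congr 1
        refine Finset.sum_congr rfl fun i _ => ?_
        simp only [S, T, D, E]
        ring
    _ = _ := by
        rw [hv, hu', ← Finset.sum_mul, h1]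
        simp only [S, T, polarMap]
        push_cast
        field_simp
        ring

end TestFunctions

set_option linter.unusedSectionVars false

/-! ## Lower bounds of forms from eigenbases -/

section LowerBound

universe u
variable {V : Type u} {H : Type*} [AddCommGroup V] [Module ℂ V] [NormedAddCommGroup H]
  [InnerProductSpace ℂ H] [CompleteSpace H]

theorem tendsto_map_sub {j : V →ₗ[ℂ] H} {w : ℕ → V} {u : H}
    (h1 : Tendsto (fun n => j (w n)) atTop (𝓝 u)) :
    Tendsto (fun nm : ℕ × ℕ => j (w nm.1 - w nm.2)) atTop (𝓝 0) := by
  have h5 : Tendsto (fun nm : ℕ × ℕ => j (w nm.1) - j (w nm.2)) atTop (𝓝 (u - u)) := by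
    rw [← prod_atTop_atTop_eq]
    exact (h1.comp tendsto_fst).sub (h1.comp tendsto_snd)
  simpa using h5

theorem tendsto_form_shift {q : V → V → ℂ} {j : V →ₗ[ℂ] H} {w : ℕ → V} {u : H}
    (h1 : Tendsto (fun n => j (w n)) atTop (𝓝 u))
    (h2 : Tendsto (fun nm : ℕ × ℕ => q (w nm.1 - w nm.2) (w nm.1 - w nm.2)) atTop (𝓝 0))
    (b c : ℂ) : Tendsto (fun nm : ℕ × ℕ => b * q (w nm.1 - w nm.2) (w nm.1 - w nm.2) +
      c * inner ℂ (j (w nm.1 - w nm.2)) (j (w nm.1 - w nm.2))) atTop (𝓝 0) := by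
  have h4 := tendsto_map_sub h1
  have h6 := (h2.const_mul b).add ((h4.inner h4).const_mul c)
  simpa using h6

/-- The spherical form is only bounded below, while the resolvent theory is for positive forms; the
shift bridges the gap. -/
theorem formGraph_shift {q : V → V → ℂ} {j : V →ₗ[ℂ] H} {u f : H} (h : (u, f) ∈ formGraph j q)
    (c : ℝ) : (u, f + (c : ℂ) • u) ∈ formGraph j fun v w => q v w + c * inner ℂ (j v) (j w) := by
  obtain ⟨w, h1, h2, h3⟩ := h
  refine ⟨w, h1, by simpa using tendsto_form_shift h1 h2 1 c, fun ψ => ?_⟩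
  have h4 := (h3 ψ).add ((Tendsto.inner (tendsto_const_nhds (x := j ψ)) h1).const_mul (c : ℂ))
  simpa [inner_add_right, inner_smul_right] using h4

/-- The resolvent of the shifted form is diagonal in the basis, with entries `(1 + lam α + c)⁻¹` at
most `(1 + c - k)⁻¹`. Parseval bounds its norm, `IsPosForm.exists_resolvent` converts this into a
bound for the form, and `c` drops out. -/
theorem form_lower_bound {q : V → V → ℂ} {j : V →ₗ[ℂ] H} {c k : ℝ}
    (hq : IsPosForm fun u v => q u v + c * inner ℂ (j u) (j v)) {ι : Type*}
    (b : HilbertBasis ι ℂ H) {lam : ι → ℝ} (hl : ∀ α, -k ≤ lam α) (hc : k ≤ c)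
    (hb : ∀ α, (b α, (lam α : ℂ) • b α) ∈ formGraph j q) (ψ : V) :
    -k * ‖j ψ‖ ^ 2 ≤ (q ψ ψ).re := by
  obtain ⟨R, hRa, hR, hM⟩ := hq.exists_resolvent j
  have h1 : ∀ α, R (b α) = (((1 + lam α + c)⁻¹ : ℝ) : ℂ) • b α := by
    intro α
    have hpos : (0 : ℝ) < 1 + lam α + c := by linarith [hl α]
    have h2 := (hR _ _).1 (formGraph_shift (hb α) c)
    have h3 : b α + ((lam α : ℂ) • b α + (c : ℂ) • b α) = ((1 + lam α + c : ℝ) : ℂ) • b α := by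
      push_cast
      module
    rw [h3, map_smul] at h2
    conv_rhs => rw [← h2]
    rw [smul_smul, ← Complex.ofReal_mul, inv_mul_cancel₀ hpos.ne', Complex.ofReal_one, one_smul]
  have hpos : (0 : ℝ) < 1 + c - k := by linarith
  have hnorm : ‖R‖ ≤ (1 + c - k)⁻¹ := by
    refine ContinuousLinearMap.opNorm_le_bound _ (by positivity) fun f => ?_
    have hP : ∀ g : H, HasSum (fun α => ‖inner ℂ (b α) g‖ ^ 2) (‖g‖ ^ 2) := fun g => by
      have h := lp.hasSum_norm (p := 2) (by simp) (b.repr g)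
      simpa [b.repr_apply_apply, LinearIsometryEquiv.norm_map] using h
    refine (pow_le_pow_iff_left₀ (norm_nonneg _) (by positivity) two_ne_zero).1 ?_
    rw [mul_pow]
    refine hasSum_le (fun α => ?_) (hP (R f)) ((hP f).mul_left _)
    rw [← mul_pow, ← ContinuousLinearMap.adjoint_inner_left, hRa, h1, inner_smul_left, norm_mul,
      Complex.conj_ofReal, Complex.norm_real]
    have hpos' : (0 : ℝ) < 1 + lam α + c := by linarith [hl α]
    rw [Real.norm_of_nonneg (inv_nonneg.2 hpos'.le)]
    gcongr
    linarith [hl α]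
  have h2 := hM _ hnorm ψ
  rw [inv_mul_eq_div, le_div_iff₀ hpos] at h2
  have h3 : (q ψ ψ + c * inner ℂ (j ψ) (j ψ)).re = (q ψ ψ).re + c * ‖j ψ‖ ^ 2 := by
    rw [inner_self_ofReal, ← Complex.ofReal_mul, Complex.add_re, Complex.ofReal_re]
  rw [h3] at h2
  linarith

end LowerBound

/-! ## Integration along rays -/

section Rays

theorem integrableOn_of_annular {E : Type*} [NormedAddCommGroup E] {f : ℝ → E} {δ R : ℝ}
    (hδ : 0 < δ) (hc : ContinuousOn f (Ioi 0)) (h : ∀ r, 0 < r → r ∉ Icc δ R → f r = 0) :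
    IntegrableOn f (Ioi 0) := by
  have h1 : IntegrableOn f (Icc δ R) :=
    (hc.mono fun r hr => lt_of_lt_of_le hδ hr.1).integrableOn_Icc
  exact h1.of_forall_sdiff_eq_zero measurableSet_Ioi fun r hr => h r hr.1 hr.2

/-- Vanishing is required only for `r > -δ`: along a ray, `r ↦ u(rθ)` reaches the opposite half of
the support of `u` for more negative `r`. -/
theorem integral_deriv_of_annular {E : Type*} [NormedAddCommGroup E] [NormedSpace ℝ E]
    [CompleteSpace E] {G G' : ℝ → E} {δ R : ℝ}
    (hδ : 0 < δ) (hG : ∀ r, 0 < r → HasDerivAt G (G' r) r) (hc : ContinuousOn G' (Ioi 0))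
    (h : ∀ r, -δ < r → r ∉ Icc δ R → G r = 0) : ∫ r in Ioi (0 : ℝ), G' r = 0 := by
  have h' : ∀ r, 0 < r → r ∉ Icc δ R → G' r = 0 := by
    intro r hr hr'
    have h1 : G =ᶠ[𝓝 r] fun _ => 0 := by
      filter_upwards [isClosed_Icc.isOpen_compl.mem_nhds hr', Ioi_mem_nhds hr] with s hs hs'
      exact h s ((neg_neg_of_pos hδ).trans hs') hs
    exact ((hG r hr).congr_of_eventuallyEq h1.symm).unique (hasDerivAt_const r 0)
  have h0 : G =ᶠ[𝓝 0] fun _ => 0 := by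
    filter_upwards [Ioo_mem_nhds (neg_neg_of_pos hδ) hδ] with s hs
    exact h s hs.1 fun hs' => (not_le.2 hs.2) hs'.1
  have h2 : ContinuousWithinAt G (Ici 0) 0 :=
    (continuousAt_const.congr h0.symm).continuousWithinAt
  have h3 : Tendsto G atTop (𝓝 0) := by
    refine tendsto_const_nhds.congr' ?_
    filter_upwards [eventually_gt_atTop R, eventually_gt_atTop (-δ)] with s hs hs'
    exact (h s hs' fun hs' => (not_le.2 hs) hs'.2).symm
  rw [integral_Ioi_of_hasDerivAt_of_tendsto h2 hG (integrableOn_of_annular hδ hc h') h3,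
    h0.self_of_nhds, sub_zero]

/-- The factor `n` makes the truncated exponent `n - 1` harmless at `n = 0`. -/
theorem nat_mul_pow_pred (n : ℕ) {r : ℝ} (hr : r ≠ 0) : n * r ^ (n - 1) = n * r ^ n / r := by
  cases n with
  | zero => simp
  | succ n => rw [Nat.add_sub_cancel, pow_succ]; field_simp

/-- Hardy's inequality on a ray. -/
theorem hardy_ray {d : ℕ} (hd : 2 ≤ d) {v v' : ℝ → ℂ} {δ R : ℝ} (hδ : 0 < δ)
    (hv : ∀ r, HasDerivAt v (v' r) r) (hc : Continuous v')
    (h : ∀ r, -δ < r → r ∉ Icc δ R → v r = 0) (h' : ∀ r, 0 < r → r ∉ Icc δ R → v' r = 0) :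
    0 ≤ ∫ r : Ioi (0 : ℝ), (‖v' r‖ ^ 2 -
      (((d : ℝ) - 2) / 2) ^ 2 * (((r : ℝ) ^ 2)⁻¹ * ‖v r‖ ^ 2)) ∂(radialMeasure d) := by
  obtain ⟨n, rfl⟩ : ∃ n, d = n + 2 := ⟨d - 2, by omega⟩
  set k : ℝ := ((↑(n + 2) : ℝ) - 2) / 2 with hk
  have hn : (n : ℝ) = 2 * k := by rw [hk]; push_cast; ring
  have hvc : Continuous v := continuous_iff_continuousAt.2 fun r => (hv r).continuousAt
  rw [integral_radial (d := n + 2) fun r => ‖v' r‖ ^ 2 - k ^ 2 * ((r ^ 2)⁻¹ * ‖v r‖ ^ 2)]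
  -- The derivative of `G` integrates to zero. With `n = 2k`, adding it to the integrand completes
  -- the square `r^{n+1} |v' + (k/r) v|²`.
  set G : ℝ → ℝ := fun r => k * (r ^ n * ‖v r‖ ^ 2)
  set G' : ℝ → ℝ := fun r => k * (n * r ^ (n - 1) * ‖v r‖ ^ 2 + r ^ n * (2 * inner ℝ (v r) (v' r)))
    with hG'
  have hG : ∀ r, 0 < r → HasDerivAt G (G' r) r := fun r _ =>
    ((hasDerivAt_pow n r).mul (hv r).norm_sq).const_mul k
  have hGc : Continuous G' := by
    have : Continuous fun r => inner ℝ (v r) (v' r) := hvc.inner hc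
    fun_prop
  have h0 := integral_deriv_of_annular (R := R) hδ hG hGc.continuousOn (fun r hr0 hr => by
    simp [G, h r hr0 hr])
  have hi1 : IntegrableOn G' (Ioi 0) := integrableOn_of_annular (R := R) hδ hGc.continuousOn
    fun r hr0 hr => by simp [G', h r ((neg_neg_of_pos hδ).trans hr0) hr]
  have hi2 : IntegrableOn (fun r : ℝ => r ^ (n + 2 - 1) •
      (‖v' r‖ ^ 2 - k ^ 2 * ((r ^ 2)⁻¹ * ‖v r‖ ^ 2))) (Ioi 0) := by
    refine integrableOn_of_annular (R := R) hδ ?_ fun r hr0 hr => by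
      simp [h r ((neg_neg_of_pos hδ).trans hr0) hr, h' r hr0 hr]
    have : ContinuousOn (fun r : ℝ => (r ^ 2)⁻¹) (Ioi 0) :=
      (continuousOn_pow 2).inv₀ fun r hr => (pow_pos hr 2).ne'
    fun_prop
  have h1 := integral_add hi2 hi1
  rw [h0, add_zero] at h1
  rw [← h1]
  refine setIntegral_nonneg measurableSet_Ioi fun r hr => ?_
  have hr0 : (r : ℝ) ≠ 0 := (ne_of_gt hr)
  have h3 : 0 ≤ r ^ (n + 1) * ‖v' r + (k / r) • v r‖ ^ 2 := by
    have : (0 : ℝ) < r := hr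
    positivity
  refine h3.trans_eq ?_
  rw [norm_add_sq_real, norm_smul, inner_smul_right, real_inner_comm, mul_pow, Real.norm_eq_abs,
    sq_abs, hG', smul_eq_mul]
  have h5 := nat_mul_pow_pred n hr0
  rw [hn] at h5
  simp only [hn, h5]
  rw [show n + 2 - 1 = n + 1 from rfl]
  field_simp
  ring

end Rays

/-! ## The forms -/

section Forms

variable {d : ℕ}

/-- The vector potential is continuous and transversal, and the electric potential is bounded. -/
structure IsAdmissible (A : Sph d → Space d) (a : Sph d → ℝ) : Prop where
  continuous : Continuous A
  transversal : ∀ θ : Sph d, inner ℝ (A θ) (θ : Space d) = 0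
  measurable : AEStronglyMeasurable a (surfaceMeasure d)
  bounded : ∃ M : ℝ, 0 ≤ M ∧ ∀ᵐ θ ∂(surfaceMeasure d), |a θ| ≤ M

variable {A : Sph d → Space d} {a : Sph d → ℝ}

theorem SmoothSphere.differentiableAt (ψ : SmoothSphere d) (θ : Sph d) :
    DifferentiableAt ℝ (homExt ψ.1) (θ : Space d) :=
  (ψ.2.differentiableOn (by simp)).differentiableAt
    (isOpen_compl_singleton.mem_nhds (sphere_ne_zero θ))

theorem sphericalMagneticGrad_add (A : Sph d → Space d) (φ ψ : SmoothSphere d) (θ : Sph d)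
    (i : Fin d) : sphericalMagneticGrad A (φ + ψ).1 θ i =
      sphericalMagneticGrad A φ.1 θ i + sphericalMagneticGrad A ψ.1 θ i := by
  have h : (φ + ψ).1 = φ.1 + ψ.1 := rfl
  rw [sphericalMagneticGrad, h, homExt_add,
    fderiv_add (SmoothSphere.differentiableAt φ θ) (SmoothSphere.differentiableAt ψ θ)]
  simp only [sphericalMagneticGrad, Pi.add_apply, add_apply]
  ring

theorem sphericalMagneticGrad_smul (A : Sph d → Space d) (c : ℂ) (ψ : SmoothSphere d) (θ : Sph d)
    (i : Fin d) : sphericalMagneticGrad A (c • ψ).1 θ i = c * sphericalMagneticGrad A ψ.1 θ i := by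
  have h : (c • ψ).1 = c • ψ.1 := rfl
  rw [sphericalMagneticGrad, h, homExt_smul, fderiv_const_smul (SmoothSphere.differentiableAt ψ θ)]
  simp only [sphericalMagneticGrad, Pi.smul_apply, smul_apply, smul_eq_mul]
  ring

theorem continuous_sphericalMagneticGrad (hA : Continuous A) (ψ : SmoothSphere d) (i : Fin d) :
    Continuous fun θ => sphericalMagneticGrad A ψ.1 θ i := by
  have h1 : ContinuousOn (fderiv ℝ (homExt ψ.1)) {0}ᶜ :=
    ψ.2.continuousOn_fderiv_of_isOpen isOpen_compl_singleton (by simp)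
  have h2 : Continuous fun θ : Sph d => fderiv ℝ (homExt ψ.1) (θ : Space d) :=
    h1.comp_continuous continuous_subtype_val fun θ => sphere_ne_zero θ
  have h3 := SmoothSphere.continuous ψ
  have h4 : Continuous fun θ => A θ i := (EuclideanSpace.proj i).continuous.comp hA
  unfold sphericalMagneticGrad
  fun_prop

theorem integrable_of_continuous_sphere {F : Sph d → ℂ} (hF : Continuous F) :
    Integrable F (surfaceMeasure d) :=
  hF.integrable_of_hasCompactSupport (HasCompactSupport.of_compactSpace _)

theorem IsAdmissible.integrable_potential_mul_sphere (h : IsAdmissible A a) {F : Sph d → ℂ}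
    (hF : Continuous F) : Integrable (fun θ => ((a θ : ℝ) : ℂ) * F θ) (surfaceMeasure d) := by
  obtain ⟨M, -, hM⟩ := h.bounded
  refine (integrable_of_continuous_sphere hF).bdd_mul (c := M)
    (Complex.continuous_ofReal.comp_aestronglyMeasurable h.measurable) ?_
  filter_upwards [hM] with θ hθ
  rwa [Complex.norm_real]

theorem IsAdmissible.integrable_sphericalDensity (h : IsAdmissible A a) (φ ψ : SmoothSphere d) :
    Integrable (sphericalDensity A a φ.1 ψ.1) (surfaceMeasure d) := by
  refine Integrable.add (integrable_of_continuous_sphere ?_)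
    (h.integrable_potential_mul_sphere ?_)
  · refine continuous_finsetSum _ fun i _ => ?_
    exact (Complex.continuous_conj.comp (continuous_sphericalMagneticGrad h.continuous φ i)).mul
      (continuous_sphericalMagneticGrad h.continuous ψ i)
  · exact (Complex.continuous_conj.comp (SmoothSphere.continuous φ)).mul (SmoothSphere.continuous ψ)

theorem sphericalForm_eq (φ ψ : SmoothSphere d) :
    sphericalForm A a φ ψ = ∫ θ, sphericalDensity A a φ.1 ψ.1 θ ∂(surfaceMeasure d) := rfl

theorem sphericalDensity_add_left (φ φ' ψ : SmoothSphere d) (θ : Sph d) :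
    sphericalDensity A a (φ + φ').1 ψ.1 θ =
      sphericalDensity A a φ.1 ψ.1 θ + sphericalDensity A a φ'.1 ψ.1 θ := by
  have h : (φ + φ').1 θ = φ.1 θ + φ'.1 θ := rfl
  simp only [sphericalDensity, sphericalMagneticGrad_add, h, map_add, add_mul,
    Finset.sum_add_distrib, mul_add]
  ring

theorem sphericalDensity_smul_left (c : ℂ) (φ ψ : SmoothSphere d) (θ : Sph d) :
    sphericalDensity A a (c • φ).1 ψ.1 θ = conj c * sphericalDensity A a φ.1 ψ.1 θ := by
  have h : (c • φ).1 θ = c * φ.1 θ := rfl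
  simp only [sphericalDensity, sphericalMagneticGrad_smul, h, map_mul, mul_add, Finset.mul_sum]
  congr 1
  · exact Finset.sum_congr rfl fun i _ => by ring
  · ring

theorem sphericalDensity_symm (φ ψ : Sph d → ℂ) (θ : Sph d) :
    conj (sphericalDensity A a ψ φ θ) = sphericalDensity A a φ ψ θ := by
  simp only [sphericalDensity, map_add, map_sum, map_mul, Complex.conj_conj, Complex.conj_ofReal]
  congr 1
  · exact Finset.sum_congr rfl fun i _ => mul_comm _ _
  · ring

theorem IsAdmissible.sphericalForm_add_left (h : IsAdmissible A a) (φ φ' ψ : SmoothSphere d) :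
    sphericalForm A a (φ + φ') ψ = sphericalForm A a φ ψ + sphericalForm A a φ' ψ := by
  simp only [sphericalForm_eq, sphericalDensity_add_left]
  exact integral_add (h.integrable_sphericalDensity φ ψ) (h.integrable_sphericalDensity φ' ψ)

theorem sphericalForm_smul_left (c : ℂ) (φ ψ : SmoothSphere d) :
    sphericalForm A a (c • φ) ψ = conj c * sphericalForm A a φ ψ := by
  simp only [sphericalForm_eq, sphericalDensity_smul_left]
  exact integral_const_mul _ _

theorem sphericalForm_symm (φ ψ : SmoothSphere d) :
    conj (sphericalForm A a ψ φ) = sphericalForm A a φ ψ := by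
  rw [sphericalForm_eq, sphericalForm_eq, ← integral_conj]
  simp only [sphericalDensity_symm]

theorem sphericalForm_smul_right (c : ℂ) (φ ψ : SmoothSphere d) :
    sphericalForm A a φ (c • ψ) = c * sphericalForm A a φ ψ := by
  rw [← sphericalForm_symm, sphericalForm_smul_left, map_mul, Complex.conj_conj, sphericalForm_symm]

theorem sphereToL2_ae (ψ : SmoothSphere d) : sphereToL2 ψ =ᵐ[surfaceMeasure d] ψ.1 :=
  MemLp.coeFn_toLp _

/-- The embedding of the smooth functions into `L²` of the sphere, as a linear map. -/
def sphereToL2Lin (d : ℕ) : SmoothSphere d →ₗ[ℂ] L2Sphere d where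
  toFun := sphereToL2
  map_add' φ ψ := by
    refine Lp.ext ?_
    filter_upwards [sphereToL2_ae (φ + ψ), sphereToL2_ae φ, sphereToL2_ae ψ,
      Lp.coeFn_add (sphereToL2 φ) (sphereToL2 ψ)] with θ h1 h2 h3 h4
    rw [h1, h4, Pi.add_apply, h2, h3]
    rfl
  map_smul' c ψ := by
    refine Lp.ext ?_
    filter_upwards [sphereToL2_ae (c • ψ), sphereToL2_ae ψ,
      Lp.coeFn_smul c (sphereToL2 ψ)] with θ h1 h2 h4
    rw [h1, RingHom.id_apply, h4, Pi.smul_apply, h2]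
    rfl

theorem inner_sphereToL2 (φ : SmoothSphere d) (f : L2Sphere d) :
    inner ℂ (sphereToL2 φ) f = ∫ θ, f θ * conj (φ.1 θ) ∂(surfaceMeasure d) := by
  rw [inner_L2_eq]
  refine integral_congr_ae ?_
  filter_upwards [sphereToL2_ae φ] with θ hθ
  rw [hθ]

theorem inner_sphereToL2_sphereToL2 (φ ψ : SmoothSphere d) :
    inner ℂ (sphereToL2 φ) (sphereToL2 ψ) = ∫ θ, ψ.1 θ * conj (φ.1 θ) ∂(surfaceMeasure d) := by
  rw [inner_sphereToL2]
  refine integral_congr_ae ?_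
  filter_upwards [sphereToL2_ae ψ] with θ hθ
  rw [hθ]

/-- The spherical form is bounded below. -/
theorem IsAdmissible.exists_isPosForm (h : IsAdmissible A a) (k : ℝ) :
    ∃ c : ℝ, k ≤ c ∧ IsPosForm fun φ ψ : SmoothSphere d =>
      sphericalForm A a φ ψ + c * inner ℂ (sphereToL2Lin d φ) (sphereToL2Lin d ψ) := by
  obtain ⟨M, hM0, hM⟩ := h.bounded
  -- The bound `c ≥ M` gives `a + c ≥ 0` almost everywhere; the bound `c ≥ k` is what
  -- `form_lower_bound` asks for.
  refine ⟨max k M, le_max_left _ _, ⟨fun u v w => ?_, fun c u v => ?_, fun u v => ?_, fun u => ?_⟩⟩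
  · rw [h.sphericalForm_add_left, map_add, inner_add_left]
    ring
  · rw [sphericalForm_smul_left, map_smul, inner_smul_left]
    ring
  · rw [map_add, sphericalForm_symm, map_mul, Complex.conj_ofReal, inner_conj_symm]
  · set c := max k M with hc
    have h1 : Integrable (fun θ => (c : ℂ) * (u.1 θ * conj (u.1 θ))) (surfaceMeasure d) :=
      (integrable_of_continuous_sphere
        ((SmoothSphere.continuous u).mul (Complex.continuous_conj.comp (SmoothSphere.continuous u)))).const_mul _
    have h2 : sphericalForm A a u u + c * inner ℂ (sphereToL2Lin d u) (sphereToL2Lin d u) =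
        ∫ θ, (sphericalDensity A a u.1 u.1 θ + c * (u.1 θ * conj (u.1 θ))) ∂(surfaceMeasure d) := by
      rw [integral_add (h.integrable_sphericalDensity u u) h1, integral_const_mul]
      congr 2
      exact inner_sphereToL2_sphereToL2 u u
    rw [h2]
    have h3 := integral_re ((h.integrable_sphericalDensity u u).add h1)
    change _ = RCLike.re _ at h3
    refine le_of_le_of_eq ?_ h3
    refine integral_nonneg_of_ae ?_
    filter_upwards [hM] with θ hθ
    have h4 : ∀ z : ℂ, conj z * z = ((‖z‖ ^ 2 : ℝ) : ℂ) := fun z => by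
      rw [mul_comm, Complex.mul_conj, Complex.normSq_eq_norm_sq]
    have h5 : sphericalDensity A a u.1 u.1 θ + c * (u.1 θ * conj (u.1 θ)) =
        (((∑ i, ‖sphericalMagneticGrad A u.1 θ i‖ ^ 2) + (a θ + c) * ‖u.1 θ‖ ^ 2 : ℝ) : ℂ) := by
      rw [sphericalDensity, mul_comm (u.1 θ)]
      simp only [h4]
      push_cast
      ring
    simp only [Pi.add_apply, Pi.zero_apply]
    rw [h5]
    rw [RCLike.re_eq_complex_re, Complex.ofReal_re]
    have h6 : 0 ≤ a θ + c := by
      have := (abs_le.1 hθ).1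
      have := le_max_right k M
      linarith
    positivity

end Forms

/-! ### The form of the Hamiltonian in polar coordinates, and its positivity. -/

section HamiltonianForm

variable {d : ℕ} {A : Sph d → Space d} {a : Sph d → ℝ}

theorem exists_annulus (u : TestSpace d) :
    ∃ δ R : ℝ, 0 < δ ∧ ∀ x, ‖x‖ ∉ Icc δ R → u x = 0 ∧ fderiv ℝ u x = 0 := by
  have h0 : (0 : Space d) ∈ (tsupport u)ᶜ := fun h => u.tsupport_subset h rfl
  obtain ⟨δ, hδ, h1⟩ := Metric.isOpen_iff.1 (isClosed_tsupport u).isOpen_compl 0 h0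
  obtain ⟨R, hR⟩ := u.hasCompactSupport.isCompact.isBounded.subset_closedBall 0
  refine ⟨δ, R, hδ, fun x hx => ?_⟩
  have h2 : x ∉ tsupport u := by
    intro h
    refine hx ⟨?_, mem_closedBall_zero_iff.1 (hR h)⟩
    by_contra hc
    exact h1 (mem_ball_zero_iff.2 (not_le.1 hc)) h
  exact ⟨image_eq_zero_of_notMem_tsupport h2, by
    by_contra hc
    exact h2 (support_fderiv_subset ℝ hc)⟩

theorem continuous_fderiv_test (u : TestSpace d) : Continuous (fderiv ℝ u) :=
  u.contDiff.continuous_fderiv (by simp)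

theorem continuous_test_polarMap (u : TestSpace d) :
    Continuous fun p : Sph d × Ioi (0 : ℝ) => u (polarMap p) :=
  u.continuous.comp continuous_polarMap

theorem isAnnular_test (u : TestSpace d) :
    IsAnnular fun p : Sph d × Ioi (0 : ℝ) => u (polarMap p) := by
  obtain ⟨δ, R, hδ, h⟩ := exists_annulus u
  exact ⟨δ, R, hδ, fun p hp => (h _ (by rwa [norm_polarMap])).1⟩

theorem continuous_radialDeriv (u : TestSpace d) : Continuous (radialDeriv u) :=
  ((continuous_fderiv_test u).comp continuous_polarMap).clm_apply
    (continuous_subtype_val.comp continuous_fst)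

theorem isAnnular_radialDeriv (u : TestSpace d) : IsAnnular (radialDeriv u) := by
  obtain ⟨δ, R, hδ, h⟩ := exists_annulus u
  exact ⟨δ, R, hδ, fun p hp => by
    rw [radialDeriv, (h _ (by rwa [norm_polarMap])).2, zero_apply]⟩

theorem sphericalMagneticGrad_slice (A : Sph d → Space d) (u : TestSpace d)
    (p : Sph d × Ioi (0 : ℝ)) (i : Fin d) :
    sphericalMagneticGrad A (slice u p.2).1 p.1 i =
      ((p.2 : ℝ) : ℂ) * fderiv ℝ u (polarMap p) (EuclideanSpace.single i 1) -
        (((p.2 : ℝ) * (p.1 : Space d) i : ℝ) : ℂ) * radialDeriv u p +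
        Complex.I * ((A p.1 i : ℝ) : ℂ) * u (polarMap p) := by
  have hi : inner ℝ (p.1 : Space d) (EuclideanSpace.single i 1) = (p.1 : Space d) i := by
    rw [EuclideanSpace.inner_single_right]
    simp
  rw [sphericalMagneticGrad, fderiv_slice, hi, radialDeriv, slice_apply]
  simp only [polarMap, Complex.real_smul]

theorem continuous_sphericalMagneticGrad_slice (hA : Continuous A) (u : TestSpace d) (i : Fin d) :
    Continuous fun p : Sph d × Ioi (0 : ℝ) =>
      sphericalMagneticGrad A (slice u p.2).1 p.1 i := by
  simp only [sphericalMagneticGrad_slice]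
  have h1 : Continuous fun p : Sph d × Ioi (0 : ℝ) =>
      fderiv ℝ u (polarMap p) (EuclideanSpace.single i 1) :=
    ((continuous_fderiv_test u).comp continuous_polarMap).clm_apply continuous_const
  have h2 := continuous_radialDeriv u
  have h3 := continuous_test_polarMap u
  have h4 : Continuous fun p : Sph d × Ioi (0 : ℝ) => A p.1 i :=
    (EuclideanSpace.proj i).continuous.comp (hA.comp continuous_fst)
  have h5 : Continuous fun p : Sph d × Ioi (0 : ℝ) => (p.1 : Space d) i :=
    (EuclideanSpace.proj i).continuous.comp (continuous_subtype_val.comp continuous_fst)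
  have h6 : Continuous fun p : Sph d × Ioi (0 : ℝ) => (p.2 : ℝ) :=
    continuous_subtype_val.comp continuous_snd
  exact (((Complex.continuous_ofReal.comp h6).mul h1).sub
    ((Complex.continuous_ofReal.comp (h6.mul h5)).mul h2)).add
    ((continuous_const.mul (Complex.continuous_ofReal.comp h4)).mul h3)

theorem isAnnular_sphericalMagneticGrad_slice (A : Sph d → Space d) (u : TestSpace d)
    (i : Fin d) : IsAnnular fun p : Sph d × Ioi (0 : ℝ) =>
      sphericalMagneticGrad A (slice u p.2).1 p.1 i := by
  obtain ⟨δ, R, hδ, h⟩ := exists_annulus u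
  refine ⟨δ, R, hδ, fun p hp => ?_⟩
  obtain ⟨h1, h2⟩ := h (polarMap p) (by rwa [norm_polarMap])
  simp [sphericalMagneticGrad_slice, radialDeriv, h1, h2]

theorem IsAdmissible.integrable_potential_mul (h : IsAdmissible A a)
    {F : Sph d × Ioi (0 : ℝ) → ℂ} (hF : IsAnnular F) (hc : Continuous F) :
    Integrable (fun p => ((a p.1 : ℝ) : ℂ) * F p)
      ((surfaceMeasure d).prod (radialMeasure d)) := by
  obtain ⟨M, hM0, hM⟩ := h.bounded
  refine (hF.integrable_of_continuous hc).bdd_mul (c := M)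
    (Complex.continuous_ofReal.comp_aestronglyMeasurable h.measurable).comp_fst ?_
  filter_upwards [Measure.quasiMeasurePreserving_fst.ae hM] with p hp
  rwa [Complex.norm_real]

theorem continuous_inv_sq : Continuous fun r : Ioi (0 : ℝ) => (((r : ℝ) ^ 2)⁻¹ : ℝ) :=
  (continuous_subtype_val.pow 2).inv₀ fun r => (pow_pos r.2 2).ne'

theorem integrable_radialDeriv (u v : TestSpace d) :
    Integrable (fun p => conj (radialDeriv u p) * radialDeriv v p)
      ((surfaceMeasure d).prod (radialMeasure d)) :=
  ((isAnnular_radialDeriv v).mul_left _).integrable_of_continuous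
    ((Complex.continuous_conj.comp (continuous_radialDeriv u)).mul (continuous_radialDeriv v))

theorem IsAdmissible.integrable_sphericalDensity_slice (h : IsAdmissible A a) (u v : TestSpace d) :
    Integrable (fun p : Sph d × Ioi (0 : ℝ) => ((((p.2 : ℝ) ^ 2)⁻¹ : ℝ) : ℂ) *
      sphericalDensity A a (slice u p.2).1 (slice v p.2).1 p.1)
      ((surfaceMeasure d).prod (radialMeasure d)) := by
  have hr : Continuous fun p : Sph d × Ioi (0 : ℝ) => ((((p.2 : ℝ) ^ 2)⁻¹ : ℝ) : ℂ) :=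
    Complex.continuous_ofReal.comp (continuous_inv_sq.comp continuous_snd)
  have h1 : ∀ i, Integrable (fun p : Sph d × Ioi (0 : ℝ) => ((((p.2 : ℝ) ^ 2)⁻¹ : ℝ) : ℂ) *
      (conj (sphericalMagneticGrad A (slice u p.2).1 p.1 i) *
        sphericalMagneticGrad A (slice v p.2).1 p.1 i))
      ((surfaceMeasure d).prod (radialMeasure d)) := fun i =>
    (((isAnnular_sphericalMagneticGrad_slice A v i).mul_left _).mul_left _).integrable_of_continuous
      (hr.mul ((Complex.continuous_conj.comp
        (continuous_sphericalMagneticGrad_slice h.continuous u i)).mul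
        (continuous_sphericalMagneticGrad_slice h.continuous v i)))
  have h2 : Integrable (fun p : Sph d × Ioi (0 : ℝ) => ((a p.1 : ℝ) : ℂ) *
      (((((p.2 : ℝ) ^ 2)⁻¹ : ℝ) : ℂ) * (conj (u (polarMap p)) * v (polarMap p))))
      ((surfaceMeasure d).prod (radialMeasure d)) :=
    h.integrable_potential_mul (((isAnnular_test v).mul_left _).mul_left _)
      (hr.mul ((Complex.continuous_conj.comp (continuous_test_polarMap u)).mul
        (continuous_test_polarMap v)))
  refine ((integrable_finsetSum Finset.univ fun i _ => h1 i).add h2).congr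
    (Eventually.of_forall fun p => ?_)
  simp only [Pi.add_apply, sphericalDensity, mul_add, Finset.mul_sum, slice_apply, polarMap]
  congr 1
  ring

/-- The form of the Hamiltonian in polar coordinates. -/
theorem IsAdmissible.hamiltonianForm_eq (h : IsAdmissible A a) (hd : 1 ≤ d) (u v : TestSpace d) :
    hamiltonianForm A a u v =
      ∫ p, conj (radialDeriv u p) * radialDeriv v p ∂((surfaceMeasure d).prod (radialMeasure d)) +
      ∫ r : Ioi (0 : ℝ), ((((r : ℝ) ^ 2)⁻¹ : ℝ) : ℂ) *
        sphericalForm A a (slice u r) (slice v r) ∂(radialMeasure d) := by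
  have h1 : hamiltonianForm A a u v = ∫ x, hamiltonianDensity A a u v x := rfl
  rw [h1, ← integral_polarMap hd]
  simp only [hamiltonianDensity_polarMap h.transversal]
  rw [integral_add (integrable_radialDeriv u v) (h.integrable_sphericalDensity_slice u v),
    integral_prod_symm _ (h.integrable_sphericalDensity_slice u v)]
  congr 1
  refine integral_congr_ae (Eventually.of_forall fun r => ?_)
  simp only [sphericalForm_eq]
  exact integral_const_mul _ _

theorem IsAdmissible.integrable_sphericalForm_slice (h : IsAdmissible A a) (u v : TestSpace d) :
    Integrable (fun r : Ioi (0 : ℝ) => ((((r : ℝ) ^ 2)⁻¹ : ℝ) : ℂ) *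
        sphericalForm A a (slice u r) (slice v r)) (radialMeasure d) := by
  refine (h.integrable_sphericalDensity_slice u v).integral_prod_right.congr
    (Eventually.of_forall fun r => ?_)
  simp only [sphericalForm_eq]
  exact integral_const_mul _ _

theorem slice_add (u v : TestSpace d) (r : ℝ) : slice (u + v) r = slice u r + slice v r := rfl

theorem slice_smul (c : ℂ) (u : TestSpace d) (r : ℝ) : slice (c • u) r = c • slice u r := rfl

theorem differentiableAt_test (u : TestSpace d) (x : Space d) : DifferentiableAt ℝ u x :=
  (u.contDiff.differentiable (by simp)).differentiableAt

theorem radialDeriv_add (u v : TestSpace d) (p : Sph d × Ioi (0 : ℝ)) :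
    radialDeriv (u + v) p = radialDeriv u p + radialDeriv v p := by
  have h : (⇑(u + v) : Space d → ℂ) = ⇑u + ⇑v := rfl
  rw [radialDeriv, h, fderiv_add (differentiableAt_test u _) (differentiableAt_test v _)]
  rfl

theorem radialDeriv_smul (c : ℂ) (u : TestSpace d) (p : Sph d × Ioi (0 : ℝ)) :
    radialDeriv (c • u) p = c * radialDeriv u p := by
  have h : (⇑(c • u) : Space d → ℂ) = c • ⇑u := rfl
  rw [radialDeriv, h, fderiv_const_smul (differentiableAt_test u _)]
  rfl

theorem IsAnnular.integrable_real {F : Sph d × Ioi (0 : ℝ) → ℝ}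
    (hF : IsAnnular fun p => (F p : ℂ)) (hc : Continuous F) :
    Integrable F ((surfaceMeasure d).prod (radialMeasure d)) := by
  simpa using (hF.integrable_of_continuous (Complex.continuous_ofReal.comp hc)).re

theorem conj_mul_self (z : ℂ) : conj z * z = ((‖z‖ ^ 2 : ℝ) : ℂ) := by
  rw [mul_comm, Complex.mul_conj, Complex.normSq_eq_norm_sq]

theorem norm_sq_slice (u : TestSpace d) (r : ℝ) :
    ‖sphereToL2 (slice u r)‖ ^ 2 =
      ∫ θ : Sph d, ‖u (r • (θ : Space d))‖ ^ 2 ∂(surfaceMeasure d) := by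
  have h := inner_sphereToL2_sphereToL2 (slice u r) (slice u r)
  simp only [mul_comm _ (conj _), conj_mul_self] at h
  rw [inner_self_ofReal, integral_complex_ofReal, Complex.ofReal_inj] at h
  exact h

theorem hasDerivAt_ray (u : TestSpace d) (θ : Sph d) (r : ℝ) :
    HasDerivAt (fun r : ℝ => u (r • (θ : Space d)))
      (fderiv ℝ u (r • (θ : Space d)) (θ : Space d)) r := by
  have h1 : HasDerivAt (fun r : ℝ => r • (θ : Space d)) (θ : Space d) r := by
    simpa using (hasDerivAt_id r).smul_const (θ : Space d)
  exact (differentiableAt_test u _).hasFDerivAt.comp_hasDerivAt r h1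

theorem hardy_slice (hd : 2 ≤ d) (u : TestSpace d) :
    0 ≤ ∫ p, (‖radialDeriv u p‖ ^ 2 - (((d : ℝ) - 2) / 2) ^ 2 *
      (((p.2 : ℝ) ^ 2)⁻¹ * ‖u (polarMap p)‖ ^ 2)) ∂((surfaceMeasure d).prod (radialMeasure d)) := by
  obtain ⟨δ, R, hδ, h⟩ := exists_annulus u
  -- Without integrability the integral is zero by convention, which satisfies the inequality too.
  by_cases hi : Integrable (fun p => ‖radialDeriv u p‖ ^ 2 - (((d : ℝ) - 2) / 2) ^ 2 *
      (((p.2 : ℝ) ^ 2)⁻¹ * ‖u (polarMap p)‖ ^ 2)) ((surfaceMeasure d).prod (radialMeasure d))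
  · rw [integral_prod _ hi]
    refine integral_nonneg fun θ => ?_
    have hn : ∀ r : ℝ, -δ < r → r ∉ Icc δ R → ‖r • (θ : Space d)‖ ∉ Icc δ R := by
      intro r hr hr'
      rw [norm_smul, norm_eq_of_mem_sphere, mul_one, Real.norm_eq_abs]
      rcases le_or_gt 0 r with h0 | h0
      · rwa [abs_of_nonneg h0]
      · rw [abs_of_neg h0]
        exact fun h' => absurd h'.1 (by linarith)
    refine hardy_ray hd (v := fun r => u (r • (θ : Space d)))
      (v' := fun r => fderiv ℝ u (r • (θ : Space d)) (θ : Space d)) hδ (hasDerivAt_ray u θ) ?_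
      (fun r hr hr' => (h _ (hn r hr hr')).1) fun r hr hr' => ?_
    · exact ((continuous_fderiv_test u).comp (by fun_prop)).clm_apply continuous_const
    · rw [(h _ (hn r (by linarith) hr')).2, zero_apply]
  · rw [integral_undef hi]

/-- The form of the Hamiltonian is nonnegative, if the spherical form is bounded below by the
constant of Hardy's inequality. -/
theorem IsAdmissible.isPosForm_hamiltonianForm (h : IsAdmissible A a) (hd : 2 ≤ d)
    (hS : ∀ ψ : SmoothSphere d,
      -(((d : ℝ) - 2) / 2) ^ 2 * ‖sphereToL2 ψ‖ ^ 2 ≤ (sphericalForm A a ψ ψ).re) :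
    IsPosForm (hamiltonianForm A a) where
  add_left u v w := by
    simp only [h.hamiltonianForm_eq (by omega : 1 ≤ d), slice_add, radialDeriv_add, map_add, add_mul,
      h.sphericalForm_add_left, mul_add]
    rw [integral_add (integrable_radialDeriv u w) (integrable_radialDeriv v w),
      integral_add (h.integrable_sphericalForm_slice u w) (h.integrable_sphericalForm_slice v w)]
    ring
  smul_left c u v := by
    simp only [h.hamiltonianForm_eq (by omega : 1 ≤ d), slice_smul, radialDeriv_smul, map_mul,
      sphericalForm_smul_left, mul_assoc, mul_left_comm _ (conj c)]
    rw [integral_const_mul, integral_const_mul]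
    ring
  symm u v := by
    simp only [h.hamiltonianForm_eq (by omega : 1 ≤ d), map_add, ← integral_conj, map_mul,
      Complex.conj_conj, Complex.conj_ofReal, sphericalForm_symm]
    simp only [mul_comm (radialDeriv v _)]
  nonneg u := by
    have h1 := h.integrable_sphericalForm_slice u u
    have hr : Continuous fun p : Sph d × Ioi (0 : ℝ) => (((p.2 : ℝ) ^ 2)⁻¹ : ℝ) :=
      continuous_inv_sq.comp continuous_snd
    have i1 : Integrable (fun p => ‖radialDeriv u p‖ ^ 2)
        ((surfaceMeasure d).prod (radialMeasure d)) := by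
      refine IsAnnular.integrable_real ?_ ((continuous_radialDeriv u).norm.pow 2)
      simp only [← conj_mul_self]
      exact (isAnnular_radialDeriv u).mul_left _
    have i2 : Integrable (fun p : Sph d × Ioi (0 : ℝ) =>
        ((p.2 : ℝ) ^ 2)⁻¹ * ‖u (polarMap p)‖ ^ 2)
        ((surfaceMeasure d).prod (radialMeasure d)) := by
      refine IsAnnular.integrable_real ?_ (hr.mul ((continuous_test_polarMap u).norm.pow 2))
      simp only [Complex.ofReal_mul, ← conj_mul_self]
      exact ((isAnnular_test u).mul_left _).mul_left _
    have h2 := hardy_slice hd u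
    rw [integral_sub i1 (i2.const_mul _), integral_const_mul, integral_prod_symm _ i2] at h2
    have h3 : (hamiltonianForm A a u u).re =
        ∫ p, ‖radialDeriv u p‖ ^ 2 ∂((surfaceMeasure d).prod (radialMeasure d)) +
        ∫ r : Ioi (0 : ℝ), ((r : ℝ) ^ 2)⁻¹ *
          (sphericalForm A a (slice u r) (slice u r)).re ∂(radialMeasure d) := by
      rw [h.hamiltonianForm_eq (by omega : 1 ≤ d), Complex.add_re]
      simp only [conj_mul_self]
      rw [integral_complex_ofReal, Complex.ofReal_re]
      congr 1
      have h4 := integral_re h1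
      simp only [RCLike.re_eq_complex_re, Complex.re_ofReal_mul] at h4
      exact h4.symm
    have i3 : Integrable (fun r : Ioi (0 : ℝ) => ((r : ℝ) ^ 2)⁻¹ *
        (sphericalForm A a (slice u r) (slice u r)).re) (radialMeasure d) := by
      have := h1.re
      simpa only [RCLike.re_eq_complex_re, Complex.re_ofReal_mul] using this
    -- The lower bound of the spherical form on each slice costs no more than Hardy's inequality
    -- `h2` provides.
    have h5 : ∫ r : Ioi (0 : ℝ), -(((d : ℝ) - 2) / 2) ^ 2 * ∫ θ : Sph d, ((r : ℝ) ^ 2)⁻¹ *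
        ‖u (polarMap (θ, r))‖ ^ 2 ∂(surfaceMeasure d) ∂(radialMeasure d) ≤
        ∫ r : Ioi (0 : ℝ), ((r : ℝ) ^ 2)⁻¹ *
          (sphericalForm A a (slice u r) (slice u r)).re ∂(radialMeasure d) := by
      refine integral_mono (i2.integral_prod_right.const_mul _) i3 fun r => ?_
      have h6 := hS (slice u r)
      rw [norm_sq_slice] at h6
      have h7 := mul_le_mul_of_nonneg_left h6 (inv_nonneg.2 (sq_nonneg (r : ℝ)))
      refine le_trans (le_of_eq ?_) h7
      rw [integral_const_mul]
      simp only [polarMap]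
      ring
    rw [integral_const_mul] at h5
    rw [h3]
    linarith

theorem testToL2_ae (u : TestSpace d) : testToL2 u =ᵐ[volume] u := MemLp.coeFn_toLp _

/-- The embedding of the test functions into `L²`, as a linear map. -/
def testToL2Lin (d : ℕ) : TestSpace d →ₗ[ℂ] L2Space d where
  toFun := testToL2
  map_add' u v := by
    refine Lp.ext ?_
    filter_upwards [testToL2_ae (u + v), testToL2_ae u, testToL2_ae v,
      Lp.coeFn_add (testToL2 u) (testToL2 v)] with x h1 h2 h3 h4
    rw [h1, h4, Pi.add_apply, h2, h3]
    rfl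
  map_smul' c u := by
    refine Lp.ext ?_
    filter_upwards [testToL2_ae (c • u), testToL2_ae u,
      Lp.coeFn_smul c (testToL2 u)] with x h1 h2 h4
    rw [h1, RingHom.id_apply, h4, Pi.smul_apply, h2]
    rfl

end HamiltonianForm

/-! ## Separated test functions -/

section RadialTest

variable {d : ℕ}

/-- A smooth function which vanishes outside a compact subset of `(0, ∞)`. -/
structure IsRadialTest (h : ℝ → ℝ) : Prop where
  smooth : ContDiff ℝ ∞ h
  support : ∃ δ R : ℝ, 0 < δ ∧ ∀ r, r ∉ Icc δ R → h r = 0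

theorem IsRadialTest.deriv {h : ℝ → ℝ} (hh : IsRadialTest h) : IsRadialTest (deriv h) where
  smooth := (contDiff_infty_iff_deriv.1 hh.smooth).2
  support := by
    obtain ⟨δ, R, hδ, hR⟩ := hh.support
    refine ⟨δ, R, hδ, fun r hr => ?_⟩
    have h1 : h =ᶠ[𝓝 r] fun _ => 0 := by
      filter_upwards [isClosed_Icc.isOpen_compl.mem_nhds hr] with s hs
      exact hR s hs
    rw [h1.deriv_eq, deriv_const]

theorem IsRadialTest.hasDerivAt {h : ℝ → ℝ} (hh : IsRadialTest h) (r : ℝ) :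
    HasDerivAt h (_root_.deriv h r) r :=
  (hh.smooth.differentiable (by simp)).differentiableAt.hasDerivAt

theorem memLp_radial_of_annular {h : ℝ → ℝ} {δ R : ℝ} (hδ : 0 < δ) (hc : ContinuousOn h (Ioi 0))
    (h0 : ∀ r, r ∉ Icc δ R → h r = 0) :
    MemLp (fun r : Ioi (0 : ℝ) => (h r : ℂ)) 2 (radialMeasure d) := by
  have hm : Continuous fun r : Ioi (0 : ℝ) => (h r : ℂ) :=
    Complex.continuous_ofReal.comp (hc.comp_continuous continuous_subtype_val fun r => r.2)
  rw [memLp_two_iff_integrable_sq_norm hm.aestronglyMeasurable]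
  simp only [Complex.norm_real]
  rw [integrable_radial_iff (f := fun r => ‖h r‖ ^ 2)]
  refine integrableOn_of_annular (R := R) hδ ?_ fun r _ hr => by simp [h0 r hr]
  fun_prop

open Classical in
/-- A radial function as an element of `L²`. -/
def radialLp (d : ℕ) (h : ℝ → ℝ) : L2Radial d :=
  if hm : MemLp (fun r : Ioi (0 : ℝ) => (h r : ℂ)) 2 (radialMeasure d) then hm.toLp _ else 0

theorem radialLp_ae {h : ℝ → ℝ}
    (hm : MemLp (fun r : Ioi (0 : ℝ) => (h r : ℂ)) 2 (radialMeasure d)) :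
    radialLp d h =ᵐ[radialMeasure d] fun r => (h r : ℂ) := by
  rw [radialLp, dif_pos hm]
  exact hm.coeFn_toLp

/-- The test function `x ↦ h(|x|) w(x / |x|)`. -/
def tensor {h : ℝ → ℝ} (hh : IsRadialTest h) (w : SmoothSphere d) : TestSpace d where
  toFun x := (h ‖x‖ : ℂ) * homExt w.1 x
  contDiff' := by
    obtain ⟨δ, R, hδ, h0⟩ := hh.support
    refine contDiff_iff_contDiffAt.2 fun x => ?_
    by_cases hx : x = 0
    · have h1 : (fun x : Space d => (h ‖x‖ : ℂ) * homExt w.1 x) =ᶠ[𝓝 x] fun _ => 0 := by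
        rw [hx]
        filter_upwards [Metric.ball_mem_nhds (0 : Space d) hδ] with y hy
        rw [h0 ‖y‖ fun h' => (not_le.2 (mem_ball_zero_iff.1 hy)) h'.1]
        simp
      exact contDiffAt_const.congr_of_eventuallyEq h1
    · refine ContDiffAt.mul ?_ ?_
      · exact Complex.ofRealCLM.contDiff.contDiffAt.comp x
          (hh.smooth.contDiffAt.comp x (contDiffAt_norm ℝ hx))
      · exact w.2.contDiffAt (isOpen_compl_singleton.mem_nhds hx)
  hasCompactSupport' := by
    obtain ⟨δ, R, hδ, h0⟩ := hh.support
    refine HasCompactSupport.intro (isCompact_closedBall (0 : Space d) R) fun x hx => ?_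
    rw [h0 ‖x‖ fun h' => hx (mem_closedBall_zero_iff.2 h'.2)]
    simp
  tsupport_subset' := by
    obtain ⟨δ, R, hδ, h0⟩ := hh.support
    have h1 : tsupport (fun x : Space d => (h ‖x‖ : ℂ) * homExt w.1 x) ⊆ {x | δ ≤ ‖x‖} := by
      refine closure_minimal (fun x hx => ?_) (isClosed_le continuous_const continuous_norm)
      by_contra hc
      refine hx ?_
      simp only
      rw [h0 ‖x‖ fun h' => hc h'.1]
      simp
    intro x hx hx0
    have h2 : δ ≤ ‖x‖ := h1 hx
    rw [mem_singleton_iff.1 hx0, norm_zero] at h2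
    linarith

variable {h : ℝ → ℝ} (hh : IsRadialTest h)

theorem tensor_polarMap (w : SmoothSphere d) (p : Sph d × Ioi (0 : ℝ)) :
    tensor hh w (polarMap p) = (h p.2 : ℂ) * w.1 p.1 := by
  change (h ‖polarMap p‖ : ℂ) * homExt w.1 (polarMap p) = _
  rw [norm_polarMap, homExt_polarMap]

theorem slice_tensor (w : SmoothSphere d) (r : Ioi (0 : ℝ)) :
    slice (tensor hh w) r = (h r : ℂ) • w :=
  Subtype.ext (funext fun θ => tensor_polarMap hh w (θ, r))

theorem radialDeriv_tensor (w : SmoothSphere d) (p : Sph d × Ioi (0 : ℝ)) :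
    radialDeriv (tensor hh w) p = ((deriv h p.2 : ℝ) : ℂ) * w.1 p.1 := by
  have h1 := hasDerivAt_ray (tensor hh w) p.1 p.2
  have h2 : HasDerivAt (fun r : ℝ => (h r : ℂ) * w.1 p.1) (((deriv h p.2 : ℝ) : ℂ) * w.1 p.1) p.2 :=
    (hh.hasDerivAt p.2).ofReal_comp.mul_const _
  refine h1.unique (h2.congr_of_eventuallyEq ?_)
  filter_upwards [Ioi_mem_nhds p.2.2] with r hr
  exact tensor_polarMap hh w (p.1, ⟨r, hr⟩)

theorem tensor_sub (w w' : SmoothSphere d) :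
    tensor hh w - tensor hh w' = tensor hh (w - w') := by
  refine TestFunction.ext fun x => ?_
  change (h ‖x‖ : ℂ) * homExt w.1 x - (h ‖x‖ : ℂ) * homExt w'.1 x =
    (h ‖x‖ : ℂ) * homExt (w - w').1 x
  have h1 : (w - w').1 = w.1 + (-1 : ℂ) • w'.1 := by
    rw [neg_one_smul, ← sub_eq_add_neg]
    rfl
  rw [h1, homExt_add, homExt_smul]
  simp only [Pi.add_apply, Pi.smul_apply, smul_eq_mul]
  ring

theorem memLp_radialTest (hh : IsRadialTest h) :
    MemLp (fun r : Ioi (0 : ℝ) => (h r : ℂ)) 2 (radialMeasure d) := by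
  obtain ⟨δ, R, hδ, h0⟩ := hh.support
  exact memLp_radial_of_annular hδ hh.smooth.continuous.continuousOn h0

theorem testToL2_tensor (hd : 1 ≤ d) (w : SmoothSphere d) :
    testToL2 (tensor hh w) = separated (radialLp d h) (sphereToL2 w) := by
  refine Lp.ext (ae_of_ae_polarMap hd ?_)
  filter_upwards [ae_polarMap hd (testToL2_ae (tensor hh w)), separated_ae hd (radialLp d h)
    (sphereToL2 w), Measure.quasiMeasurePreserving_snd.ae (radialLp_ae (memLp_radialTest hh)),
    Measure.quasiMeasurePreserving_fst.ae (sphereToL2_ae w)] with p h1 h2 h3 h4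
  rw [h1, h2, h3, h4, tensor_polarMap]

theorem inner_testToL2_separated (hd : 1 ≤ d) (u : TestSpace d) (g : L2Radial d)
    (ψ : L2Sphere d) :
    inner ℂ (testToL2 u) (separated g ψ) =
      ∫ r : Ioi (0 : ℝ), g r * inner ℂ (sphereToL2 (slice u r)) ψ ∂(radialMeasure d) := by
  rw [← inner_conj_symm, inner_separated hd, inner_conj_symm, inner_L2_eq]
  refine integral_congr_ae ?_
  filter_upwards [coeff_ae ψ (testToL2 u), ae_ae_swap (ae_polarMap hd (testToL2_ae u))]
    with r h1 h2
  rw [h1, inner_sphereToL2, ← integral_conj]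
  congr 1
  refine integral_congr_ae ?_
  filter_upwards [h2] with θ hθ
  rw [hθ, map_mul, Complex.conj_conj, mul_comm]
  rfl

/-- Integration by parts on a ray. -/
theorem radial_ibp (hd : 1 ≤ d) {v v' : ℝ → ℂ} (hv : ∀ r, HasDerivAt v (v' r) r)
    (hv' : Continuous v') (hh : IsRadialTest h) :
    ∫ r : Ioi (0 : ℝ), v' r * (h r : ℂ) ∂(radialMeasure d) =
      ∫ r : Ioi (0 : ℝ), v r * ((-deriv h r - ((d : ℝ) - 1) * h r / r : ℝ) : ℂ)
        ∂(radialMeasure d) := by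
  obtain ⟨n, rfl⟩ : ∃ n, d = n + 1 := ⟨d - 1, by omega⟩
  obtain ⟨δ, R, hδ, h0⟩ := hh.support
  obtain ⟨δ', R', hδ', h0'⟩ := hh.deriv.support
  have hvc : Continuous v := continuous_iff_continuousAt.2 fun r => (hv r).continuousAt
  have hhc := hh.smooth.continuous
  have hhc' := hh.deriv.smooth.continuous
  -- Here `n = d - 1`, and differentiating the weight `r^n` produces the term `(d - 1) h / r`.
  set G : ℝ → ℂ := fun r => (r ^ n) • (v r * (h r : ℂ)) with hGdef
  set G' : ℝ → ℂ := fun r => (r ^ n) • (v' r * (h r : ℂ) + v r * ((deriv h r : ℝ) : ℂ)) +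
    (n * r ^ (n - 1)) • (v r * (h r : ℂ))
  have hG : ∀ r, 0 < r → HasDerivAt G (G' r) r := fun r _ =>
    (hasDerivAt_pow n r).smul ((hv r).mul (hh.hasDerivAt r).ofReal_comp)
  have hGc : Continuous G' := by fun_prop
  have h1 := integral_deriv_of_annular (R := R) hδ hG hGc.continuousOn
    (fun r _ hr => by simp [G, h0 r hr])
  rw [integral_radial (d := n + 1) fun r => v' r * (h r : ℂ),
    integral_radial (d := n + 1) fun r => v r *
      ((-deriv h r - (((n + 1 : ℕ) : ℝ) - 1) * h r / r : ℝ) : ℂ), ← sub_eq_zero]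
  rw [← integral_sub, ← h1]
  · refine setIntegral_congr_fun measurableSet_Ioi fun r hr => ?_
    have hr0 : (r : ℝ) ≠ 0 := ne_of_gt hr
    have hr1 : (r : ℂ) ≠ 0 := Complex.ofReal_ne_zero.2 hr0
    simp only [G', nat_mul_pow_pred n hr0, Complex.real_smul, Nat.add_sub_cancel]
    push_cast
    field_simp
    ring
  · refine integrableOn_of_annular (R := R) hδ (by fun_prop) fun r _ hr => by simp [h0 r hr]
  · refine integrableOn_of_annular (δ := min δ δ') (R := max R R') (lt_min hδ hδ') ?_
      fun r _ hr => ?_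
    · have : ContinuousOn (fun r : ℝ => (r : ℂ)⁻¹) (Ioi 0) :=
        Complex.continuous_ofReal.continuousOn.inv₀ fun r hr =>
          Complex.ofReal_ne_zero.2 (ne_of_gt hr)
      simp only [div_eq_mul_inv]
      push_cast
      fun_prop
    · have h2 : r ∉ Icc δ R := fun h' => hr (Icc_subset_Icc (min_le_left _ _) (le_max_left _ _) h')
      have h3 : r ∉ Icc δ' R' :=
        fun h' => hr (Icc_subset_Icc (min_le_right _ _) (le_max_right _ _) h')
      simp [h0 r h2, h0' r h3]

end RadialTest

/-! ### Radial test functions times spherical eigenfunctions in the operator domain. -/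

section SeparatedGraph

variable {d : ℕ} {A : Sph d → Space d} {a : Sph d → ℝ} {h : ℝ → ℝ}

theorem deriv_eq_zero_of_annular {δ R : ℝ} (h0 : ∀ r, r ∉ Icc δ R → h r = 0) (r : ℝ)
    (hr : r ∉ Icc δ R) : deriv h r = 0 := by
  have h1 : h =ᶠ[𝓝 r] fun _ => 0 := by
    filter_upwards [isClosed_Icc.isOpen_compl.mem_nhds hr] with s hs
    exact h0 s hs
  rw [h1.deriv_eq, deriv_const]

/-- The radial part of the Laplacian, with the sign reversed. -/
def radialLaplace (d : ℕ) (h : ℝ → ℝ) (r : ℝ) : ℝ :=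
  -deriv (deriv h) r - ((d : ℝ) - 1) * deriv h r / r

/-- The centrifugal term `lam h / r²`. -/
def centrifugal (lam : ℝ) (h : ℝ → ℝ) (r : ℝ) : ℝ := lam * (r ^ 2)⁻¹ * h r

/-- The radial part of the Hamiltonian on the component with angular eigenvalue `lam`. -/
def radialOp (d : ℕ) (lam : ℝ) (h : ℝ → ℝ) (r : ℝ) : ℝ :=
  radialLaplace d h r + centrifugal lam h r

theorem continuousOn_radialLaplace (hh : IsRadialTest h) :
    ContinuousOn (radialLaplace d h) (Ioi 0) := by
  have h1 := hh.deriv.deriv.smooth.continuous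
  have h2 := hh.deriv.smooth.continuous
  have h3 : ContinuousOn (fun r : ℝ => r⁻¹) (Ioi 0) :=
    continuousOn_id.inv₀ fun r hr => ne_of_gt hr
  unfold radialLaplace
  simp only [div_eq_mul_inv]
  fun_prop

theorem radialLaplace_eq_zero {δ R : ℝ} (h0 : ∀ r, r ∉ Icc δ R → h r = 0) (r : ℝ)
    (hr : r ∉ Icc δ R) : radialLaplace d h r = 0 := by
  have h1 := deriv_eq_zero_of_annular h0
  simp [radialLaplace, h1 r hr, deriv_eq_zero_of_annular h1 r hr]

theorem memLp_radialLaplace (hh : IsRadialTest h) :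
    MemLp (fun r : Ioi (0 : ℝ) => (radialLaplace d h r : ℂ)) 2 (radialMeasure d) := by
  obtain ⟨δ, R, hδ, h0⟩ := hh.support
  exact memLp_radial_of_annular hδ (continuousOn_radialLaplace hh) (radialLaplace_eq_zero h0)

theorem memLp_centrifugal (lam : ℝ) (hh : IsRadialTest h) :
    MemLp (fun r : Ioi (0 : ℝ) => (centrifugal lam h r : ℂ)) 2 (radialMeasure d) := by
  obtain ⟨δ, R, hδ, h0⟩ := hh.support
  refine memLp_radial_of_annular (h := centrifugal lam h) (R := R) hδ ?_
    fun r hr => by simp [centrifugal, h0 r hr]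
  have h1 := hh.smooth.continuous
  have h3 : ContinuousOn (fun r : ℝ => (r ^ 2)⁻¹) (Ioi 0) :=
    (continuousOn_pow 2).inv₀ fun r hr => (pow_pos hr 2).ne'
  unfold centrifugal
  fun_prop

theorem radialLp_radialOp (lam : ℝ) (hh : IsRadialTest h) :
    radialLp d (radialOp d lam h) =
      radialLp d (radialLaplace d h) + radialLp d (centrifugal lam h) := by
  have h1 := memLp_radialLaplace (d := d) hh
  have h2 := memLp_centrifugal (d := d) lam hh
  have h3 : MemLp (fun r : Ioi (0 : ℝ) => (radialOp d lam h r : ℂ)) 2 (radialMeasure d) := by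
    exact (memLp_congr_ae (Eventually.of_forall fun r => by simp [radialOp])).1 (h1.add h2)
  refine Lp.ext ?_
  filter_upwards [radialLp_ae h1, radialLp_ae h2, radialLp_ae h3, Lp.coeFn_add
    (radialLp d (radialLaplace d h)) (radialLp d (centrifugal lam h))] with r e1 e2 e3 e4
  rw [e3, e4, Pi.add_apply, e1, e2, radialOp, Complex.ofReal_add]

/-- The radial part of the form, after integration by parts. -/
theorem integral_radialDeriv_tensor (hd : 1 ≤ d) (hh : IsRadialTest h) (u : TestSpace d)
    (w : SmoothSphere d) :
    ∫ p, conj (radialDeriv u p) * radialDeriv (tensor hh w) p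
      ∂((surfaceMeasure d).prod (radialMeasure d)) =
    inner ℂ (testToL2 u) (separated (radialLp d (radialLaplace d h)) (sphereToL2 w)) := by
  obtain ⟨δ, R, hδ, h0⟩ := hh.support
  rw [integral_prod _ (integrable_radialDeriv u (tensor hh w))]
  have h1 : ∀ θ : Sph d, ∫ r, conj (radialDeriv u (θ, r)) * radialDeriv (tensor hh w) (θ, r)
      ∂(radialMeasure d) = ∫ r : Ioi (0 : ℝ), (radialLaplace d h r : ℂ) *
        (w.1 θ * conj (u (polarMap (θ, r)))) ∂(radialMeasure d) := by
    intro θ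
    have h2 := radial_ibp hd (v := fun r => conj (u (r • (θ : Space d))))
      (v' := fun r => conj (fderiv ℝ u (r • (θ : Space d)) (θ : Space d)))
      (fun r => (hasDerivAt_ray u θ r).star)
      (Complex.continuous_conj.comp (((continuous_fderiv_test u).comp
        (by fun_prop)).clm_apply continuous_const)) hh.deriv
    calc _ = (∫ r : Ioi (0 : ℝ), conj (fderiv ℝ u ((r : ℝ) • (θ : Space d)) (θ : Space d)) *
          ((deriv h r : ℝ) : ℂ) ∂(radialMeasure d)) * w.1 θ := by
          rw [← integral_mul_const]
          refine integral_congr_ae (Eventually.of_forall fun r => ?_)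
          simp only [radialDeriv_tensor]
          simp only [radialDeriv, polarMap]
          ring
      _ = _ := by
          rw [h2, ← integral_mul_const]
          refine integral_congr_ae (Eventually.of_forall fun r => ?_)
          simp only [radialLaplace, polarMap]
          ring
  simp only [h1]
  have hc : Continuous fun p : Sph d × Ioi (0 : ℝ) => (radialLaplace d h p.2 : ℂ) *
      (w.1 p.1 * conj (u (polarMap p))) := by
    refine Continuous.mul ?_ (((SmoothSphere.continuous w).comp continuous_fst).mul
      (Complex.continuous_conj.comp (continuous_test_polarMap u)))
    exact Complex.continuous_ofReal.comp ((continuousOn_radialLaplace hh).comp_continuous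
      (continuous_subtype_val.comp continuous_snd) fun p => p.2.2)
  have hann : IsAnnular fun p : Sph d × Ioi (0 : ℝ) => (radialLaplace d h p.2 : ℂ) *
      (w.1 p.1 * conj (u (polarMap p))) :=
    ⟨δ, R, hδ, fun p hp => by simp [radialLaplace_eq_zero h0 _ hp]⟩
  have hi := hann.integrable_of_continuous hc
  rw [integral_integral_swap (f := fun (θ : Sph d) (r : Ioi (0 : ℝ)) =>
    (radialLaplace d h r : ℂ) * (w.1 θ * conj (u (polarMap (θ, r))))) hi,
    inner_testToL2_separated hd]
  refine integral_congr_ae ?_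
  filter_upwards [radialLp_ae (memLp_radialLaplace (d := d) hh)] with r hr
  rw [hr, inner_sphereToL2_sphereToL2, ← integral_const_mul]
  rfl

/-- A sequence that converges in the energy norm is bounded there, so Cauchy–Schwarz bounds the form
against it uniformly in `n`. The square root of the energy is weakened to `1` plus the energy, since
the energy itself is integrable over the slices of a test function with weight `r⁻²`. -/
theorem IsAdmissible.sphericalForm_bound (ha : IsAdmissible A a) {w : ℕ → SmoothSphere d}
    {φ : L2Sphere d} (h1 : Tendsto (fun n => sphereToL2 (w n)) atTop (𝓝 φ))
    (h2 : Tendsto (fun nm : ℕ × ℕ => sphericalForm A a (w nm.1 - w nm.2) (w nm.1 - w nm.2)) atTop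
      (𝓝 0)) :
    ∃ C c : ℝ, ∀ ψ n, ‖sphericalForm A a ψ (w n)‖ ≤
      C * (1 + ((sphericalForm A a ψ ψ).re + c * ‖sphereToL2 ψ‖ ^ 2)) := by
  obtain ⟨c, hc, hq⟩ := ha.exists_isPosForm 0
  obtain ⟨C, hC0, hC⟩ := hq.bounded_of_cauchy (sphereToL2Lin d) h1
    (by simpa using tendsto_form_shift (j := sphereToL2Lin d) h1 h2 1 c)
  obtain ⟨B, hB⟩ := h1.norm.bddAbove_range
  refine ⟨C + c * B, c + 1, fun ψ n => ?_⟩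
  have hBn : ‖sphereToL2 (w n)‖ ≤ B := hB ⟨n, rfl⟩
  have hB0 : 0 ≤ B := (norm_nonneg _).trans hBn
  have h3 : (sphericalForm A a ψ ψ + c * inner ℂ (sphereToL2Lin d ψ) (sphereToL2Lin d ψ)).re =
      (sphericalForm A a ψ ψ).re + c * ‖sphereToL2 ψ‖ ^ 2 := by
    rw [inner_self_ofReal, ← Complex.ofReal_mul, Complex.add_re, Complex.ofReal_re]
    rfl
  have h4 := hq.nonneg ψ
  have h5 := hC ψ n
  rw [h3] at h4 h5
  change _ ≤ C * √((sphericalForm A a ψ ψ).re + c * ‖sphereToL2 ψ‖ ^ 2 + ‖sphereToL2 ψ‖ ^ 2) at h5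
  set S := (sphericalForm A a ψ ψ).re + c * ‖sphereToL2 ψ‖ ^ 2 + ‖sphereToL2 ψ‖ ^ 2 with hS
  have hS0 : 0 ≤ S := by positivity
  have h6 : √S ≤ 1 + S := by
    rw [Real.sqrt_le_left (by linarith)]
    nlinarith
  have h7 : ‖sphereToL2 ψ‖ ≤ √S := Real.le_sqrt_of_sq_le (by rw [hS]; linarith)
  have h8 : ‖(c : ℂ) * inner ℂ (sphereToL2Lin d ψ) (sphereToL2Lin d (w n))‖ ≤ c * (√S * B) := by
    rw [norm_mul, Complex.norm_real, Real.norm_of_nonneg hc]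
    refine mul_le_mul_of_nonneg_left ((norm_inner_le_norm _ _).trans ?_) hc
    exact mul_le_mul h7 hBn (norm_nonneg _) (Real.sqrt_nonneg _)
  have h9 : sphericalForm A a ψ (w n) = (sphericalForm A a ψ (w n) +
      c * inner ℂ (sphereToL2Lin d ψ) (sphereToL2Lin d (w n))) -
      c * inner ℂ (sphereToL2Lin d ψ) (sphereToL2Lin d (w n)) := by ring
  rw [h9]
  refine (norm_sub_le _ _).trans ((add_le_add h5 h8).trans ?_)
  have h10 : (sphericalForm A a ψ ψ).re + (c + 1) * ‖sphereToL2 ψ‖ ^ 2 = S := by rw [hS]; ring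
  rw [h10]
  calc C * √S + c * (√S * B) = (C + c * B) * √S := by ring
    _ ≤ _ := by gcongr

theorem integrable_norm_sq_slice (u : TestSpace d) :
    Integrable (fun r : Ioi (0 : ℝ) => ((r : ℝ) ^ 2)⁻¹ * ‖sphereToL2 (slice u r)‖ ^ 2)
      (radialMeasure d) := by
  have hr : Continuous fun p : Sph d × Ioi (0 : ℝ) => (((p.2 : ℝ) ^ 2)⁻¹ : ℝ) :=
    continuous_inv_sq.comp continuous_snd
  have i2 : Integrable (fun p : Sph d × Ioi (0 : ℝ) =>
      ((p.2 : ℝ) ^ 2)⁻¹ * ‖u (polarMap p)‖ ^ 2)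
      ((surfaceMeasure d).prod (radialMeasure d)) := by
    refine IsAnnular.integrable_real ?_ (hr.mul ((continuous_test_polarMap u).norm.pow 2))
    simp only [Complex.ofReal_mul, ← conj_mul_self]
    exact ((isAnnular_test u).mul_left _).mul_left _
  refine i2.integral_prod_right.congr (Eventually.of_forall fun r => ?_)
  simp only [norm_sq_slice]
  exact integral_const_mul _ _

/-- The angular part of the form converges along a sequence which realizes an eigenfunction. -/
theorem IsAdmissible.tendsto_angular (ha : IsAdmissible A a) (hd : 1 ≤ d) (hh : IsRadialTest h)
    {lam : ℝ} {w : ℕ → SmoothSphere d} {φ : L2Sphere d}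
    (h1 : Tendsto (fun n => sphereToL2 (w n)) atTop (𝓝 φ))
    (h2 : Tendsto (fun nm : ℕ × ℕ => sphericalForm A a (w nm.1 - w nm.2) (w nm.1 - w nm.2)) atTop
      (𝓝 0))
    (h3 : ∀ ψ, Tendsto (fun n => sphericalForm A a ψ (w n)) atTop
      (𝓝 (inner ℂ (sphereToL2 ψ) ((lam : ℂ) • φ)))) (u : TestSpace d) :
    Tendsto (fun n => ∫ r : Ioi (0 : ℝ), ((((r : ℝ) ^ 2)⁻¹ : ℝ) : ℂ) *
        sphericalForm A a (slice u r) (slice (tensor hh (w n)) r) ∂(radialMeasure d)) atTop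
      (𝓝 (inner ℂ (testToL2 u) (separated (radialLp d (centrifugal lam h)) φ))) := by
  obtain ⟨C, c, hC⟩ := ha.sphericalForm_bound h1 h2
  obtain ⟨δ, R, hδ, h0⟩ := hh.support
  obtain ⟨B, hB⟩ := hh.smooth.continuous.bounded_above_of_compact_support
    (HasCompactSupport.intro isCompact_Icc h0)
  rw [inner_testToL2_separated hd]
  have hlim : ∫ r : Ioi (0 : ℝ), radialLp d (centrifugal lam h) r *
      inner ℂ (sphereToL2 (slice u r)) φ ∂(radialMeasure d) =
      ∫ r : Ioi (0 : ℝ), ((((r : ℝ) ^ 2)⁻¹ * h r : ℝ) : ℂ) *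
        inner ℂ (sphereToL2 (slice u r)) ((lam : ℂ) • φ) ∂(radialMeasure d) := by
    refine integral_congr_ae ?_
    filter_upwards [radialLp_ae (memLp_centrifugal (d := d) lam hh)] with r hr
    rw [hr, inner_smul_right, centrifugal]
    push_cast
    ring
  rw [hlim]
  have hform : ∀ n (r : Ioi (0 : ℝ)), ((((r : ℝ) ^ 2)⁻¹ : ℝ) : ℂ) *
      sphericalForm A a (slice u r) (slice (tensor hh (w n)) r) =
      ((((r : ℝ) ^ 2)⁻¹ * h r : ℝ) : ℂ) * sphericalForm A a (slice u r) (w n) := by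
    intro n r
    rw [slice_tensor, sphericalForm_smul_right]
    push_cast
    ring
  -- The majorant comes from `sphericalForm_bound`: its constant term is controlled by the compact
  -- support of `h`, its energy term by the bound `B` for `h`.
  refine tendsto_integral_of_dominated_convergence (fun r : Ioi (0 : ℝ) =>
    |C| * (((r : ℝ) ^ 2)⁻¹ * |h r| + B * |((r : ℝ) ^ 2)⁻¹ * (sphericalForm A a (slice u r)
      (slice u r)).re + c * (((r : ℝ) ^ 2)⁻¹ * ‖sphereToL2 (slice u r)‖ ^ 2)|)) (fun n => ?_) ?_
      (fun n => ?_) ?_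
  · exact (ha.integrable_sphericalForm_slice u (tensor hh (w n))).aestronglyMeasurable
  · refine Integrable.const_mul (Integrable.add ?_ (Integrable.const_mul (Integrable.abs
      (Integrable.add ?_ ((integrable_norm_sq_slice u).const_mul c))) _)) _
    · rw [integrable_radial_iff (f := fun r => (r ^ 2)⁻¹ * |h r|)]
      refine integrableOn_of_annular (R := R) hδ ?_ fun r _ hr => by simp [h0 r hr]
      have e1 := hh.smooth.continuous
      have e3 : ContinuousOn (fun r : ℝ => (r ^ 2)⁻¹) (Ioi 0) :=
        (continuousOn_pow 2).inv₀ fun r hr => (pow_pos hr 2).ne'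
      fun_prop
    · have := (ha.integrable_sphericalForm_slice u u).re
      simpa only [RCLike.re_eq_complex_re, Complex.re_ofReal_mul] using this
  · refine Eventually.of_forall fun r => ?_
    rw [hform, norm_mul, Complex.norm_real, norm_mul, Real.norm_of_nonneg
      (inv_nonneg.2 (sq_nonneg (r : ℝ))), Real.norm_eq_abs]
    have hr0 : 0 ≤ ((r : ℝ) ^ 2)⁻¹ := inv_nonneg.2 (sq_nonneg (r : ℝ))
    set T := (sphericalForm A a (slice u r) (slice u r)).re + c * ‖sphereToL2 (slice u r)‖ ^ 2
      with hT
    have e1 : ‖sphericalForm A a (slice u r) (w n)‖ ≤ |C| * (1 + |T|) := by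
      refine (hC _ _).trans ((le_abs_self _).trans ?_)
      rw [abs_mul]
      gcongr
      exact (abs_add_le _ _).trans (by rw [abs_one])
    have e2 : ((r : ℝ) ^ 2)⁻¹ * (sphericalForm A a (slice u r) (slice u r)).re +
        c * (((r : ℝ) ^ 2)⁻¹ * ‖sphereToL2 (slice u r)‖ ^ 2) = ((r : ℝ) ^ 2)⁻¹ * T := by
      rw [hT]; ring
    have e3 : |h r| ≤ B := hB r
    rw [e2, abs_mul, abs_of_nonneg hr0]
    calc ((r : ℝ) ^ 2)⁻¹ * |h r| * ‖sphericalForm A a (slice u r) (w n)‖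
        ≤ ((r : ℝ) ^ 2)⁻¹ * |h r| * (|C| * (1 + |T|)) := by gcongr
      _ = |C| * (((r : ℝ) ^ 2)⁻¹ * |h r| + |h r| * (((r : ℝ) ^ 2)⁻¹ * |T|)) := by ring
      _ ≤ _ := by gcongr
  · refine Eventually.of_forall fun r => ?_
    simp only [hform]
    exact (h3 _).const_mul _

/-- A radial test function times an angular eigenfunction belongs to the domain of the
Hamiltonian. -/
theorem IsAdmissible.mem_formGraph_separated (ha : IsAdmissible A a) (hd : 1 ≤ d)
    (hh : IsRadialTest h) {lam : ℝ} {φ : L2Sphere d}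
    (hφ : (φ, (lam : ℂ) • φ) ∈ formGraph sphereToL2 (sphericalForm A a)) :
    (separated (radialLp d h) φ, separated (radialLp d (radialOp d lam h)) φ) ∈
      formGraph testToL2 (hamiltonianForm A a) := by
  obtain ⟨w, h1, h2, h3⟩ := hφ
  -- The approximating sequence is the one for `φ` on the sphere, multiplied by the fixed radial
  -- factor.
  refine ⟨fun n => tensor hh (w n), ?_, ?_, fun u => ?_⟩
  · simp only [testToL2_tensor hh hd]
    exact (separatedRight hd (radialLp d h)).continuous.tendsto _ |>.comp h1
  · simp only [tensor_sub, ha.hamiltonianForm_eq hd]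
    -- On tensors with fixed `h` the form is a fixed linear combination of the spherical form and
    -- the inner product, so the Cauchy property carries over from the sphere.
    have e1 : ∀ v : SmoothSphere d, ∫ p, conj (radialDeriv (tensor hh v) p) *
        radialDeriv (tensor hh v) p ∂((surfaceMeasure d).prod (radialMeasure d)) =
        (∫ r : Ioi (0 : ℝ), (((deriv h r) ^ 2 : ℝ) : ℂ) ∂(radialMeasure d)) *
          inner ℂ (sphereToL2 v) (sphereToL2 v) := by
      intro v
      rw [inner_sphereToL2_sphereToL2, mul_comm, ← integral_prod_mul]
      refine integral_congr_ae (Eventually.of_forall fun p => ?_)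
      simp only [radialDeriv_tensor, map_mul, Complex.conj_ofReal]
      push_cast
      ring
    have e2 : ∀ v : SmoothSphere d, ∫ r : Ioi (0 : ℝ), ((((r : ℝ) ^ 2)⁻¹ : ℝ) : ℂ) *
        sphericalForm A a (slice (tensor hh v) r) (slice (tensor hh v) r) ∂(radialMeasure d) =
        (∫ r : Ioi (0 : ℝ), ((((r : ℝ) ^ 2)⁻¹ * (h r) ^ 2 : ℝ) : ℂ) ∂(radialMeasure d)) *
          sphericalForm A a v v := by
      intro v
      rw [← integral_mul_const]
      refine integral_congr_ae (Eventually.of_forall fun r => ?_)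
      simp only [slice_tensor, sphericalForm_smul_right, sphericalForm_smul_left,
        Complex.conj_ofReal]
      push_cast
      ring
    simp only [e1, e2]
    have e3 := tendsto_form_shift (j := sphereToL2Lin d) h1 h2
      (∫ r : Ioi (0 : ℝ), ((((r : ℝ) ^ 2)⁻¹ * (h r) ^ 2 : ℝ) : ℂ) ∂(radialMeasure d))
      (∫ r : Ioi (0 : ℝ), (((deriv h r) ^ 2 : ℝ) : ℂ) ∂(radialMeasure d))
    refine e3.congr fun nm => ?_
    rw [add_comm]
    rfl
  · simp only [ha.hamiltonianForm_eq hd, integral_radialDeriv_tensor hd]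
    rw [radialLp_radialOp lam hh, separated_add hd, inner_add_right]
    refine Tendsto.add ?_ (ha.tendsto_angular hd hh h1 h2 h3 u)
    exact Tendsto.inner tendsto_const_nhds
      (((separatedRight hd (radialLp d (radialLaplace d h))).continuous.tendsto _).comp h1)

end SeparatedGraph

/-! ## Gaussians in the domain of the Hamiltonian -/

section Gauss

variable {d : ℕ} {ν s : ℝ}

/-- The logarithmic derivative of `gaussFun d ν s`. -/
def gaussLogDeriv (d : ℕ) (ν s r : ℝ) : ℝ := (ν - ((d : ℝ) - 2) / 2) / r - s * r

theorem hasDerivAt_gaussFun (d : ℕ) (ν s : ℝ) {r : ℝ} (hr : 0 < r) :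
    HasDerivAt (gaussFun d ν s) (gaussLogDeriv d ν s r * gaussFun d ν s r) r := by
  have h1 := Real.hasDerivAt_rpow_const (p := ν - ((d : ℝ) - 2) / 2) (Or.inl hr.ne')
  have h2 : HasDerivAt (fun r : ℝ => -(s * r ^ 2 / 2)) (-(s * r)) r := by
    refine (((hasDerivAt_pow 2 r).const_mul s).div_const 2).neg.congr_deriv ?_
    norm_num
    ring
  refine (h1.mul h2.exp).congr_deriv ?_
  rw [Real.rpow_sub_one hr.ne', gaussLogDeriv, gaussFun]
  ring

theorem hasDerivAt_gaussLogDeriv (d : ℕ) (ν s : ℝ) {r : ℝ} (hr : 0 < r) :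
    HasDerivAt (gaussLogDeriv d ν s) (-((ν - ((d : ℝ) - 2) / 2) / r ^ 2) - s) r := by
  have h1 := ((hasDerivAt_inv hr.ne').const_mul (ν - ((d : ℝ) - 2) / 2)).sub
    ((hasDerivAt_id r).const_mul s)
  refine (h1.congr_deriv ?_).congr_of_eventuallyEq (Eventually.of_forall fun x => ?_)
  · field_simp
  · simp [gaussLogDeriv, div_eq_mul_inv]

theorem continuousOn_gaussFun (d : ℕ) (ν s : ℝ) : ContinuousOn (gaussFun d ν s) (Ioi 0) :=
  fun _ hr => (hasDerivAt_gaussFun d ν s hr).continuousAt.continuousWithinAt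

theorem continuousOn_gaussLogDeriv (d : ℕ) (ν s : ℝ) :
    ContinuousOn (gaussLogDeriv d ν s) (Ioi 0) :=
  fun _ hr => (hasDerivAt_gaussLogDeriv d ν s hr).continuousAt.continuousWithinAt

theorem contDiffAt_gaussFun (d : ℕ) (ν s : ℝ) {r : ℝ} (hr : 0 < r) :
    ContDiffAt ℝ ∞ (gaussFun d ν s) r := by
  unfold gaussFun
  have h1 : ContDiffAt ℝ ∞ (fun r : ℝ => r ^ (ν - ((d : ℝ) - 2) / 2)) r :=
    Real.contDiffAt_rpow_const_of_ne hr.ne'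
  exact h1.mul (by fun_prop)

variable {c : ℝ → ℝ}

theorem hasDerivAt_mul_gauss (hc : ContDiff ℝ ∞ c) {r : ℝ} (hr : 0 < r) :
    HasDerivAt (fun r => c r * gaussFun d ν s r)
      (deriv c r * gaussFun d ν s r + c r * (gaussLogDeriv d ν s r * gaussFun d ν s r)) r :=
  (hc.differentiable (by simp)).differentiableAt.hasDerivAt.mul (hasDerivAt_gaussFun d ν s hr)

theorem deriv_deriv_mul_gauss (hc : ContDiff ℝ ∞ c) {r : ℝ} (hr : 0 < r) :
    deriv (deriv fun r => c r * gaussFun d ν s r) r =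
      deriv (deriv c) r * gaussFun d ν s r +
        2 * (deriv c r * (gaussLogDeriv d ν s r * gaussFun d ν s r)) +
        c r * ((-((ν - ((d : ℝ) - 2) / 2) / r ^ 2) - s + gaussLogDeriv d ν s r ^ 2) *
          gaussFun d ν s r) := by
  have h1 : (deriv fun r => c r * gaussFun d ν s r) =ᶠ[𝓝 r] fun r =>
      deriv c r * gaussFun d ν s r + c r * (gaussLogDeriv d ν s r * gaussFun d ν s r) := by
    filter_upwards [Ioi_mem_nhds hr] with x hx
    exact (hasDerivAt_mul_gauss hc hx).deriv
  have hc' := (contDiff_infty_iff_deriv.1 hc).2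
  have e1 := (hc.differentiable (by simp)).differentiableAt.hasDerivAt (x := r)
  have e2 := (hc'.differentiable (by simp)).differentiableAt.hasDerivAt (x := r)
  have e3 := hasDerivAt_gaussFun d ν s hr
  have e4 := hasDerivAt_gaussLogDeriv d ν s hr
  have e5 : HasDerivAt (fun r => deriv c r * gaussFun d ν s r +
      c r * (gaussLogDeriv d ν s r * gaussFun d ν s r)) _ r :=
    (e2.mul e3).add (e1.mul (e4.mul e3))
  rw [h1.deriv_eq, e5.deriv]
  ring

/-- The action of the radial operator on a truncated Gaussian. -/
theorem radialOp_mul_gauss (hc : ContDiff ℝ ∞ c) {r : ℝ} (hr : 0 < r) :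
    radialOp d (ν ^ 2 - (((d : ℝ) - 2) / 2) ^ 2) (fun r => c r * gaussFun d ν s r) r =
      (c r * (2 * (ν + 1) * s + -s ^ 2 * r ^ 2) - 2 * deriv c r * gaussLogDeriv d ν s r -
        deriv (deriv c) r - ((d : ℝ) - 1) * deriv c r / r) * gaussFun d ν s r := by
  -- The `r⁻²` terms cancel because the angular eigenvalue is `ν² - ((d-2)/2)²`.
  rw [radialOp, radialLaplace, centrifugal, deriv_deriv_mul_gauss hc hr,
    (hasDerivAt_mul_gauss hc hr).deriv, gaussLogDeriv]
  field_simp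
  ring

/-- A localization formula: subtracting the total derivative of `r^{d-1} c c' g²` removes `c''` and
the terms linear in `c'`, so the cutoff costs only `c'² g²`. -/
theorem integral_mul_radialOp (hd : 1 ≤ d) (hc : ContDiff ℝ ∞ c) {δ R : ℝ} (hδ : 0 < δ)
    (h0 : ∀ r, r ∉ Icc δ R → c r = 0) :
    ∫ r : Ioi (0 : ℝ), radialOp d (ν ^ 2 - (((d : ℝ) - 2) / 2) ^ 2)
        (fun r => c r * gaussFun d ν s r) r * (c r * gaussFun d ν s r) ∂(radialMeasure d) =
      ∫ r : Ioi (0 : ℝ), (c r ^ 2 * (2 * (ν + 1) * s + -s ^ 2 * (r : ℝ) ^ 2) + deriv c r ^ 2) *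
        gaussFun d ν s r ^ 2 ∂(radialMeasure d) := by
  obtain ⟨n, rfl⟩ : ∃ n, d = n + 1 := ⟨d - 1, by omega⟩
  have hcc := hc.continuous
  have hc' := (contDiff_infty_iff_deriv.1 hc).2
  have hcc' := hc'.continuous
  have hcc'' := (contDiff_infty_iff_deriv.1 hc').2.continuous
  have hg := continuousOn_gaussFun (n + 1) ν s
  have hl := continuousOn_gaussLogDeriv (n + 1) ν s
  have h0' := deriv_eq_zero_of_annular h0
  set g := gaussFun (n + 1) ν s
  set l := gaussLogDeriv (n + 1) ν s
  set G : ℝ → ℝ := fun r => r ^ n * (c r * deriv c r * (g r * g r))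
  set G' : ℝ → ℝ := fun r => n * r ^ (n - 1) * (c r * deriv c r * (g r * g r)) +
    r ^ n * ((deriv c r * deriv c r + c r * deriv (deriv c) r) * (g r * g r) +
      c r * deriv c r * (l r * g r * g r + g r * (l r * g r)))
  have hG : ∀ r, 0 < r → HasDerivAt G (G' r) r := fun r hr =>
    (hasDerivAt_pow n r).mul
      (((hc.differentiable (by simp)).differentiableAt.hasDerivAt.mul
        (hc'.differentiable (by simp)).differentiableAt.hasDerivAt).mul
        ((hasDerivAt_gaussFun (n + 1) ν s hr).mul (hasDerivAt_gaussFun (n + 1) ν s hr)))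
  have hGc : ContinuousOn G' (Ioi 0) := by fun_prop
  have h1 := integral_deriv_of_annular (R := R) hδ hG hGc
    (fun r _ hr => by simp [G, h0 r hr])
  have hi1 : IntegrableOn G' (Ioi 0) := integrableOn_of_annular (R := R) hδ hGc
    fun r _ hr => by simp [G', h0 r hr, h0' r hr]
  have hi2 : IntegrableOn (fun r : ℝ => r ^ n • ((c r ^ 2 * (2 * (ν + 1) * s + -s ^ 2 * r ^ 2) +
      deriv c r ^ 2) * g r ^ 2)) (Ioi 0) := by
    refine integrableOn_of_annular (R := R) hδ (by fun_prop) fun r _ hr => by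
      simp [h0 r hr, h0' r hr]
  rw [integral_radial (d := n + 1) fun r => radialOp (n + 1) (ν ^ 2 - (((↑(n + 1) : ℝ) - 2) / 2) ^ 2)
      (fun r => c r * g r) r * (c r * g r), integral_radial (d := n + 1) fun r =>
      (c r ^ 2 * (2 * (ν + 1) * s + -s ^ 2 * r ^ 2) + deriv c r ^ 2) * g r ^ 2]
  simp only [Nat.add_sub_cancel]
  have h2 := integral_sub hi2 hi1
  rw [h1, sub_zero] at h2
  rw [← h2]
  refine setIntegral_congr_fun measurableSet_Ioi fun r hr => ?_
  have hr0 : (r : ℝ) ≠ 0 := ne_of_gt hr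
  simp only [G', nat_mul_pow_pred n hr0]
  rw [radialOp_mul_gauss hc hr]
  simp only [smul_eq_mul, g, l]
  push_cast
  field_simp
  ring

/-- A smooth cutoff function which equals one on `[2 / N, N]` and vanishes outside
`[1 / N, N + 1]`. -/
def radialCutoff (N r : ℝ) : ℝ :=
  Real.smoothTransition (N * r - 1) * Real.smoothTransition (N + 1 - r)

theorem contDiff_radialCutoff (N : ℝ) : ContDiff ℝ ∞ (radialCutoff N) := by
  unfold radialCutoff
  exact (Real.smoothTransition.contDiff.comp (by fun_prop)).mul
    (Real.smoothTransition.contDiff.comp (by fun_prop))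

theorem radialCutoff_nonneg (N r : ℝ) : 0 ≤ radialCutoff N r :=
  mul_nonneg (Real.smoothTransition.nonneg _) (Real.smoothTransition.nonneg _)

theorem radialCutoff_le_one (N r : ℝ) : radialCutoff N r ≤ 1 :=
  mul_le_one₀ (Real.smoothTransition.le_one _) (Real.smoothTransition.nonneg _)
    (Real.smoothTransition.le_one _)

theorem radialCutoff_eq_zero {N : ℝ} (hN : 0 < N) (r : ℝ) (hr : r ∉ Icc (1 / N) (N + 1)) :
    radialCutoff N r = 0 := by
  rw [radialCutoff]
  by_cases h : 1 / N ≤ r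
  · have h2 : N + 1 < r := by
      by_contra hc
      exact hr ⟨h, not_lt.1 hc⟩
    rw [Real.smoothTransition.zero_of_nonpos (x := N + 1 - r) (by linarith), mul_zero]
  · have h2 : r * N < 1 := by rwa [not_le, lt_div_iff₀ hN] at h
    rw [Real.smoothTransition.zero_of_nonpos (x := N * r - 1) (by linarith), zero_mul]

theorem radialCutoff_eq_one {N r : ℝ} (h1 : 2 ≤ N * r) (h2 : r ≤ N) : radialCutoff N r = 1 := by
  rw [radialCutoff, Real.smoothTransition.one_of_one_le (by linarith),
    Real.smoothTransition.one_of_one_le (by linarith), one_mul]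

theorem deriv_smoothTransition_eq_zero {x : ℝ} (hx : x ∉ Icc (0 : ℝ) 1) :
    deriv Real.smoothTransition x = 0 := by
  by_cases h : 0 ≤ x
  · have h1 : Real.smoothTransition =ᶠ[𝓝 x] fun _ => 1 := by
      filter_upwards [Ioi_mem_nhds (not_le.1 fun h' => hx ⟨h, h'⟩)] with y hy
      exact Real.smoothTransition.one_of_one_le (le_of_lt hy)
    rw [h1.deriv_eq, deriv_const]
  · have h1 : Real.smoothTransition =ᶠ[𝓝 x] fun _ => 0 := by
      filter_upwards [Iio_mem_nhds (not_le.1 h)] with y hy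
      exact Real.smoothTransition.zero_of_nonpos (le_of_lt hy)
    rw [h1.deriv_eq, deriv_const]

theorem exists_deriv_smoothTransition_le :
    ∃ M : ℝ, 0 ≤ M ∧ ∀ x, |deriv Real.smoothTransition x| ≤ M := by
  have h1 : Continuous (deriv Real.smoothTransition) :=
    (Real.smoothTransition.contDiff (n := 1)).continuous_deriv le_rfl
  obtain ⟨M, hM⟩ := h1.bounded_above_of_compact_support
    (HasCompactSupport.intro isCompact_Icc fun x hx => deriv_smoothTransition_eq_zero hx)
  exact ⟨M, (norm_nonneg _).trans (hM 0), hM⟩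

/-- The outer transition has slope at most `M`. The inner one has slope at most `N M` and is active
only for `1 ≤ N r ≤ 2`; the factors `2` come from `(x + y)² ≤ 2x² + 2y²`. -/
theorem deriv_radialCutoff_sq_le {M : ℝ} (hM : ∀ x, |deriv Real.smoothTransition x| ≤ M)
    (N r : ℝ) : deriv (radialCutoff N) r ^ 2 ≤
      2 * M ^ 2 + 2 * N ^ 2 * M ^ 2 * {r | N * r - 1 ∈ Icc (0 : ℝ) 1}.indicator (fun _ => 1) r := by
  have hs : ∀ x, HasDerivAt Real.smoothTransition (deriv Real.smoothTransition x) x := fun x =>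
    ((Real.smoothTransition.contDiff (n := 1)).differentiable one_ne_zero).differentiableAt.hasDerivAt
  have h1 : HasDerivAt (radialCutoff N) (deriv Real.smoothTransition (N * r - 1) * N *
      Real.smoothTransition (N + 1 - r) + Real.smoothTransition (N * r - 1) *
      (deriv Real.smoothTransition (N + 1 - r) * -1)) r := by
    refine HasDerivAt.mul ?_ ?_
    · refine (hs _).comp r ?_
      simpa using ((hasDerivAt_id r).const_mul N).sub_const 1
    · refine (hs _).comp r ?_
      simpa using (hasDerivAt_id r).const_sub (N + 1)
  rw [h1.deriv]
  set x := deriv Real.smoothTransition (N * r - 1) with hx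
  set y := deriv Real.smoothTransition (N + 1 - r)
  set a := Real.smoothTransition (N + 1 - r)
  set b := Real.smoothTransition (N * r - 1)
  have ha : a ^ 2 ≤ 1 := pow_le_one₀ (Real.smoothTransition.nonneg _) (Real.smoothTransition.le_one _)
  have hb : b ^ 2 ≤ 1 := pow_le_one₀ (Real.smoothTransition.nonneg _) (Real.smoothTransition.le_one _)
  have hy2 : y ^ 2 ≤ M ^ 2 := sq_le_sq' (by linarith [(abs_le.1 (hM (N + 1 - r))).1])
    (abs_le.1 (hM (N + 1 - r))).2
  have hx2 : x ^ 2 ≤ M ^ 2 * {r | N * r - 1 ∈ Icc (0 : ℝ) 1}.indicator (fun _ => 1) r := by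
    by_cases h : N * r - 1 ∈ Icc (0 : ℝ) 1
    · rw [indicator_of_mem (show r ∈ {r | N * r - 1 ∈ Icc (0 : ℝ) 1} from h), mul_one]
      exact sq_le_sq' (by linarith [(abs_le.1 (hM (N * r - 1))).1])
        (abs_le.1 (hM (N * r - 1))).2
    · rw [indicator_of_notMem (show r ∉ {r | N * r - 1 ∈ Icc (0 : ℝ) 1} from h), hx,
        deriv_smoothTransition_eq_zero h]
      simp
  have e1 : (x * N * a + b * (y * -1)) ^ 2 ≤ 2 * (N ^ 2 * (x ^ 2 * a ^ 2)) + 2 * (b ^ 2 * y ^ 2) := by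
    nlinarith [sq_nonneg (x * N * a + b * y)]
  have e2 : x ^ 2 * a ^ 2 ≤ M ^ 2 * {r | N * r - 1 ∈ Icc (0 : ℝ) 1}.indicator (fun _ => 1) r :=
    (mul_le_of_le_one_right (sq_nonneg x) ha).trans hx2
  have e3 : b ^ 2 * y ^ 2 ≤ M ^ 2 := (mul_le_of_le_one_left (sq_nonneg y) hb).trans hy2
  have e4 := mul_le_mul_of_nonneg_left e2 (sq_nonneg N)
  linarith

end Gauss

/-! ### Gaussians times spherical eigenfunctions in the operator domain. -/

section GaussGraph

variable {d : ℕ} {ν s : ℝ} {A : Sph d → Space d} {a : Sph d → ℝ}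

/-- The truncated Gaussian. -/
def cutGauss (d : ℕ) (ν s N r : ℝ) : ℝ := radialCutoff N r * gaussFun d ν s r

theorem isRadialTest_cutGauss (d : ℕ) (ν s : ℝ) {N : ℝ} (hN : 0 < N) :
    IsRadialTest (cutGauss d ν s N) where
  smooth := by
    refine contDiff_iff_contDiffAt.2 fun r => ?_
    rcases lt_or_ge 0 r with hr | hr
    · exact (contDiff_radialCutoff N).contDiffAt.mul (contDiffAt_gaussFun d ν s hr)
    · have h1 : cutGauss d ν s N =ᶠ[𝓝 r] fun _ => 0 := by
        have h2 : r < 1 / N := lt_of_le_of_lt hr (by positivity)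
        filter_upwards [Iio_mem_nhds h2] with x hx
        rw [cutGauss, radialCutoff_eq_zero hN x fun h' => (not_le.2 hx) h'.1, zero_mul]
      exact contDiffAt_const.congr_of_eventuallyEq h1
  support := ⟨1 / N, N + 1, by positivity, fun r hr => by
    rw [cutGauss, radialCutoff_eq_zero hN r hr, zero_mul]⟩

/-- The weighted square is `r^{2ν} · r · exp(-s r²)`. One factor `r ≤ 2/N` supplies the smallness
and `r ≤ 2` bounds the rest, which suffices even for `ν = 0`. -/
theorem gaussFun_sq_le (hν : 0 ≤ ν) (hs : 0 < s) {N r : ℝ} (hN : 1 ≤ N) (hr : 0 < r)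
    (h2 : N * r ≤ 2) (hd : 1 ≤ d) :
    r ^ (d - 1) * gaussFun d ν s r ^ 2 ≤ 2 ^ (2 * ν) * (2 / N) := by
  have hr2 : r ≤ 2 / N := by rw [le_div_iff₀ (by linarith)]; linarith
  have hr3 : r ≤ 2 := by nlinarith
  rw [pow_two, gaussFun_mul d ν s s hr]
  have h1 : r ^ (d - 1) * (r ^ (2 * ν - ((d : ℝ) - 2)) * Real.exp (-((s + s) * r ^ 2 / 2))) =
      r ^ (2 * ν) * r * Real.exp (-((s + s) * r ^ 2 / 2)) := by
    rw [← mul_assoc, ← Real.rpow_natCast, ← Real.rpow_add hr, ← Real.rpow_add_one hr.ne']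
    congr 2
    push_cast [Nat.cast_sub hd]
    ring
  rw [h1]
  have h3 : Real.exp (-((s + s) * r ^ 2 / 2)) ≤ 1 := Real.exp_le_one_iff.2 (by
    have : 0 ≤ (s + s) * r ^ 2 / 2 := by positivity
    linarith)
  refine (mul_le_of_le_one_right (by positivity) h3).trans ?_
  gcongr

/-- The inner cutoff contributes `N²` times a density of order `1/N`, over an interval of length
`1/N`. This is bounded uniformly in `N`, which is all that the weak limit in
`IsAdmissible.mem_formGraph_gauss` requires. -/
theorem exists_energy_bound (hd : 1 ≤ d) (hν : 0 ≤ ν) (hs : 0 < s) :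
    ∃ B : ℝ, ∀ N : ℝ, 1 ≤ N → ∫ r : Ioi (0 : ℝ),
      (radialCutoff N r ^ 2 * (2 * (ν + 1) * s + -s ^ 2 * (r : ℝ) ^ 2) +
        deriv (radialCutoff N) r ^ 2) * gaussFun d ν s r ^ 2 ∂(radialMeasure d) ≤ B := by
  obtain ⟨M, hM0, hM⟩ := exists_deriv_smoothTransition_le
  -- The constant collects the terms independent of `N`: the positive part of the operator symbol
  -- and the outer cutoff. The term with `-s² r²` is discarded.
  set K : ℝ := 2 * (ν + 1) * s + 2 * M ^ 2 with hK
  have hi : IntegrableOn (fun r : ℝ => r ^ (d - 1) • (K * gaussFun d ν s r ^ 2)) (Ioi 0) := by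
    rw [← integrable_radial_iff (f := fun r => K * gaussFun d ν s r ^ 2)]
    refine ((integrable_pow_gauss hd hν 0 hs hs).const_mul K).congr
      (Eventually.of_forall fun r => ?_)
    simp only [pow_zero, one_mul]
    ring
  refine ⟨(∫ r in Ioi (0 : ℝ), r ^ (d - 1) • (K * gaussFun d ν s r ^ 2)) +
    2 * M ^ 2 * (2 ^ (2 * ν) * 2), fun N hN => ?_⟩
  have hN0 : 0 < N := by linarith
  set S : Set ℝ := {r | N * r - 1 ∈ Icc (0 : ℝ) 1} with hS
  have hSI : S = Icc (1 / N) (2 / N) := by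
    ext r
    simp only [hS, mem_ofPred_eq, mem_Icc, div_le_iff₀ hN0, le_div_iff₀ hN0]
    constructor <;> rintro ⟨h1, h2⟩ <;> constructor <;> linarith
  -- A pointwise bound for the inner cutoff's contribution on `S`; multiplied by the length `1/N` of
  -- `S` it no longer depends on `N`.
  set Q : ℝ := 2 * N ^ 2 * M ^ 2 * (2 ^ (2 * ν) * (2 / N)) with hQ
  have hj : IntegrableOn (S.indicator fun _ => Q) (Ioi 0) := by
    refine Integrable.integrableOn ?_
    rw [hSI, integrable_indicator_iff measurableSet_Icc]
    exact integrableOn_const (by simp)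
  have hjv : ∫ r in Ioi (0 : ℝ), S.indicator (fun _ => Q) r ≤ 2 * M ^ 2 * (2 ^ (2 * ν) * 2) := by
    have h1 : ∫ r in Ioi (0 : ℝ), S.indicator (fun _ => Q) r = (1 / N) * Q := by
      have h3 : Ioi (0 : ℝ) ∩ S = Icc (1 / N) (2 / N) := by
        rw [hSI]
        refine inter_eq_right.2 fun r hr => ?_
        have : (0 : ℝ) < 1 / N := by positivity
        exact lt_of_lt_of_le this hr.1
      rw [setIntegral_indicator (by rw [hSI]; exact measurableSet_Icc), h3, setIntegral_const,
        Measure.real, Real.volume_Icc, ENNReal.toReal_ofReal, smul_eq_mul]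
      · ring
      · rw [← sub_div]; norm_num; exact hN0.le
    rw [h1, hQ]
    apply le_of_eq
    field_simp
  rw [integral_radial (d := d) fun r => (radialCutoff N r ^ 2 * (2 * (ν + 1) * s + -s ^ 2 * r ^ 2) +
        deriv (radialCutoff N) r ^ 2) * gaussFun d ν s r ^ 2]
  refine le_trans ?_ (add_le_add_right hjv _)
  rw [← integral_add hi hj]
  have hcc := (contDiff_radialCutoff N).continuous
  have hcc' := (contDiff_infty_iff_deriv.1 (contDiff_radialCutoff N)).2.continuous
  have hg := continuousOn_gaussFun d ν s
  have h0 := radialCutoff_eq_zero hN0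
  refine setIntegral_mono_on (integrableOn_of_annular (δ := 1 / N) (R := N + 1) (by positivity)
    (by fun_prop) fun r _ hr => by simp [h0 r hr, deriv_eq_zero_of_annular h0 r hr])
    (hi.add hj) measurableSet_Ioi fun r hr => ?_
  have hr0 : (0 : ℝ) < r := hr
  have e1 : radialCutoff N r ^ 2 * (2 * (ν + 1) * s + -s ^ 2 * r ^ 2) ≤ 2 * (ν + 1) * s := by
    have : radialCutoff N r ^ 2 ≤ 1 :=
      pow_le_one₀ (radialCutoff_nonneg N r) (radialCutoff_le_one N r)
    have h5 : 0 ≤ 2 * (ν + 1) * s := by positivity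
    have h6 : 0 ≤ radialCutoff N r ^ 2 * (s ^ 2 * r ^ 2) := by positivity
    nlinarith
  have e2 := deriv_radialCutoff_sq_le hM N r
  have e3 : 0 ≤ r ^ (d - 1) * gaussFun d ν s r ^ 2 := by positivity
  have e4 : 2 * N ^ 2 * M ^ 2 * S.indicator (fun _ => 1) r *
      (r ^ (d - 1) * gaussFun d ν s r ^ 2) ≤ S.indicator (fun _ => Q) r := by
    by_cases hrS : r ∈ S
    · rw [indicator_of_mem hrS, indicator_of_mem hrS, mul_one, hQ]
      refine mul_le_mul_of_nonneg_left ?_ (by positivity)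
      exact gaussFun_sq_le hν hs hN hr0 (by have := hrS.2; linarith) hd
    · rw [indicator_of_notMem hrS, indicator_of_notMem hrS]
      simp
  calc r ^ (d - 1) • ((radialCutoff N r ^ 2 * (2 * (ν + 1) * s + -s ^ 2 * r ^ 2) +
        deriv (radialCutoff N) r ^ 2) * gaussFun d ν s r ^ 2)
      = (radialCutoff N r ^ 2 * (2 * (ν + 1) * s + -s ^ 2 * r ^ 2) +
        deriv (radialCutoff N) r ^ 2) * (r ^ (d - 1) * gaussFun d ν s r ^ 2) := by
        rw [smul_eq_mul]; ring
    _ ≤ (2 * (ν + 1) * s + (2 * M ^ 2 + 2 * N ^ 2 * M ^ 2 * S.indicator (fun _ => 1) r)) *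
        (r ^ (d - 1) * gaussFun d ν s r ^ 2) :=
        mul_le_mul_of_nonneg_right (add_le_add e1 e2) e3
    _ = r ^ (d - 1) • (K * gaussFun d ν s r ^ 2) + 2 * N ^ 2 * M ^ 2 * S.indicator (fun _ => 1) r *
      (r ^ (d - 1) * gaussFun d ν s r ^ 2) := by
        rw [hK, smul_eq_mul]; ring
    _ ≤ _ := add_le_add_right e4 _

theorem memLp_radialOp (lam : ℝ) {h : ℝ → ℝ} (hh : IsRadialTest h) :
    MemLp (fun r : Ioi (0 : ℝ) => (radialOp d lam h r : ℂ)) 2 (radialMeasure d) :=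
  (memLp_congr_ae (Eventually.of_forall fun r => by simp [radialOp])).1
    ((memLp_radialLaplace (d := d) hh).add (memLp_centrifugal (d := d) lam hh))

theorem inner_radialLp {h k : ℝ → ℝ}
    (hh : MemLp (fun r : Ioi (0 : ℝ) => (h r : ℂ)) 2 (radialMeasure d))
    (hk : MemLp (fun r : Ioi (0 : ℝ) => (k r : ℂ)) 2 (radialMeasure d)) :
    inner ℂ (radialLp d h) (radialLp d k) =
      ((∫ r : Ioi (0 : ℝ), k r * h r ∂(radialMeasure d) : ℝ) : ℂ) := by
  rw [inner_L2_eq, ← integral_complex_ofReal]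
  refine integral_congr_ae ?_
  filter_upwards [radialLp_ae hh, radialLp_ae hk] with r h1 h2
  rw [h1, h2, Complex.conj_ofReal, Complex.ofReal_mul]

theorem gaussLp_one_ae (hd : 1 ≤ d) (hν : 0 ≤ ν) (hs : 0 < s) :
    gaussLp d ν 1 0 s =ᵐ[radialMeasure d] fun r => (gaussFun d ν s r : ℂ) := by
  simpa using gaussLp_ae hd hν 1 0 hs

/-- Equality on a neighbourhood carries over to derivatives, and uniformity on `[δ, R]` lets one
index serve the whole support of a test function. -/
theorem radialCutoff_eventually_eq {δ : ℝ} (hδ : 0 < δ) (R : ℝ) :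
    ∀ᶠ n : ℕ in atTop, ∀ r ∈ Icc δ R,
      radialCutoff ((n : ℝ) + 1) =ᶠ[𝓝 r] fun _ => 1 := by
  have h1 : Tendsto (fun n : ℕ => (n : ℝ) + 1) atTop atTop :=
    tendsto_atTop_add_const_right _ _ tendsto_natCast_atTop_atTop
  filter_upwards [h1.eventually_gt_atTop (2 / δ), h1.eventually_gt_atTop R] with n hn1 hn2 r hr
  have h2 : 2 / ((n : ℝ) + 1) < r := by
    refine lt_of_lt_of_le ?_ hr.1
    rw [div_lt_iff₀ (by positivity)]
    rwa [div_lt_iff₀ hδ, mul_comm] at hn1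
  filter_upwards [Ioo_mem_nhds h2 (hr.2.trans_lt hn2)] with x hx
  refine radialCutoff_eq_one ?_ hx.2.le
  have := hx.1.le
  rw [div_le_iff₀ (by positivity)] at this
  linarith

theorem radialOp_cutGauss {N r : ℝ} (hr : 0 < r) (h : radialCutoff N =ᶠ[𝓝 r] fun _ => 1) :
    radialOp d (ν ^ 2 - (((d : ℝ) - 2) / 2) ^ 2) (cutGauss d ν s N) r =
      (2 * (ν + 1) * s + -s ^ 2 * r ^ 2) * gaussFun d ν s r := by
  have h1 := radialOp_mul_gauss (d := d) (ν := ν) (s := s) (contDiff_radialCutoff N) hr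
  have h2 : deriv (radialCutoff N) =ᶠ[𝓝 r] fun _ => 0 := by
    have := h.deriv
    simpa using this
  rw [h2.deriv_eq, deriv_const, h2.self_of_nhds, h.self_of_nhds] at h1
  refine Eq.trans h1 ?_
  ring

theorem slice_eq_zero {u : TestSpace d} {δ R : ℝ}
    (h : ∀ x, ‖x‖ ∉ Icc δ R → u x = 0 ∧ fderiv ℝ u x = 0) {r : Ioi (0 : ℝ)}
    (hr : (r : ℝ) ∉ Icc δ R) : sphereToL2 (slice u r) = 0 := by
  have h1 : slice u r = 0 := Subtype.ext (funext fun θ => by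
    have := (h (polarMap (θ, r)) (by rwa [norm_polarMap])).1
    exact this)
  rw [h1]
  exact map_zero (sphereToL2Lin d)

/-- A Gaussian times an angular eigenfunction belongs to the domain of the Hamiltonian. -/
theorem IsAdmissible.mem_formGraph_gauss (ha : IsAdmissible A a) (hd : 1 ≤ d)
    (hq : IsPosForm (hamiltonianForm A a)) (hν : 0 ≤ ν) (hs : 0 < s) {φ : L2Sphere d}
    (hφ : (φ, ((ν ^ 2 - (((d : ℝ) - 2) / 2) ^ 2 : ℝ) : ℂ) • φ) ∈
      formGraph sphereToL2 (sphericalForm A a)) :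
    (separated (gaussLp d ν 1 0 s) φ, separated (gaussLp d ν (2 * (ν + 1) * s) (-s ^ 2) s) φ) ∈
      formGraph testToL2 (hamiltonianForm A a) := by
  set lam : ℝ := ν ^ 2 - (((d : ℝ) - 2) / 2) ^ 2 with hlam
  have hN : ∀ n : ℕ, (0 : ℝ) < (n : ℝ) + 1 := fun n => by positivity
  set h : ℕ → ℝ → ℝ := fun n => cutGauss d ν s ((n : ℝ) + 1) with hh_def
  have hh : ∀ n, IsRadialTest (h n) := fun n => isRadialTest_cutGauss d ν s (hN n)
  obtain ⟨B, hB⟩ := exists_energy_bound hd hν hs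
  have hgi : Integrable (fun r : Ioi (0 : ℝ) => gaussFun d ν s r * gaussFun d ν s r)
      (radialMeasure d) := by
    simpa using integrable_pow_gauss hd hν 0 hs hs
  have hle : ∀ n r, |h n r| ≤ |gaussFun d ν s r| := fun n r => by
    simp only [h, cutGauss, abs_mul]
    refine mul_le_of_le_one_left (abs_nonneg _) ?_
    rw [abs_of_nonneg (radialCutoff_nonneg _ _)]
    exact radialCutoff_le_one _ _
  -- The truncated Gaussians are radial test functions; it remains to bound their energies, to pass
  -- to the weak limit, and to test the images against smooth functions.
  refine hq.mem_formGraph_of_bounded (testToL2Lin d)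
    (un := fun n => separated (radialLp d (h n)) φ)
    (fn := fun n => separated (radialLp d (radialOp d lam (h n))) φ)
    (B := ‖φ‖ ^ 2 * ((∫ r : Ioi (0 : ℝ), gaussFun d ν s r * gaussFun d ν s r
      ∂(radialMeasure d)) + B))
    (fun n => ha.mem_formGraph_separated hd (hh n) hφ) (fun n => ?_) (fun v => ?_) fun u => ?_
  · rw [inner_add_right, inner_separated_separated hd, inner_separated_separated hd, ← mul_add,
      inner_radialLp (memLp_radialTest (hh n)) (memLp_radialTest (hh n)),
      inner_radialLp (memLp_radialTest (hh n)) (memLp_radialOp lam (hh n)), inner_self_ofReal,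
      ← Complex.ofReal_add, ← Complex.ofReal_mul, Complex.ofReal_re]
    refine mul_le_mul_of_nonneg_left (add_le_add ?_ ?_) (sq_nonneg _)
    · refine integral_mono_of_nonneg (Eventually.of_forall fun r => mul_self_nonneg _) hgi
        (Eventually.of_forall fun r => ?_)
      simpa only [abs_mul_abs_self] using mul_self_le_mul_self (abs_nonneg _) (hle n r)
    · have h1 := integral_mul_radialOp (ν := ν) (s := s) hd
        (contDiff_radialCutoff ((n : ℝ) + 1)) (δ := 1 / ((n : ℝ) + 1)) (by positivity)
        (radialCutoff_eq_zero (hN n))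
      refine le_of_eq_of_le h1 (hB _ (by
        have : (0 : ℝ) ≤ n := Nat.cast_nonneg n
        linarith))
  · have h1 : ∀ g, inner ℂ v (separated g φ) = ∫ r, g r * conj (coeff φ v r)
        ∂(radialMeasure d) := fun g => by
      rw [← inner_conj_symm, inner_separated hd, inner_conj_symm, inner_L2_eq]
    rw [h1]
    simp only [h1]
    have hdom : Integrable (fun r => gaussLp d ν 1 0 s r * conj (coeff φ v r))
        (radialMeasure d) := integrable_inner_L2 (coeff φ v) (gaussLp d ν 1 0 s)
    refine tendsto_integral_of_dominated_convergence _
      (fun n => (integrable_inner_L2 (coeff φ v) (radialLp d (h n))).aestronglyMeasurable)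
      hdom.norm (fun n => ?_) ?_
    · filter_upwards [gaussLp_one_ae hd hν hs, radialLp_ae (memLp_radialTest (d := d) (hh n))]
        with r h2 h3
      rw [h2, h3, norm_mul, norm_mul, Complex.norm_real, Complex.norm_real]
      exact mul_le_mul_of_nonneg_right (hle n r) (norm_nonneg _)
    · have h2 : ∀ᵐ r ∂(radialMeasure d), ∀ n, radialLp d (h n) r = (h n r : ℂ) :=
        ae_all_iff.2 fun n => radialLp_ae (memLp_radialTest (hh n))
      filter_upwards [gaussLp_one_ae hd hν hs, h2] with r h3 h4
      refine tendsto_const_nhds.congr' ?_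
      filter_upwards [radialCutoff_eventually_eq r.2 (r : ℝ)] with n hn
      have h5 := (hn r ⟨le_rfl, le_rfl⟩).self_of_nhds
      rw [h3, h4]
      simp only [h, cutGauss]
      rw [h5, one_mul]
  -- For large `n` the cutoff is `1` near the support of `u`, so the pairing is eventually constant
  -- in `n`.
  · obtain ⟨δ, R, hδ, hu⟩ := exists_annulus u
    refine tendsto_const_nhds.congr' ?_
    filter_upwards [radialCutoff_eventually_eq hδ R] with n hn
    change inner ℂ (testToL2 u) _ = inner ℂ (testToL2 u) _
    rw [inner_testToL2_separated hd, inner_testToL2_separated hd]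
    refine integral_congr_ae ?_
    filter_upwards [gaussLp_ae hd hν (2 * (ν + 1) * s) (-s ^ 2) hs,
      radialLp_ae (memLp_radialOp (d := d) lam (hh n))] with r h3 h4
    by_cases hr : (r : ℝ) ∈ Icc δ R
    · rw [h3, h4]
      congr 2
      exact (radialOp_cutGauss r.2 (hn r hr)).symm
    · rw [slice_eq_zero hu hr, inner_zero_left, mul_zero, mul_zero]

end GaussGraph

/-! ## Diagonalization of the Hamiltonian -/

section Diagonalization

variable {d : ℕ}

theorem gaussLp_add (hd : 1 ≤ d) {ν : ℝ} (hν : 0 ≤ ν) (b c b' c' : ℝ) {s : ℝ} (hs : 0 < s) :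
    gaussLp d ν b c s + gaussLp d ν b' c' s = gaussLp d ν (b + b') (c + c') s := by
  refine Lp.ext ?_
  filter_upwards [gaussLp_ae hd hν b c hs, gaussLp_ae hd hν b' c' hs,
    gaussLp_ae hd hν (b + b') (c + c') hs,
    Lp.coeFn_add (gaussLp d ν b c s) (gaussLp d ν b' c' s)] with r h1 h2 h3 h4
  rw [h3, h4, Pi.add_apply, h1, h2]
  push_cast
  ring

/-- The function `t ↦ (1 + |t|)⁻¹`. -/
def absResolvent (t : ℝ) : ℂ := (((1 + |t|)⁻¹ : ℝ) : ℂ)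

theorem isBddMeas_absResolvent : IsBddMeas absResolvent :=
  isBddMeas_resolvent (m := fun t : ℝ => |t|) continuous_abs.measurable fun t => abs_nonneg t

theorem mulOp_absResolvent_gaussImage (hd : 1 ≤ d) {ν : ℝ} (hν : 0 ≤ ν) {s : ℝ} (hs : 0 < s) :
    mulOp (radialMeasure d) (fun r => absResolvent ((r : ℝ) ^ 2)) (gaussImage d ν 1 1 s) =
      gaussImage d ν 1 0 s := by
  rw [gaussImage, gaussImage, map_smul]
  congr 1
  have hs' : 0 < s⁻¹ := inv_pos.2 hs
  refine Lp.ext ?_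
  filter_upwards [(isBddMeas_radial isBddMeas_absResolvent).mulOp_ae (gaussLp d ν 1 1 s⁻¹),
    gaussLp_ae hd hν 1 1 hs', gaussLp_ae hd hν 1 0 hs'] with r h1 h2 h3
  have h4 : (1 + (r : ℝ) ^ 2) ≠ 0 := by positivity
  rw [h1, h2, h3, absResolvent, abs_of_nonneg (sq_nonneg _), ← Complex.ofReal_mul]
  congr 1
  field_simp
  ring

variable {ι : Type*} [Countable ι] {φ : HilbertBasis ι ℂ (L2Sphere d)} {ν : ι → ℝ}

/-- The family of images of `((1 + r²) e^{-t r² / 2})` under the Hankel transforms is total. -/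
theorem isTotal_separated_gauss (hd : 1 ≤ d) (hν : ∀ α, 0 ≤ ν α) :
    IsTotal fun p : ι × Ioi (0 : ℝ) => separated
      (gaussLp d (ν p.1) (1 + 2 * (ν p.1 + 1) * p.2) (-(p.2 : ℝ) ^ 2) p.2) (φ p.1) := by
  intro f hf
  refine eq_zero_of_coeff hd φ fun α => ?_
  have hU := hankelOp_involution hd (hν α)
  have h1 : hankelOp d (ν α) (coeff (φ α) f) = 0 := by
    refine isTotal_gaussLp hd (hν α) zero_lt_one zero_le_one _ fun t => ?_
    -- The transform inverts the parameter of a Gaussian, so the family member with parameter `t⁻¹`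
    -- tests against `(1 + r²) g_t`.
    have ht : 0 < (t : ℝ)⁻¹ := inv_pos.2 t.2
    have h2 := hf (α, ⟨(t : ℝ)⁻¹, ht⟩)
    simp only at h2
    rw [inner_separated hd, ← hU.apply_apply (coeff (φ α) f), ← hU.inner_left,
      hankelOp_bessel hd (hν α) ht, gaussImage, inner_smul_left, inv_inv] at h2
    refine (mul_eq_zero.1 h2).resolve_left ?_
    rw [Complex.conj_ofReal]
    exact_mod_cast (Real.rpow_pos_of_pos ht _).ne'
  rw [← hU.apply_apply (coeff (φ α) f), h1, map_zero]

/-- The Hamiltonian acts as multiplication by `|x|²` after the Hankel transforms along an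
eigenbasis of the spherical operator. -/
theorem IsAdmissible.isDiagonalizedBy_hamiltonian {A : Sph d → Space d} {a : Sph d → ℝ}
    (ha : IsAdmissible A a) (hd : 2 ≤ d) (hν : ∀ α, 0 ≤ ν α)
    (hφ : ∀ α, IsSphericalEigenfunction A a (ν α ^ 2 - (((d : ℝ) - 2) / 2) ^ 2) (φ α)) :
    IsDiagonalizedBy (hamiltonian A a) (hankelTransport φ ν) fun x => ‖x‖ ^ 2 := by
  have hd1 : 1 ≤ d := by omega
  have hΨ := hankelTransport_involution (φ := φ) hd1 hν
  obtain ⟨c, hc, hqs⟩ := ha.exists_isPosForm ((((d : ℝ) - 2) / 2) ^ 2)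
  -- The eigenvalues are `ν²` minus the Hardy constant, so the spherical form is bounded below by
  -- minus that constant.
  have hS := form_lower_bound hqs φ
    (lam := fun α => ν α ^ 2 - (((d : ℝ) - 2) / 2) ^ 2)
    (fun α => by linarith [sq_nonneg (ν α)]) hc hφ
  have hq := ha.isPosForm_hamiltonianForm hd hS
  obtain ⟨T, -, hT, -⟩ := hq.exists_resolvent (testToL2Lin d)
  -- Written with `|t|`, the resolvent symbol is bounded on all of `ℝ`; it is evaluated only at `t =
  -- |x|²`.
  have hF : (fun x : Space d => (((1 + ‖x‖ ^ 2)⁻¹ : ℝ) : ℂ)) =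
      fun x => absResolvent (‖x‖ ^ 2) := by
    funext x
    rw [absResolvent, abs_of_nonneg (sq_nonneg _)]
  -- Both operators send `(1 + L) g_s φ_α` to `g_s φ_α`: the resolvent because `g_s φ_α` lies in the
  -- domain, the other because the Hankel transform turns `1 + L` into `1 + r²`. The family is
  -- total.
  have hTeq : T = hankelTransport φ ν *
      mulOp volume (fun x : Space d => (((1 + ‖x‖ ^ 2)⁻¹ : ℝ) : ℂ)) * hankelTransport φ ν := by
    refine (isTotal_separated_gauss (φ := φ) hd1 hν).clm_ext fun p => ?_
    obtain ⟨α, s⟩ := p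
    have hs : (0 : ℝ) < s := s.2
    have h1 := (hT _ _).1 (ha.mem_formGraph_gauss hd1 hq (hν α) hs (hφ α))
    rw [← separated_add hd1, gaussLp_add hd1 (hν α) _ _ _ _ hs, zero_add] at h1
    simp only
    rw [h1, mul_apply_eq_comp, mul_apply_eq_comp,
      hankelTransport_separated hd1 hν, hankelOp_bessel hd1 (hν α) hs, hF,
      mulOp_separated hd1 isBddMeas_absResolvent, mulOp_absResolvent_gaussImage hd1 (hν α) hs,
      hankelTransport_separated hd1 hν, ← hankelOp_gaussLp hd1 (hν α) hs,
      (hankelOp_involution hd1 (hν α)).apply_apply]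
  refine isDiagonalizedBy_friedrichs hΨ (measurable_norm.pow_const 2) (fun x => sq_nonneg _)
    fun u f => ?_
  rw [← hTeq]
  exact hT u f

theorem isAdmissible_of_contDiffOn {A : Sph d → Space d} {a : Sph d → ℝ}
    (hA : ContDiffOn ℝ 1 (homExt A) {0}ᶜ)
    (hA' : ∀ θ : Sph d, inner ℝ (A θ) (θ : Space d) = 0) (ha : MemLp a ⊤ (surfaceMeasure d)) :
    IsAdmissible A a where
  continuous := (hA.continuousOn.comp_continuous continuous_subtype_val
    fun θ => sphere_ne_zero θ).congr fun θ => homExt_coe A θ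
  transversal := hA'
  measurable := ha.aestronglyMeasurable
  bounded := by
    have h1 : eLpNormEssSup a (surfaceMeasure d) < ⊤ := by
      simpa using ha.eLpNorm_lt_top
    refine ⟨(eLpNormEssSup a (surfaceMeasure d)).toReal, ENNReal.toReal_nonneg, ?_⟩
    filter_upwards [ae_le_eLpNormEssSup (f := a) (μ := surfaceMeasure d)] with θ hθ
    have h2 := ENNReal.toReal_mono h1.ne hθ
    simpa using h2

theorem IsClusteredEigenbasis.neg_le_eigenvalue {ℓ ℓ₀ : ℕ} {A : Sph d → Space d} {a : Sph d → ℝ}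
    {C : ℝ} {low : Fin ℓ₀ → ℝ} {μ : (j : ℕ) → Fin (sphereMultiplicity d j) → ℝ}
    {e : HilbertBasis (Index d ℓ ℓ₀) ℂ (L2Sphere d)} (he : IsClusteredEigenbasis A a C low μ e)
    (α : Index d ℓ ℓ₀) : 0 ≤ eigenvalue low μ α + (((d : ℝ) - 2) / 2) ^ 2 := by
  rcases α with i | ⟨j, k⟩
  · have := he.low_ge i
    simp only [eigenvalue]
    linarith
  · simp only [eigenvalue]
    positivity

theorem IsClusteredEigenbasis.isDiagonalizedBy (hd : 2 ≤ d) {ℓ ℓ₀ : ℕ} {A : Sph d → Space d}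
    {a : Sph d → ℝ} (ha : IsAdmissible A a)
    {C : ℝ} {low : Fin ℓ₀ → ℝ} {μ : (j : ℕ) → Fin (sphereMultiplicity d j) → ℝ}
    {e : HilbertBasis (Index d ℓ ℓ₀) ℂ (L2Sphere d)} (he : IsClusteredEigenbasis A a C low μ e) :
    IsDiagonalizedBy (hamiltonian A a)
      (hankelTransport e fun α => besselOrder d (eigenvalue low μ α)) fun x => ‖x‖ ^ 2 := by
  refine ha.isDiagonalizedBy_hamiltonian hd (fun α => Real.sqrt_nonneg _) fun α => ?_
  rw [besselOrder, Real.sq_sqrt (he.neg_le_eigenvalue α), add_sub_cancel_right]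
  exact he.eigen α

end Diagonalization

end Intertwining

end

/-! ### The intertwining property. -/

theorem mainTheorem7 {d : ℕ} (hd : 2 ≤ d)
    (A : Intertwining.Sph d → Intertwining.Space d)
    (hA : ContDiffOn ℝ 1 (Intertwining.homExt A) {0}ᶜ)
    (hA_transversal : ∀ θ : Intertwining.Sph d, inner ℝ (A θ) (θ : Intertwining.Space d) = 0)
    (a : Intertwining.Sph d → ℝ) (ha : MemLp a ⊤ (Intertwining.surfaceMeasure d))
    (ℓ ℓ₀ : ℕ) (C : ℝ) (hC_pos : 0 < C) (hC_lt : C < 1 / 2)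
    (lowμ lowν : Fin ℓ₀ → ℝ)
    (μ ν : (j : ℕ) → Fin (Intertwining.sphereMultiplicity d j) → ℝ)
    (e φ : HilbertBasis (Intertwining.Index d ℓ ℓ₀) ℂ (Intertwining.L2Sphere d))
    (he : Intertwining.IsClusteredEigenbasis A 0 C lowμ μ e)
    (hφ : Intertwining.IsClusteredEigenbasis A a C lowν ν φ) :
    ∃ W : Intertwining.L2Space d →L[ℂ] Intertwining.L2Space d,
      (∀ f, HasSum (fun α => Intertwining.intertwiningTerm
        (Intertwining.eigenvalue lowμ μ α) (Intertwining.eigenvalue lowν ν α) (e α) (φ α) f)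
        (W f)) ∧
      (∀ f, HasSum (fun α => Intertwining.intertwiningTerm
        (Intertwining.eigenvalue lowν ν α) (Intertwining.eigenvalue lowμ μ α) (φ α) (e α) f)
        (star W f)) ∧
      W * star W = 1 ∧ star W * W = 1 ∧
      ∀ F : ℝ → ℂ, Measurable F → (∃ M : ℝ, ∀ x, ‖F x‖ ≤ M) →
        Intertwining.IsFunctionOf (Intertwining.hamiltonian A 0) F
          (Intertwining.borelFC (Intertwining.hamiltonian A 0) F) ∧
        Intertwining.IsFunctionOf (Intertwining.hamiltonian A a) F
          (Intertwining.borelFC (Intertwining.hamiltonian A a) F) ∧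
        Intertwining.borelFC (Intertwining.hamiltonian A a) F =
          W * Intertwining.borelFC (Intertwining.hamiltonian A 0) F * star W := by
  have hd1 : 1 ≤ d := by omega
  have h0 := Intertwining.isAdmissible_of_contDiffOn hA hA_transversal
    (a := 0) MemLp.zero
  have h1 := Intertwining.isAdmissible_of_contDiffOn hA hA_transversal ha
  have hμ : ∀ α, 0 ≤ Intertwining.besselOrder d (Intertwining.eigenvalue lowμ μ α :
    ℝ) := fun α : Intertwining.Index d ℓ ℓ₀ => Real.sqrt_nonneg _
  have hν : ∀ α, 0 ≤ Intertwining.besselOrder d (Intertwining.eigenvalue lowν ν α :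
    ℝ) := fun α : Intertwining.Index d ℓ ℓ₀ => Real.sqrt_nonneg _
  have hm : Measurable fun x : Intertwining.Space d => ‖x‖ ^ 2 := measurable_norm.pow_const 2
  refine ⟨Intertwining.waveOperator e φ _ _, Intertwining.hasSum_waveOperator hd1 hμ hν, ?_,
    Intertwining.waveOperator_mul_star hd1 hμ hν, Intertwining.star_mul_waveOperator hd1 hμ hν,
    fun F hF hF' => ?_⟩
  -- The adjoint is the operator of the same kind with the two bases and the two families of orders
  -- exchanged.
  · rw [Intertwining.star_waveOperator hd1 hμ hν]
    exact Intertwining.hasSum_waveOperator hd1 hν hμ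
  · have hB : Intertwining.IsBddMeas F := ⟨hF, hF'⟩
    have e0 := (he.isDiagonalizedBy hd h0).isFunctionOf
      (Intertwining.hankelTransport_involution hd1 hμ) hm hB
    have e1 := (hφ.isDiagonalizedBy hd h1).isFunctionOf
      (Intertwining.hankelTransport_involution hd1 hν) hm hB
    -- By uniqueness of the functional calculus, the chosen operators are the explicit ones `Ψ
    -- F(|x|²) Ψ`.
    rw [e0.borelFC_eq, e1.borelFC_eq]
    exact ⟨e0, e1, (Intertwining.waveOperator_conj hd1 hμ hν hB).symm⟩
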